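/- **Theorem 1.2.** *Setting.* Let $G$ be a 3-dimensional Lie group whose Lie algebra $\mathfrak g$ is non-unimodular (that is, $\operatorname{tr}\operatorname{ad}_x\neq 0$ for some $x\in\mathfrak g$), and let $\mathfrak u=\{x\in\mathfrak g\mid \operatorname{tr}\operatorname{ad}_x=0\}$ be its unimodular kernel. Let $H$ be a left-invariant 3-form and $F$ a left-invariant closed 2-form on $G$ with $F\neq 0$. On $E=TG\oplus T^*G\oplus\mathbb R$, with anchor $\pi$ the projection to $TG$ and $\langle X+\xi+a,\,Y+\eta+b\rangle=\tfrac12(\xi(Y)+\eta(X))+ab$, the Dorfman bracket is $$[X+\xi+a,\,Y+\eta+b]=\mathcal L_X(Y+\eta)-i_Yd\xi+2b\,da+i_Xi_YH-2(b\,i_XF-a\,i_YF)+X(b)-Y(a)+F(X,Y).$$ For a left-invariant pseudo-Riemannian metric $g$ on $G$ put $E_-=\{X-g(X)\mid X\in TG\}$ and $E_+=E_-^{\perp}$. A *generalized connection* is a map $D:\Gamma(E)\times\Gamma(E)\to\Gamma(E)$, $(u,v)\mapsto D_uv$, which is $C^\infty(G)$-linear in $u$, additive in $v$, with $D_u(fv)=\pi(u)(f)v+fD_uv$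 and $\pi(u)\langle v,w\rangle=\langle D_uv,w\rangle+\langle v,D_uw\rangle$. It is a *Levi-Civita generalized connection* of $E_-$ if $D_u\Gamma(E_-)\subset\Gamma(E_-)$ and $\langle D_uv-D_vu-[u,v],w\rangle+\langle v,D_wu\rangle=0$ for all $u,v,w$. Its divergence is $\delta^D(u)=\operatorname{tr}(Du)$. A left-invariant divergence operator is identified with an element $\delta\in(\mathfrak g\oplus\mathfrak g^*\oplus\mathbb R)^*$ through its (constant) values on left-invariant sections. With $R^D(u,v)w=D_uD_vw-D_vD_uw-D_{[u,v]}w$, the Ricci tensors of $(E_-,\delta)$ are $$\mathrm{Ric}^{\pm}(u,v)=\operatorname{tr}_{E_\pm}\bigl(R^D(\cdot,u)v\bigr),\qquad u\in E_\mp,\ v\in E_\pm,$$ for any Levi-Civita generalized connection $D$ of $E_-$ with $\delta^D=\delta$. We call $(E_-,H,F,\delta)$ an *odd generalized Einstein metric on $G$ with divergence $\delta$* if $\mathrm{Ric}^+=0$ and $\mathrm{Ric}^-=0$; it is *divergence-free* if $\delta=0$ and *has non-zero divergence* if $\delta\ne0$. Let $\tau_2(\mathbb R)\oplus\mathbb R$,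 $\tau_3(\mathbb R)$, $\tau_{3,\lambda}(\mathbb R)$ ($\lambda\neq-1$, $0<|\lambda|\le1$) and $\tau'_{3,\lambda}(\mathbb R)$ ($\lambda\ne0$) be the Lie algebras $\mathbb R\ltimes_A\mathbb R^2$, where $1\in\mathbb R$ acts on the abelian ideal $\mathbb R^2$ by, respectively, $$A=\begin{pmatrix}1&0\\0&0\end{pmatrix},\quad\begin{pmatrix}1&1\\0&1\end{pmatrix},\quad\begin{pmatrix}1&0\\0&\lambda\end{pmatrix},\quad\begin{pmatrix}\lambda&-1\\1&\lambda\end{pmatrix}.$$ *(i)* There exist odd generalized Einstein metrics on $G$ with $g|_{\mathfrak u\times\mathfrak u}$ degenerate. If $\mathfrak g$ is isomorphic to $\tau_2(\mathbb R)\oplus\mathbb R$, $\tau_3(\mathbb R)$ or some $\tau_{3,\lambda}(\mathbb R)$, then there exist divergence-free ones and there exist ones with non-zero divergence, all with $g|_{\mathfrak u\times\mathfrak u}$ degenerate. If $\mathfrak g$ is isomorphic to some $\tau'_{3,\lambda}(\mathbb R)$, then every odd generalized Einstein metric on $G$ with $g|_{\mathfrak u\times\mathfrak u}$ degenerate has non-zero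 divergence. *(ii)* There exist odd generalized Einstein metrics on $G$ with $g|_{\mathfrak u\times\mathfrak u}$ non-degenerate if and only if $\mathfrak g$ is isomorphic to $\tau_2(\mathbb R)\oplus\mathbb R$, $\tau_{3,\frac12}(\mathbb R)$ or $\tau_{3,-\frac12}(\mathbb R)$. All such metrics have non-zero divergence. -/

import Mathlib

open scoped Manifold ContDiff

namespace OddGen

/-! ### The Lie algebras `ℝ ⋉_A ℝ²` -/

/-- The semi-direct product `ℝ ⋉_A ℝ²` of the line and the abelian Lie algebra `ℝ²`, on which
`1 ∈ ℝ` acts by the matrix `A`. The pair `(t, x)` stands for `t + x`. -/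
@[ext] structure SemiDir (A : Matrix (Fin 2) (Fin 2) ℝ) where
  t : ℝ
  x : Fin 2 → ℝ

namespace SemiDir

variable (A : Matrix (Fin 2) (Fin 2) ℝ)

/-- The underlying set of `ℝ ⋉_A ℝ²` is a product. -/
def toProd : SemiDir A ≃ ℝ × (Fin 2 → ℝ) where
  toFun p := (p.t, p.x)
  invFun q := ⟨q.1, q.2⟩
  left_inv _ := rfl
  right_inv _ := rfl

noncomputable instance : AddCommGroup (SemiDir A) := (toProd A).addCommGroup

noncomputable instance : Module ℝ (SemiDir A) := (toProd A).module ℝ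

/-- `[s + x, t + y] = s A y - t A x`. -/
noncomputable instance : Bracket (SemiDir A) (SemiDir A) where
  bracket p q := ⟨0, p.t • A.mulVec q.x - q.t • A.mulVec p.x⟩

variable {A}

theorem lie_t (p q : SemiDir A) : ⁅p, q⁆.t = 0 := rfl

theorem lie_x (p q : SemiDir A) : ⁅p, q⁆.x = p.t • A.mulVec q.x - q.t • A.mulVec p.x := rfl

theorem zero_t : (0 : SemiDir A).t = 0 := rfl

theorem zero_x : (0 : SemiDir A).x = 0 := rfl

theorem add_t (p q : SemiDir A) : (p + q).t = p.t + q.t := rfl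

theorem add_x (p q : SemiDir A) : (p + q).x = p.x + q.x := rfl

theorem smul_t (c : ℝ) (p : SemiDir A) : (c • p).t = c * p.t := rfl

theorem smul_x (c : ℝ) (p : SemiDir A) : (c • p).x = c • p.x := rfl

noncomputable instance : LieRing (SemiDir A) where
  add_lie p q r := by
    apply SemiDir.ext
    · simp only [lie_t, add_t, add_zero]
    · simp only [lie_x, add_t, add_x, Matrix.mulVec_add, smul_add, add_smul]
      abel
  lie_add p q r := by
    apply SemiDir.ext
    · simp only [lie_t, add_t, add_zero]
    · simp only [lie_x, add_t, add_x, Matrix.mulVec_add, smul_add, add_smul]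
      abel
  lie_self p := by
    apply SemiDir.ext
    · simp only [lie_t, zero_t]
    · simp only [lie_x, zero_x, sub_self]
  leibniz_lie p q r := by
    apply SemiDir.ext
    · simp only [lie_t, add_t, add_zero]
    · simp only [lie_x, lie_t, add_x, Matrix.mulVec_sub, Matrix.mulVec_smul, smul_sub, zero_smul,
        smul_comm q.t p.t, smul_comm r.t p.t, smul_comm r.t q.t]
      abel

noncomputable instance : LieAlgebra ℝ (SemiDir A) where
  lie_smul c p q := by
    apply SemiDir.ext
    · simp only [lie_t, smul_t, mul_zero]
    · simp only [lie_x, smul_t, smul_x, Matrix.mulVec_smul, smul_sub, mul_smul, smul_comm p.t c]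

end SemiDir

/-- The Lie algebra `τ₂(ℝ) ⊕ ℝ`. -/
abbrev Tau2R : Type := SemiDir !![1, 0; 0, 0]

/-- The Lie algebra `τ₃(ℝ)`. -/
abbrev Tau3 : Type := SemiDir !![1, 1; 0, 1]

/-- The Lie algebra `τ_{3,l}(ℝ)`, where `l ≠ -1` and `0 < |l| ≤ 1`. -/
abbrev Tau3p (l : ℝ) : Type := SemiDir !![1, 0; 0, l]

/-- The Lie algebra `τ'_{3,l}(ℝ)`, where `l ≠ 0`. -/
abbrev Tau3p' (l : ℝ) : Type := SemiDir !![l, -1; 1, l]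

/-- Three-dimensional Euclidean space, on which all Lie groups below are modelled. -/
abbrev E3 : Type := EuclideanSpace ℝ (Fin 3)

/-- The trace of the map `φ`, which is required to restrict to a linear endomorphism of the
subspace `S`, is defined and equal to `t`. -/
def HasTraceOn {V : Type*} [AddCommGroup V] [Module ℝ V] (S : Submodule ℝ V) (φ : V → V) (t : ℝ) :
    Prop :=
  ∃ T : S →ₗ[ℝ] S, (∀ w : S, (T w : V) = φ w) ∧ LinearMap.trace ℝ S T = t

section Group

variable {G : Type*} [TopologicalSpace G] [ChartedSpace E3 G]

instance (x : G) : Module.Finite ℝ (TangentSpace (𝓡 3) x) :=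
  inferInstanceAs (Module.Finite ℝ (EuclideanSpace ℝ (Fin 3)))

variable [Group G] [LieGroup (𝓡 3) ∞ G]

instance : LieGroup (𝓡 3) (minSmoothness ℝ 3) G := by
  rw [minSmoothness_of_isRCLikeNormedField]
  infer_instance

/-! ### Smooth functions, vector fields and sections of `TG ⊕ T*G ⊕ ℝ` -/

/-- The fibre at `x` of the bundle `E = TG ⊕ T*G ⊕ ℝ`. -/
abbrev Fib (x : G) : Type _ :=
  TangentSpace (𝓡 3) x × Module.Dual ℝ (TangentSpace (𝓡 3) x) × ℝ

/-- Vector fields on `G`, not necessarily smooth. -/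
abbrev VF (G : Type*) [TopologicalSpace G] [ChartedSpace E3 G] : Type _ :=
  Π x : G, TangentSpace (𝓡 3) x

/-- One-forms on `G`, not necessarily smooth. -/
abbrev OneForm (G : Type*) [TopologicalSpace G] [ChartedSpace E3 G] : Type _ :=
  Π x : G, Module.Dual ℝ (TangentSpace (𝓡 3) x)

/-- Sections `X + ξ + f` of `E`, not necessarily smooth. -/
abbrev Sec (G : Type*) [TopologicalSpace G] [ChartedSpace E3 G] : Type _ :=
  Π x : G, Fib x

/-- The vector field part of a section; this is the anchor `π`. -/
def Sec.vec (u : Sec G) : VF G := fun x => (u x).1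

/-- The one-form part of a section. -/
def Sec.form (u : Sec G) : OneForm G := fun x => (u x).2.1

/-- The function part of a section. -/
def Sec.fn (u : Sec G) : G → ℝ := fun x => (u x).2.2

def SmoothFn (f : G → ℝ) : Prop := ContMDiff (𝓡 3) 𝓘(ℝ, ℝ) ∞ f

def SmoothVF (X : VF G) : Prop :=
  ContMDiff (𝓡 3) (𝓡 3).tangent ∞ (fun x => (⟨x, X x⟩ : TangentBundle (𝓡 3) G))

/-- A one-form is smooth if its value on every smooth vector field is smooth. -/
def SmoothForm (ξ : OneForm G) : Prop :=
  ∀ Z : VF G, SmoothVF Z → SmoothFn (fun x => ξ x (Z x))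

/-- `u ∈ Γ(E)`. -/
structure SmoothSec (u : Sec G) : Prop where
  vec : SmoothVF u.vec
  form : SmoothForm u.form
  fn : SmoothFn u.fn

/-- The derivative `X(f)` of a function along a vector field. -/
noncomputable def dirD (X : VF G) (f : G → ℝ) : G → ℝ :=
  fun x => mfderiv (𝓡 3) 𝓘(ℝ, ℝ) f x (X x)

/-- The scalar product `⟨X + ξ + a, Y + η + b⟩ = (ξ(Y) + η(X)) / 2 + a b` on the fibre at `x`. -/
noncomputable def pairing (x : G) : LinearMap.BilinForm ℝ (Fib x) :=
  LinearMap.mk₂ ℝ (fun p q => (1 / 2) * (p.2.1 q.1 + q.2.1 p.1) + p.2.2 * q.2.2)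
    (by intro p p' q; simp; ring) (by intro c p q; simp; ring)
    (by intro p q q'; simp; ring) (by intro c p q; simp; ring)

/-! ### Left-invariant objects -/

/-- The Lie algebra `𝔤` of `G`. -/
abbrev LieAlg (G : Type*) [TopologicalSpace G] [ChartedSpace E3 G] [Group G] : Type _ :=
  GroupLieAlgebra (𝓡 3) G

/-- The differential at the identity of the left translation by `x`. -/
noncomputable def dL (x : G) : LieAlg G →ₗ[ℝ] TangentSpace (𝓡 3) x :=
  (mfderiv (𝓡 3) (𝓡 3) (fun y : G => x * y) 1).toLinearMap

/-- The Maurer-Cartan form: the differential at `x` of the left translation by `x⁻¹`. -/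
noncomputable def mc (x : G) : TangentSpace (𝓡 3) x →ₗ[ℝ] LieAlg G :=
  (mfderiv (𝓡 3) (𝓡 3) (fun y : G => x⁻¹ * y) x).toLinearMap

/-- The left-invariant section with value `a` at the identity. This identifies the fibre
`𝔤 ⊕ 𝔤* ⊕ ℝ` at the identity with the space of left-invariant sections of `E`. -/
noncomputable def leftInv (a : Fib (1 : G)) : Sec G :=
  fun x => (dL x a.1, a.2.1 ∘ₗ mc x, a.2.2)

/-- The left-invariant vector field with value `z` at the point `x`. -/
noncomputable def extVF {x : G} (z : TangentSpace (𝓡 3) x) : VF G := fun y => dL y (mc x z)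

/-- The left-invariant section with value `w` at the point `x`. -/
noncomputable def extSec {x : G} (w : Fib x) : Sec G :=
  leftInv (mc x w.1, w.2.1 ∘ₗ dL x, w.2.2)

variable (G) in
/-- Left-invariant `k`-forms, identified with their value at the identity. -/
abbrev InvForm (k : ℕ) : Type _ := LieAlg G [⋀^Fin k]→ₗ[ℝ] ℝ

/-- The value at `x` of the left-invariant two-form `F`. -/
noncomputable def evalF (F : InvForm G 2) (x : G) (X Y : TangentSpace (𝓡 3) x) : ℝ :=
  F ![mc x X, mc x Y]

/-- The value at `x` of the left-invariant three-form `H`. -/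
noncomputable def evalH (H : InvForm G 3) (x : G) (X Y Z : TangentSpace (𝓡 3) x) : ℝ :=
  H ![mc x X, mc x Y, mc x Z]

/-- The value at `x` of the left-invariant symmetric bilinear form `g`. -/
noncomputable def evalG (g : LinearMap.BilinForm ℝ (LieAlg G)) (x : G) :
    LinearMap.BilinForm ℝ (TangentSpace (𝓡 3) x) :=
  g.compl₁₂ (mc x) (mc x)

/-! ### The Dorfman bracket -/

/-- `(L_X η)(z) = X(η(Z)) - η([X, Z])` at `x`, where `Z` extends `z`. -/
noncomputable def lieForm (X : VF G) (η : OneForm G) (x : G) (z : TangentSpace (𝓡 3) x) : ℝ :=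
  dirD X (fun y => η y (extVF z y)) x - η x (VectorField.mlieBracket (𝓡 3) X (extVF z) x)

/-- `(dξ)(Y, z) = Y(ξ(Z)) - Z(ξ(Y)) - ξ([Y, Z])` at `x`, where `Z` extends `z`. -/
noncomputable def dForm (ξ : OneForm G) (Y : VF G) (x : G) (z : TangentSpace (𝓡 3) x) : ℝ :=
  dirD Y (fun y => ξ y (extVF z y)) x - dirD (extVF z) (fun y => ξ y (Y y)) x
    - ξ x (VectorField.mlieBracket (𝓡 3) Y (extVF z) x)

/-- The value at `z ∈ T_x G` of the one-form part of the Dorfman bracket of `u = X + ξ + a` and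
`v = Y + η + b`, that is of
`L_X η - i_Y dξ + 2 b da + i_X i_Y H - 2 (b i_X F - a i_Y F)`. -/
noncomputable def dorfmanForm (H : InvForm G 3) (F : InvForm G 2) (u v : Sec G) (x : G)
    (z : TangentSpace (𝓡 3) x) : ℝ :=
  lieForm u.vec v.form x z - dForm u.form v.vec x z + 2 * v.fn x * dirD (extVF z) u.fn x
    + evalH H x (v.vec x) (u.vec x) z
    - 2 * (v.fn x * evalF F x (u.vec x) z - u.fn x * evalF F x (v.vec x) z)

/-- The Dorfman bracket `[u, v]_{H, F}`. Its one-form part is the linear form on `T_x G` which is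
given on a basis by `dorfmanForm` (which is linear in `z` if `u` and `v` are smooth). -/
noncomputable def dorfman (H : InvForm G 3) (F : InvForm G 2) (u v : Sec G) : Sec G := fun x =>
  (VectorField.mlieBracket (𝓡 3) u.vec v.vec x,
    (Module.finBasis ℝ (TangentSpace (𝓡 3) x)).constr ℝ
      (fun i => dorfmanForm H F u v x (Module.finBasis ℝ (TangentSpace (𝓡 3) x) i)),
    dirD u.vec v.fn x - dirD v.vec u.fn x + evalF F x (u.vec x) (v.vec x))

/-! ### Generalized metrics and generalized connections -/

/-- The fibre at `x` of `E₋ = {X - g(X) | X ∈ TG}`. -/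
noncomputable def Eminus (g : LinearMap.BilinForm ℝ (LieAlg G)) (x : G) : Submodule ℝ (Fib x) :=
  LinearMap.range ((LinearMap.id : TangentSpace (𝓡 3) x →ₗ[ℝ] _).prod ((-evalG g x).prod 0))

/-- The fibre at `x` of the orthogonal complement `E₊` of `E₋`. -/
noncomputable def Eplus (g : LinearMap.BilinForm ℝ (LieAlg G)) (x : G) : Submodule ℝ (Fib x) :=
  (pairing x).orthogonal (Eminus g x)

/-- `D` is a generalized connection on `E`. Only the values on smooth sections matter. -/
structure IsGenConnection (D : Sec G → Sec G → Sec G) : Prop where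
  smooth : ∀ u v, SmoothSec u → SmoothSec v → SmoothSec (D u v)
  add_left : ∀ u u' v, SmoothSec u → SmoothSec u' → SmoothSec v → D (u + u') v = D u v + D u' v
  smul_left : ∀ (f : G → ℝ) (u v), SmoothFn f → SmoothSec u → SmoothSec v →
    D (fun x => f x • u x) v = fun x => f x • D u v x
  add_right : ∀ u v v', SmoothSec u → SmoothSec v → SmoothSec v' → D u (v + v') = D u v + D u v'
  leibniz : ∀ (f : G → ℝ) (u v), SmoothFn f → SmoothSec u → SmoothSec v →
    D u (fun x => f x • v x) = fun x => dirD u.vec f x • v x + f x • D u v x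
  metric : ∀ u v w, SmoothSec u → SmoothSec v → SmoothSec w → ∀ x,
    dirD u.vec (fun y => pairing y (v y) (w y)) x
      = pairing x (D u v x) (w x) + pairing x (v x) (D u w x)

/-- `D` is a Levi-Civita generalized connection of `E₋ = {X - g(X) | X ∈ TG}` on `E_{H,F}`: it is
torsion-free and preserves `E₋`. -/
structure IsLeviCivita (H : InvForm G 3) (F : InvForm G 2) (g : LinearMap.BilinForm ℝ (LieAlg G))
    (D : Sec G → Sec G → Sec G) : Prop extends IsGenConnection D where
  torsion_free : ∀ u v w, SmoothSec u → SmoothSec v → SmoothSec w → ∀ x,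
    pairing x (D u v x - D v u x - dorfman H F u v x) (w x) + pairing x (v x) (D w u x) = 0
  preserves : ∀ u v, SmoothSec u → SmoothSec v → (∀ x, v x ∈ Eminus g x) →
    ∀ x, D u v x ∈ Eminus g x

/-- The divergence `u ↦ tr (D u)` of `D` is the left-invariant divergence operator `δ`. Divergence
operators satisfy `δ(f u) = π(u)(f) + f δ(u)`, hence are determined by their values on
left-invariant sections; these are constant if the operator is left-invariant, which is therefore
identified with a linear form `δ` on `𝔤 ⊕ 𝔤* ⊕ ℝ`. -/
def HasDivergence (D : Sec G → Sec G → Sec G) (δ : Module.Dual ℝ (Fib (1 : G))) : Prop :=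
  ∀ (a : Fib (1 : G)) (x : G),
    HasTraceOn (⊤ : Submodule ℝ (Fib x)) (fun w => D (extSec w) (leftInv a) x) (δ a)

/-- The curvature `R(u, v) w = D_u D_v w - D_v D_u w - D_{[u, v]} w`. -/
noncomputable def curv (H : InvForm G 3) (F : InvForm G 2) (D : Sec G → Sec G → Sec G)
    (u v w : Sec G) : Sec G :=
  D u (D v w) - D v (D u w) - D (dorfman H F u v) w

/-- The Ricci tensors of `D` vanish: the trace over `E₊` of `R(·, u) v` is zero for all `u ∈ E₋`,
`v ∈ E₊`, and the trace over `E₋` of `R(·, u) v` is zero for all `u ∈ E₊`, `v ∈ E₋`. Since these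
restrictions of `R` are tensors, they are evaluated at `x` on left-invariant extensions. -/
def RicciFlat (H : InvForm G 3) (F : InvForm G 2) (g : LinearMap.BilinForm ℝ (LieAlg G))
    (D : Sec G → Sec G → Sec G) : Prop :=
  ∀ x : G,
    (∀ u ∈ Eminus g x, ∀ v ∈ Eplus g x,
      HasTraceOn (Eplus g x) (fun w => curv H F D (extSec w) (extSec u) (extSec v) x) 0) ∧
    (∀ u ∈ Eplus g x, ∀ v ∈ Eminus g x,
      HasTraceOn (Eminus g x) (fun w => curv H F D (extSec w) (extSec u) (extSec v) x) 0)

/-! ### Odd generalized Einstein metrics -/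

/-- The left-invariant two-form `F` is closed: `dF(X, Y, Z) = 0` for all left-invariant vector
fields. -/
def IsClosedForm (F : InvForm G 2) : Prop :=
  ∀ X Y Z : LieAlg G, F ![⁅X, Y⁆, Z] + F ![⁅Y, Z⁆, X] + F ![⁅Z, X⁆, Y] = 0

/-- `E₋ = {X - g(X) | X ∈ TG}`, for the left-invariant pseudo-Riemannian metric `g`, is an odd
generalized Einstein metric with (left-invariant) divergence `δ` on the Courant algebroid `E_{H,F}`
over `G`. The Courant algebroid axioms amount to `dF = 0` and `dH + F ∧ F = 0`; the second equation
is one of four-forms, and holds trivially in dimension three. The Ricci tensor of `(E₋, δ)` is the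
one of any Levi-Civita generalized connection of `E₋` with divergence `δ`. -/
structure IsOddEinstein (H : InvForm G 3) (F : InvForm G 2) (g : LinearMap.BilinForm ℝ (LieAlg G))
    (δ : Module.Dual ℝ (Fib (1 : G))) : Prop where
  closed : IsClosedForm F
  symm : ∀ X Y, g X Y = g Y X
  nondegenerate : g.Nondegenerate
  exists_connection : ∃ D, IsLeviCivita H F g D ∧ HasDivergence D δ
  ricci : ∀ D, IsLeviCivita H F g D → HasDivergence D δ → RicciFlat H F g D

variable (G) in
/-- The unimodular kernel `{X ∈ 𝔤 | tr (ad X) = 0}` of `𝔤`. -/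
noncomputable def unimodKernel : Submodule ℝ (LieAlg G) :=
  LinearMap.ker
    (LinearMap.trace ℝ (LieAlg G) ∘ₗ (LieAlgebra.ad ℝ (LieAlg G) : LieAlg G →ₗ[ℝ] _))

variable (G) in
/-- The Lie algebra of `G` is isomorphic to `L`. -/
def HasLieAlg (L : Type) [LieRing L] [LieAlgebra ℝ L] : Prop := Nonempty (LieAlg G ≃ₗ⁅ℝ⁆ L)

/-- The restriction of `g` to the unimodular kernel is non-degenerate. -/
def NondegOnKernel (g : LinearMap.BilinForm ℝ (LieAlg G)) : Prop :=
  (g.restrict (unimodKernel G)).Nondegenerate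

end Group

end OddGen

open OddGen

set_option linter.unusedSectionVars false

namespace OddGen

/-! ### Calculus of smooth functions and vector fields on `G`. -/

section Analysis

variable {G : Type*} [TopologicalSpace G] [ChartedSpace E3 G] [Group G] [LieGroup (𝓡 3) ∞ G]

theorem SmoothFn.add {f f' : G → ℝ} (hf : SmoothFn f) (hf' : SmoothFn f') :
    SmoothFn (fun x => f x + f' x) := ContMDiff.add hf hf'

theorem SmoothFn.mul {f f' : G → ℝ} (hf : SmoothFn f) (hf' : SmoothFn f') :
    SmoothFn (fun x => f x * f' x) := ContMDiff.mul hf hf'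

theorem SmoothFn.sum {ι : Type*} (s : Finset ι) {f : ι → G → ℝ} (hf : ∀ i, SmoothFn (f i)) :
    SmoothFn (fun x => ∑ i ∈ s, f i x) := contMDiff_finsetSum fun i _ => hf i

theorem smoothFn_const (c : ℝ) : SmoothFn (fun _ : G => c) := contMDiff_const

theorem SmoothFn.mdifferentiableAt {f : G → ℝ} (hf : SmoothFn f) (x : G) :
    MDifferentiableAt (𝓡 3) 𝓘(ℝ, ℝ) f x := ContMDiff.mdifferentiableAt hf (by simp)

theorem SmoothVF.mdifferentiableAt {X : VF G} (hX : SmoothVF X) (x : G) :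
    MDifferentiableAt (𝓡 3) (𝓡 3).tangent
      (fun x => (⟨x, X x⟩ : TangentBundle (𝓡 3) G)) x :=
  ContMDiff.mdifferentiableAt hX (by simp)

theorem SmoothVF.smul {f : G → ℝ} {X : VF G} (hf : SmoothFn f) (hX : SmoothVF X) :
    SmoothVF (fun x => f x • X x) := ContMDiff.smul_section hf hX

theorem SmoothVF.sum {ι : Type*} (s : Finset ι) {X : ι → VF G} (hX : ∀ i, SmoothVF (X i)) :
    SmoothVF (fun x => ∑ i ∈ s, X i x) := ContMDiff.sum_section fun i _ => hX i

theorem dirD_eq_mvfderiv (X : VF G) (f : G → ℝ) (x : G) :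
    dirD X f x = mvfderiv (𝓡 3) f x (X x) := rfl

theorem dirD_const (X : VF G) (c : ℝ) (x : G) : dirD X (fun _ => c) x = 0 := by
  rw [dirD_eq_mvfderiv, mvfderiv_const]; rfl

theorem dirD_add (X : VF G) {f f' : G → ℝ} (hf : SmoothFn f) (hf' : SmoothFn f') (x : G) :
    dirD X (fun y => f y + f' y) x = dirD X f x + dirD X f' x := by
  rw [dirD_eq_mvfderiv, mvfderiv_fun_add (hf.mdifferentiableAt x) (hf'.mdifferentiableAt x)]; rfl

theorem dirD_mul (X : VF G) {f f' : G → ℝ} (hf : SmoothFn f) (hf' : SmoothFn f') (x : G) :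
    dirD X (fun y => f y * f' y) x = f x * dirD X f' x + f' x * dirD X f x := by
  rw [dirD_eq_mvfderiv, mvfderiv_fun_mul (hf.mdifferentiableAt x) (hf'.mdifferentiableAt x)]; rfl

theorem dirD_mul_const (X : VF G) {f : G → ℝ} (hf : SmoothFn f) (c : ℝ) (x : G) :
    dirD X (fun y => f y * c) x = dirD X f x * c := by
  rw [dirD_mul X hf (smoothFn_const c), dirD_const]; ring

theorem dirD_sum (X : VF G) {ι : Type*} (s : Finset ι) {f : ι → G → ℝ}
    (hf : ∀ i, SmoothFn (f i)) (x : G) :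
    dirD X (fun y => ∑ i ∈ s, f i y) x = ∑ i ∈ s, dirD X (f i) x := by
  classical
  induction s using Finset.induction_on with
  | empty => simpa using dirD_const X 0 x
  | insert i s hi ih =>
    simp only [Finset.sum_insert hi]
    rw [dirD_add X (hf i) (SmoothFn.sum s hf), ih]

theorem dirD_add_left (X Y : VF G) (f : G → ℝ) (x : G) :
    dirD (fun y => X y + Y y) f x = dirD X f x + dirD Y f x :=
  map_add (mvfderiv (𝓡 3) f x) _ _

theorem dirD_smul_left (c : G → ℝ) (X : VF G) (f : G → ℝ) (x : G) :
    dirD (fun y => c y • X y) f x = c x * dirD X f x :=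
  map_smul (mvfderiv (𝓡 3) f x) _ _

theorem dirD_congr {X Y : VF G} {x : G} (h : X x = Y x) (f : G → ℝ) :
    dirD X f x = dirD Y f x := congrArg (mvfderiv (𝓡 3) f x) h

theorem SmoothFn.dirD {X : VF G} (hX : SmoothVF X) {f : G → ℝ}
    (hf : SmoothFn f) : SmoothFn (OddGen.dirD X f) := by
  have h1 := (ContMDiff.contMDiff_tangentMap (n := ∞) hf (m := ∞) (by simp)).comp hX
  exact (contMDiff_snd_tangentBundle_modelSpace ℝ 𝓘(ℝ, ℝ)).comp h1

/-! ### Functions with values in a finite-dimensional space -/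

variable {V W : Type*} [AddCommGroup V] [Module ℝ V] [AddCommGroup W] [Module ℝ W]

/-- A function with values in a finite-dimensional space all of whose components are smooth. -/
def SmoothVec (s : G → V) : Prop := ∀ φ : Module.Dual ℝ V, SmoothFn (fun x => φ (s x))

theorem smoothVec_const (v : V) : SmoothVec (fun _ : G => v) := fun _ => smoothFn_const _

theorem SmoothVec.add {s t : G → V} (hs : SmoothVec s) (ht : SmoothVec t) :
    SmoothVec (fun x => s x + t x) := fun φ => by
  simpa only [map_add] using (hs φ).add (ht φ)

theorem SmoothVec.smul {f : G → ℝ} {s : G → V} (hf : SmoothFn f) (hs : SmoothVec s) :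
    SmoothVec (fun x => f x • s x) := fun φ => by
  simpa only [map_smul, smul_eq_mul] using hf.mul (hs φ)

theorem SmoothVec.comp (A : V →ₗ[ℝ] W) {s : G → V} (hs : SmoothVec s) :
    SmoothVec (fun x => A (s x)) := fun φ => hs (φ ∘ₗ A)

theorem SmoothVec.sum {ι : Type*} (s : Finset ι) {f : ι → G → V} (hf : ∀ i, SmoothVec (f i)) :
    SmoothVec (fun x => ∑ i ∈ s, f i x) := fun φ => by
  simpa only [map_sum] using SmoothFn.sum s fun i => hf i φ

variable [Module.Finite ℝ V] [Module.Finite ℝ W]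

theorem map_eq_sum_coord {U : Type*} [AddCommGroup U] [Module ℝ U] (A : V →ₗ[ℝ] U) (v : V) :
    A v = ∑ i, (Module.finBasis ℝ V).coord i v • A (Module.finBasis ℝ V i) := by
  conv_lhs => rw [← (Module.finBasis ℝ V).sum_repr v]
  simp only [map_sum, map_smul, Module.Basis.coord_apply]

theorem SmoothVec.bilin {U : Type*} [AddCommGroup U] [Module ℝ U] (A : V →ₗ[ℝ] W →ₗ[ℝ] U)
    {s : G → V} {t : G → W} (hs : SmoothVec s) (ht : SmoothVec t) :
    SmoothVec (fun x => A (s x) (t x)) := by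
  have e : (fun x => A (s x) (t x)) = fun x => ∑ i, ((Module.finBasis ℝ V).coord i (s x)) •
      A (Module.finBasis ℝ V i) (t x) := by
    funext x
    exact map_eq_sum_coord (A.flip (t x)) (s x)
  rw [e]
  exact SmoothVec.sum _ fun i => SmoothVec.smul (hs _) (ht.comp _)

/-- The derivative along a vector field of a function with values in a finite-dimensional space. -/
noncomputable def vecD (X : VF G) (s : G → V) (x : G) : V :=
  ∑ i, dirD X (fun y => (Module.finBasis ℝ V).coord i (s y)) x • Module.finBasis ℝ V i

/-- This characterizes `vecD` independently of the basis in its definition; the rules for `vecD`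
follow by testing against linear forms. -/
theorem dual_vecD (φ : Module.Dual ℝ V) (X : VF G) {s : G → V} (hs : SmoothVec s) (x : G) :
    φ (vecD X s x) = dirD X (fun y => φ (s y)) x := by
  have e : (fun y => φ (s y)) = fun y => ∑ i, (Module.finBasis ℝ V).coord i (s y) *
      φ (Module.finBasis ℝ V i) := by
    funext y
    exact map_eq_sum_coord φ (s y)
  rw [e, dirD_sum X _ fun i => (hs _).mul (smoothFn_const _), vecD, map_sum]
  refine Finset.sum_congr rfl fun i _ => ?_
  rw [dirD_mul_const X (hs _), map_smul, smul_eq_mul]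

theorem eq_of_forall_dual {v w : V} (h : ∀ φ : Module.Dual ℝ V, φ v = φ w) : v = w :=
  (Module.forall_dual_apply_eq_zero_iff ℝ (v - w)).1 (fun φ => by rw [map_sub, h, sub_self])
    |> sub_eq_zero.1

theorem vecD_map (A : V →ₗ[ℝ] W) (X : VF G) {s : G → V} (hs : SmoothVec s) (x : G) :
    vecD X (fun y => A (s y)) x = A (vecD X s x) :=
  eq_of_forall_dual fun φ => by
    rw [dual_vecD _ _ (hs.comp A)]
    exact (dual_vecD (φ ∘ₗ A) X hs x).symm

theorem vecD_const (X : VF G) (v : V) (x : G) : vecD X (fun _ => v) x = 0 :=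
  eq_of_forall_dual fun φ => by rw [dual_vecD _ _ (smoothVec_const v), dirD_const, map_zero]

theorem vecD_add (X : VF G) {s t : G → V} (hs : SmoothVec s) (ht : SmoothVec t) (x : G) :
    vecD X (fun y => s y + t y) x = vecD X s x + vecD X t x :=
  eq_of_forall_dual fun φ => by
    rw [dual_vecD _ _ (hs.add ht), map_add, dual_vecD _ _ hs, dual_vecD _ _ ht]
    simp only [map_add]
    exact dirD_add X (hs φ) (ht φ) x

theorem vecD_smul (X : VF G) {f : G → ℝ} {s : G → V} (hf : SmoothFn f) (hs : SmoothVec s) (x : G) :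
    vecD X (fun y => f y • s y) x = dirD X f x • s x + f x • vecD X s x :=
  eq_of_forall_dual fun φ => by
    rw [dual_vecD _ _ (SmoothVec.smul hf hs), map_add, map_smul, map_smul, dual_vecD _ _ hs]
    simp only [map_smul, smul_eq_mul]
    rw [dirD_mul X hf (hs φ)]
    ring

theorem vecD_add_left (X Y : VF G) (s : G → V) (x : G) :
    vecD (fun y => X y + Y y) s x = vecD X s x + vecD Y s x := by
  simp only [vecD, dirD_add_left, add_smul, Finset.sum_add_distrib]

theorem vecD_smul_left (c : G → ℝ) (X : VF G) (s : G → V) (x : G) :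
    vecD (fun y => c y • X y) s x = c x • vecD X s x := by
  simp only [vecD, dirD_smul_left, mul_smul, Finset.smul_sum]

theorem vecD_congr {X Y : VF G} {x : G} (h : X x = Y x) (s : G → V) :
    vecD X s x = vecD Y s x := by
  simp only [vecD, dirD_congr h]

theorem SmoothVec.vecD {X : VF G} (hX : SmoothVF X) {s : G → V}
    (hs : SmoothVec s) : SmoothVec (OddGen.vecD X s) := fun φ => by
  have e : (fun x => φ (OddGen.vecD X s x)) = OddGen.dirD X (fun y => φ (s y)) :=
    funext fun x => dual_vecD φ X hs x
  rw [e]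
  exact (hs φ).dirD hX

theorem dirD_bilin (A : V →ₗ[ℝ] W →ₗ[ℝ] ℝ) (X : VF G) {s : G → V} {t : G → W}
    (hs : SmoothVec s) (ht : SmoothVec t) (x : G) :
    dirD X (fun y => A (s y) (t y)) x = A (vecD X s x) (t x) + A (s x) (vecD X t x) := by
  have e : (fun x => A (s x) (t x)) = fun x => ∑ i, (Module.finBasis ℝ V).coord i (s x) *
      A (Module.finBasis ℝ V i) (t x) := by
    funext x
    exact map_eq_sum_coord (A.flip (t x)) (s x)
  have e2 : A (s x) (vecD X t x) = ∑ i, (Module.finBasis ℝ V).coord i (s x) *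
      A (Module.finBasis ℝ V i) (vecD X t x) := map_eq_sum_coord (A.flip (vecD X t x)) (s x)
  rw [e, dirD_sum X _ fun i => (hs _).mul (ht _), e2, vecD, map_sum, LinearMap.sum_apply,
    ← Finset.sum_add_distrib]
  refine Finset.sum_congr rfl fun i _ => ?_
  rw [dirD_mul X (hs _) (ht _), dual_vecD _ X ht, map_smul, LinearMap.smul_apply, smul_eq_mul]
  ring

end Analysis

/-! ### Left trivialization of the tangent bundle and of `E`. -/

section Frame

variable {G : Type*} [TopologicalSpace G] [ChartedSpace E3 G] [Group G] [LieGroup (𝓡 3) ∞ G]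

theorem mdifferentiableAt_mul_left (x y : G) :
    MDifferentiableAt (𝓡 3) (𝓡 3) (fun z : G => x * z) y :=
  (contMDiff_mul_left (I := 𝓡 3) (n := ∞)).mdifferentiableAt (by simp)

theorem dL_mc (x : G) (z : TangentSpace (𝓡 3) x) : dL x (mc x z) = z := by
  have h : mfderiv (𝓡 3) (𝓡 3) ((fun y : G => x * y) ∘ fun y : G => x⁻¹ * y) x
      = ContinuousLinearMap.id ℝ _ := by
    have : (fun y : G => x * y) ∘ (fun y : G => x⁻¹ * y) = id := by ext y; simp
    rw [this, mfderiv_id]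
  rw [mfderiv_comp (I' := 𝓡 3) _ (mdifferentiableAt_mul_left _ _)
    (mdifferentiableAt_mul_left _ _), inv_mul_cancel] at h
  exact congrArg (fun f : TangentSpace (𝓡 3) x →L[ℝ] TangentSpace (𝓡 3) x => f z) h

theorem mc_dL (x : G) (z : LieAlg G) : mc x (dL x z) = z := by
  have h : mfderiv (𝓡 3) (𝓡 3) ((fun y : G => x⁻¹ * y) ∘ fun y : G => x * y) 1
      = ContinuousLinearMap.id ℝ _ := by
    have : (fun y : G => x⁻¹ * y) ∘ (fun y : G => x * y) = id := by ext y; simp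
    rw [this, mfderiv_id]
  rw [mfderiv_comp (I' := 𝓡 3) _ (mdifferentiableAt_mul_left _ _)
    (mdifferentiableAt_mul_left _ _), mul_one] at h
  exact congrArg (fun f : LieAlg G →L[ℝ] LieAlg G => f z) h

/-- The left trivialization of the fibre of `E` at `x`. -/
noncomputable def triv (x : G) : Fib x ≃ₗ[ℝ] Fib (1 : G) where
  toFun w := (mc x w.1, w.2.1 ∘ₗ dL x, w.2.2)
  invFun a := (dL x a.1, a.2.1 ∘ₗ mc x, a.2.2)
  map_add' p q := by simp [LinearMap.add_comp]
  map_smul' c p := by simp [LinearMap.smul_comp]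
  left_inv w := by
    refine Prod.ext (dL_mc x _) (Prod.ext (LinearMap.ext fun z => ?_) rfl)
    exact congrArg w.2.1 (dL_mc x z)
  right_inv w := by
    refine Prod.ext (mc_dL x _) (Prod.ext (LinearMap.ext fun z => ?_) rfl)
    exact congrArg w.2.1 (mc_dL x z)

theorem extSec_eq {x : G} (w : Fib x) : extSec w = leftInv (triv x w) := rfl

theorem triv_leftInv (a : Fib (1 : G)) (x : G) : triv x (leftInv a x) = a :=
  (triv x).apply_symm_apply a

theorem pairing_eq_triv (x : G) (p q : Fib x) :
    pairing x p q = pairing (1 : G) (triv x p) (triv x q) := by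
  simp only [pairing, LinearMap.mk₂_apply, triv, LinearEquiv.coe_mk, LinearMap.coe_mk,
    AddHom.coe_mk, LinearMap.comp_apply, dL_mc]

/-- The expression is the tangent map of the multiplication `G × G → G`, applied to the zero vector
at `φ x` and to `s x`. The identity as `φ` yields smoothness of left-invariant fields, the inversion
that of the Maurer-Cartan form. -/
theorem contMDiff_mfderiv_mul_left {φ : G → G} (hφ : ContMDiff (𝓡 3) (𝓡 3) ∞ φ)
    {s : G → TangentBundle (𝓡 3) G} (hs : ContMDiff (𝓡 3) (𝓡 3).tangent ∞ s) :
    ContMDiff (𝓡 3) (𝓡 3).tangent ∞ (fun x => (⟨φ x * (s x).proj,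
      mfderiv (𝓡 3) (𝓡 3) (fun y : G => φ x * y) (s x).proj (s x).snd⟩ :
        TangentBundle (𝓡 3) G)) := by
  let z : G → TangentBundle (𝓡 3) G := fun g => Bundle.TotalSpace.mk' E3 g 0
  have hz : ContMDiff (𝓡 3) (𝓡 3).tangent ∞ z := Bundle.contMDiff_zeroSection _ _
  have hmul : ContMDiff ((𝓡 3).prod (𝓡 3)).tangent (𝓡 3).tangent ∞
      (tangentMap ((𝓡 3).prod (𝓡 3)) (𝓡 3) (fun (p : G × G) => p.1 * p.2)) :=
    (contMDiff_mul (𝓡 3) ∞).contMDiff_tangentMap (m := ∞) (by simp)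
  have key := (hmul.comp contMDiff_equivTangentBundleProd_symm).comp ((hz.comp hφ).prodMk hs)
  have e : (fun x => (⟨φ x * (s x).proj,
      mfderiv (𝓡 3) (𝓡 3) (fun y : G => φ x * y) (s x).proj (s x).snd⟩ :
        TangentBundle (𝓡 3) G)) = (tangentMap ((𝓡 3).prod (𝓡 3)) (𝓡 3)
        (fun (p : G × G) => p.1 * p.2) ∘ (equivTangentBundleProd (𝓡 3) G (𝓡 3) G).symm) ∘
        fun x => (z (φ x), s x) := by
    funext x
    refine Bundle.TotalSpace.ext rfl (heq_of_eq ?_)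
    have h := mfderiv_prod_eq_add_apply (I := 𝓡 3) (I' := 𝓡 3) (I'' := 𝓡 3)
      (f := fun p : G × G => p.1 * p.2) (p := (φ x, (s x).proj)) (v := ((0 : E3), (s x).snd))
      ((contMDiff_mul (𝓡 3) ∞).mdifferentiableAt (by simp))
    refine Eq.trans ?_ h.symm
    exact (zero_add _).symm.trans (congrArg₂ (· + ·) (map_zero _).symm rfl)
  rw [e]
  exact key

theorem smoothVF_leftInv (a : LieAlg G) : SmoothVF (fun x : G => dL x a) := by
  have h := contMDiff_mfderiv_mul_left (G := G) contMDiff_id (s := fun _ => ⟨1, a⟩) contMDiff_const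
  refine h.congr fun x => ?_
  exact Bundle.TotalSpace.ext (mul_one x).symm (by rfl)

theorem smoothFn_dual_mc {X : VF G} (hX : SmoothVF X) (ℓ : LieAlg G →ₗ[ℝ] ℝ) :
    SmoothFn (fun x : G => ℓ (mc x (X x))) := by
  have h := contMDiff_mfderiv_mul_left (G := G) (contMDiff_inv (𝓡 3) ∞) hX
  have S : ContMDiff (𝓡 3) (𝓡 3).tangent ∞
      (fun x : G => (⟨1, mc x (X x)⟩ : TangentBundle (𝓡 3) G)) := by
    refine h.congr fun x => ?_
    exact Bundle.TotalSpace.ext (inv_mul_cancel x).symm (by rfl)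
  let F : G → E3 := fun x => mc x (X x)
  have hF : ContMDiff (𝓡 3) 𝓘(ℝ, E3) ∞ F := by
    intro x
    have h2 := (Bundle.contMDiffAt_totalSpace.1 (S x)).2
    refine h2.congr_of_eventuallyEq (Filter.Eventually.of_forall fun y => ?_)
    -- The trivialization centred at `1` is the identity on the fibre over `1`, so the fibre
    -- coordinate of the section is `F` itself.
    have := (tangentBundleCore (𝓡 3) G).coordChange_self (achart E3 (1 : G)) 1
      (mem_chart_source E3 (1 : G)) (F y)
    exact this.symm
  let ℓ' : E3 →L[ℝ] ℝ := LinearMap.toContinuousLinearMap (show E3 →ₗ[ℝ] ℝ from ℓ)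
  exact ℓ'.contMDiff.comp hF

theorem vf_eq_sum {ι : Type*} [Fintype ι] (b : Module.Basis ι ℝ (LieAlg G)) (X : VF G) (x : G) :
    X x = ∑ i, b.coord i (mc x (X x)) • dL x (b i) := by
  have h := congrArg (dL x) (b.sum_repr (mc x (X x)))
  rw [dL_mc, map_sum] at h
  exact h.symm.trans (Finset.sum_congr rfl fun i _ => map_smul _ _ _)

theorem smoothVF_iff {X : VF G} :
    SmoothVF X ↔ ∀ ℓ : LieAlg G →ₗ[ℝ] ℝ, SmoothFn (fun x => ℓ (mc x (X x))) := by
  refine ⟨fun h ℓ => smoothFn_dual_mc h ℓ, fun h => ?_⟩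
  let b := Module.finBasis ℝ (LieAlg G)
  have e : X = fun x => ∑ i, b.coord i (mc x (X x)) • dL x (b i) := funext (vf_eq_sum b X)
  rw [e]
  exact SmoothVF.sum _ fun i => SmoothVF.smul (h (b.coord i)) (smoothVF_leftInv (b i))

theorem smoothForm_iff {ξ : OneForm G} :
    SmoothForm ξ ↔ ∀ a : LieAlg G, SmoothFn (fun x => ξ x (dL x a)) := by
  refine ⟨fun h a => h _ (smoothVF_leftInv a), fun h Z hZ => ?_⟩
  let b := Module.finBasis ℝ (LieAlg G)
  have e : (fun x => ξ x (Z x)) = fun x => ∑ i, b.coord i (mc x (Z x)) * ξ x (dL x (b i)) := by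
    funext x
    have h := congrArg (ξ x) (vf_eq_sum b Z x)
    rw [map_sum] at h
    exact h.trans (Finset.sum_congr rfl fun i _ => map_smul _ _ _)
  rw [e]
  exact SmoothFn.sum _ fun i => (smoothFn_dual_mc hZ _).mul (h _)

/-- From here on, smooth sections are treated as smooth functions with values in one fixed vector
space, the fibre at the identity. -/
theorem smoothSec_iff {u : Sec G} : SmoothSec u ↔ SmoothVec (fun x => triv x (u x)) := by
  constructor
  · intro h φ
    have e : (fun x => φ (triv x (u x))) = fun x =>
        (φ ∘ₗ LinearMap.inl ℝ _ _) (mc x (u.vec x))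
        + ∑ i, u.form x (dL x (Module.finBasis ℝ (LieAlg G) i)) *
          φ (0, (Module.finBasis ℝ (LieAlg G)).coord i, 0) + u.fn x * φ (0, 0, 1) := by
      funext x
      have h1 := (Module.finBasis ℝ (LieAlg G)).sum_dual_apply_smul_coord (u.form x ∘ₗ dL x)
      have h2 : triv x (u x) = (mc x (u.vec x), 0, 0)
          + ∑ i, u.form x (dL x (Module.finBasis ℝ (LieAlg G) i)) •
            ((0, (Module.finBasis ℝ (LieAlg G)).coord i, 0) : Fib (1 : G))
          + u.fn x • ((0, 0, 1) : Fib (1 : G)) := by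
        have h3 : ∑ i, u.form x (dL x (Module.finBasis ℝ (LieAlg G) i)) •
            ((0, (Module.finBasis ℝ (LieAlg G)).coord i, 0) : Fib (1 : G))
            = (0, u.form x ∘ₗ dL x, 0) := by
          rw [← h1]
          have := map_sum (LinearMap.inr ℝ (LieAlg G) (Module.Dual ℝ (LieAlg G) × ℝ) ∘ₗ
            LinearMap.inl ℝ (Module.Dual ℝ (LieAlg G)) ℝ)
            (fun i => (u.form x ∘ₗ dL x) (Module.finBasis ℝ (LieAlg G) i) •
              (Module.finBasis ℝ (LieAlg G)).coord i) Finset.univ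
          refine Eq.trans (Finset.sum_congr rfl fun i _ => ?_) this.symm
          rw [map_smul]
          rfl
        rw [h3]
        refine Prod.ext ?_ (Prod.ext ?_ ?_)
        · exact (add_zero _).symm.trans (by simp; rfl)
        · simp; rfl
        · simp; rfl
      rw [h2, map_add, map_add, map_sum, map_smul]
      refine congrArg₂ _ (congrArg₂ _ rfl (Finset.sum_congr rfl fun i _ => map_smul _ _ _)) rfl
    rw [e]
    exact ((smoothFn_dual_mc h.vec _).add (SmoothFn.sum _ fun i =>
      (smoothForm_iff.1 h.form _).mul (smoothFn_const _))).add (h.fn.mul (smoothFn_const _))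
  · intro h
    refine ⟨smoothVF_iff.2 fun ℓ => h (ℓ ∘ₗ LinearMap.fst ℝ _ _), smoothForm_iff.2 fun a => ?_, ?_⟩
    · exact h (LinearMap.applyₗ a ∘ₗ LinearMap.fst ℝ _ _ ∘ₗ LinearMap.snd ℝ _ _)
    · exact h (LinearMap.snd ℝ _ _ ∘ₗ LinearMap.snd ℝ _ _)

end Frame

/-! ### Algebraic Levi-Civita connections on a metric space with a skew bracket -/

section MetricBracket

/-- A finite-dimensional vector space with a scalar product `B` and a bracket `br`, such that
`B (br u v) w` is totally skew in `u`, `v`, `w`. -/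
structure MetricBracket (V : Type*) [AddCommGroup V] [Module ℝ V] where
  B : LinearMap.BilinForm ℝ V
  nondeg : B.Nondegenerate
  symm : ∀ v w, B v w = B w v
  br : V →ₗ[ℝ] V →ₗ[ℝ] V
  skew : ∀ u v w, B (br u v) w = -B (br v u) w
  skew' : ∀ u v w, B (br u v) w = -B (br u w) v

variable {V : Type*} [AddCommGroup V] [Module ℝ V]

/-- An orthogonal decomposition of a metric space, given by the two projections. -/
structure Splitting (M : MetricBracket V) where
  P : V →ₗ[ℝ] V
  Q : V →ₗ[ℝ] V
  add : ∀ v, P v + Q v = v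
  PQ : ∀ v, P (Q v) = 0
  QP : ∀ v, Q (P v) = 0
  ortho : ∀ v w, M.B (P v) (Q w) = 0

namespace Splitting

variable {M : MetricBracket V} (S : Splitting M)

/-- The same decomposition, with the two summands interchanged. -/
def swap : Splitting M where
  P := S.Q
  Q := S.P
  add v := by rw [add_comm, S.add]
  PQ := S.QP
  QP := S.PQ
  ortho v w := by rw [M.symm, S.ortho]

theorem PP (v : V) : S.P (S.P v) = S.P v := by
  have h := congrArg S.P (S.add v)
  rwa [map_add, S.PQ, add_zero] at h

theorem adjoint (v w : V) : M.B (S.P v) w = M.B v (S.P w) := by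
  conv_lhs => rw [← S.add w, map_add, S.ortho, add_zero]
  conv_rhs => rw [← S.add v, map_add, LinearMap.add_apply, M.symm (S.Q v), S.ortho, add_zero]

end Splitting

theorem MetricBracket.ext_B (M : MetricBracket V) {v w : V} (h : ∀ z, M.B v z = M.B w z) :
    v = w := by
  rw [← sub_eq_zero]
  refine M.nondeg.1 _ fun z => ?_
  rw [map_sub, LinearMap.sub_apply, h, sub_self]

/-- The connection coefficients of a metric, torsion-free connection which preserves the given
splitting. -/
structure IsAlgLC (M : MetricBracket V) (S : Splitting M) (Γ : V →ₗ[ℝ] V →ₗ[ℝ] V) : Prop where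
  metric : ∀ u v w, M.B (Γ u v) w + M.B v (Γ u w) = 0
  torsion : ∀ u v w, M.B (Γ u v - Γ v u - M.br u v) w + M.B v (Γ w u) = 0
  preserves : ∀ u v, S.P (Γ u (S.Q v)) = 0

namespace IsAlgLC

variable {M : MetricBracket V} {S : Splitting M} {Γ : V →ₗ[ℝ] V →ₗ[ℝ] V}

/-- By metric compatibility `Γ u` is skew, and a skew map which preserves one summand preserves its
orthogonal complement. -/
theorem preserves' (h : IsAlgLC M S Γ) (u v : V) : S.Q (Γ u (S.P v)) = 0 := by
  refine M.ext_B fun z => ?_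
  have h1 := h.metric u (S.P v) (S.Q z)
  have h2 : M.B (S.P v) (Γ u (S.Q z)) = 0 := by
    rw [← S.add (Γ u (S.Q z)), h.preserves, zero_add, S.ortho]
  rw [map_zero, LinearMap.zero_apply, show M.B (S.Q (Γ u (S.P v))) z = M.B (Γ u (S.P v)) (S.Q z)
    from S.swap.adjoint _ _]
  linarith

theorem swap (h : IsAlgLC M S Γ) : IsAlgLC M S.swap Γ :=
  ⟨h.metric, h.torsion, h.preserves'⟩

theorem commute (h : IsAlgLC M S Γ) (u v : V) : S.P (Γ u v) = Γ u (S.P v) := by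
  conv_lhs => rw [← S.add v, map_add, map_add, h.preserves, add_zero]
  have := S.add (Γ u (S.P v))
  rwa [h.preserves', add_zero] at this

/-- In the torsion equation for `u₋`, `v₊` and `z₊`, the terms in which `Γ` acts on `u₋` stay in
`E₋` and are orthogonal to `E₊`. The mixed coefficients thus depend on the bracket only, which is
the source of the independence of the Ricci tensor from the connection. -/
theorem mixed (h : IsAlgLC M S Γ) (u v : V) :
    Γ (S.Q u) (S.P v) = S.P (M.br (S.Q u) (S.P v)) := by
  rw [← S.PP v, ← h.commute, S.PP]
  refine M.ext_B fun z => ?_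
  rw [S.adjoint, S.adjoint]
  have h1 := h.torsion (S.Q u) (S.P v) (S.P z)
  have h2 : M.B (Γ (S.P v) (S.Q u)) (S.P z) = 0 := by
    rw [← S.adjoint, h.preserves, map_zero, LinearMap.zero_apply]
  have h3 : M.B (S.P v) (Γ (S.P z) (S.Q u)) = 0 := by
    rw [S.adjoint, h.preserves, map_zero]
  simp only [map_sub, LinearMap.sub_apply] at h1
  linarith

end IsAlgLC

variable [Module.Finite ℝ V]

/-- The operator `w ↦ [[w₊, u₋]₋, v₊]₊`. -/
def Splitting.doubleBr {M : MetricBracket V} (S : Splitting M) (u v : V) : V →ₗ[ℝ] V :=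
  S.P ∘ₗ M.br.flip (S.P v) ∘ₗ S.Q ∘ₗ M.br.flip (S.Q u) ∘ₗ S.P

/-- The Ricci tensor, as a function of the bracket and the divergence. -/
noncomputable def Splitting.ric {M : MetricBracket V} (S : Splitting M) (δ : Module.Dual ℝ V)
    (u v : V) : ℝ :=
  δ (S.P (M.br (S.Q u) (S.P v))) - LinearMap.trace ℝ V (S.doubleBr u v)

/-- All `Γ w s₊` lie in the range of `P`, so the trace does not change when `w` is restricted to
that range. -/
theorem IsAlgLC.trace_comp {M : MetricBracket V} {S : Splitting M} {Γ : V →ₗ[ℝ] V →ₗ[ℝ] V}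
    (h : IsAlgLC M S Γ) {δ : Module.Dual ℝ V} (hδ : ∀ a, LinearMap.trace ℝ V (Γ.flip a) = δ a)
    (s : V) : LinearMap.trace ℝ V (Γ.flip (S.P s) ∘ₗ S.P) = δ (S.P s) := by
  rw [← hδ, ← LinearMap.trace_comp_comm']
  congr 1
  ext w
  simp only [LinearMap.comp_apply, LinearMap.flip_apply]
  rw [h.commute, S.PP]

/-- Split `[w₊, u₋] = -Γ u₋ w₊ + [w₊, u₋]₋`. The first part cancels against the term `Γ u (Γ w v)`
because traces are cyclic; by `mixed` the second one gives `doubleBr`. The map `E` will be the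
derivative of the connection coefficients. -/
theorem IsAlgLC.trace_curvature {M : MetricBracket V} {S : Splitting M} {Γ : V →ₗ[ℝ] V →ₗ[ℝ] V}
    (h : IsAlgLC M S Γ) {δ : Module.Dual ℝ V} (hδ : ∀ a, LinearMap.trace ℝ V (Γ.flip a) = δ a)
    (u v : V) (E : V →ₗ[ℝ] V) (hE : LinearMap.trace ℝ V (E ∘ₗ S.P) = 0) :
    LinearMap.trace ℝ V ((Γ.flip (Γ (S.Q u) (S.P v)) - E - Γ (S.Q u) ∘ₗ Γ.flip (S.P v)
      - Γ.flip (S.P v) ∘ₗ M.br.flip (S.Q u)) ∘ₗ S.P) = S.ric δ u v := by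
  have h1 := h.trace_comp hδ
  have h2 : ∀ w, S.P (M.br (S.P w) (S.Q u)) = -Γ (S.Q u) (S.P w) := by
    intro w
    rw [h.mixed]
    refine M.ext_B fun z => ?_
    rw [map_neg, LinearMap.neg_apply, S.adjoint, S.adjoint, M.skew]
  have h3 : (Γ.flip (S.P v) ∘ₗ M.br.flip (S.Q u)) ∘ₗ S.P
      = S.doubleBr u v - (Γ.flip (S.P v) ∘ₗ S.P) ∘ₗ Γ (S.Q u) := by
    ext w
    simp only [LinearMap.comp_apply, LinearMap.flip_apply, LinearMap.sub_apply,
      Splitting.doubleBr]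
    have hy : M.br (S.P w) (S.Q u) = -Γ (S.Q u) (S.P w) + S.Q (M.br (S.P w) (S.Q u)) := by
      rw [← h2, S.add]
    rw [← h.mixed, h.commute (S.Q u) w]
    conv_lhs => rw [hy, map_add, map_neg]
    simp only [LinearMap.add_apply, LinearMap.neg_apply]
    abel
  rw [LinearMap.sub_comp, LinearMap.sub_comp, LinearMap.sub_comp, map_sub, map_sub, map_sub, hE,
    h3, map_sub, LinearMap.comp_assoc, LinearMap.trace_comp_comm' (Γ (S.Q u)), h.mixed, h1]
  rw [Splitting.ric]
  ring

/-! ### Existence -/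

/-- The scalar product conjugates `-A` to the transpose of `A`, so the trace of `A` equals its
negative. -/
theorem MetricBracket.trace_eq_zero_of_skew (M : MetricBracket V) (A : V →ₗ[ℝ] V)
    (hA : ∀ v w, M.B (A v) w = -M.B v (A w)) : LinearMap.trace ℝ V A = 0 := by
  let e := M.B.toDual M.nondeg
  have h : Module.Dual.transpose (R := ℝ) A = e.conj (-A) := by
    ext φ w
    obtain ⟨v, rfl⟩ := e.surjective φ
    simp only [LinearEquiv.conj_apply, LinearMap.comp_apply, LinearEquiv.coe_coe,
      LinearEquiv.symm_apply_apply, Module.Dual.transpose_apply]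
    change M.B v (A w) = M.B ((-A) v) w
    rw [LinearMap.neg_apply, map_neg, LinearMap.neg_apply, hA, neg_neg]
  have h1 := LinearMap.trace_transpose' (R := ℝ) A
  rw [h, LinearMap.trace_conj', map_neg] at h1
  linarith

/-- The summand of a torsion-free connection which adjusts its divergence on the range of `P`. -/
noncomputable def Splitting.adjust {M : MetricBracket V} (S : Splitting M) (δ : Module.Dual ℝ V) :
    V →ₗ[ℝ] V →ₗ[ℝ] V :=
  LinearMap.mk₂ ℝ (fun u v => (1 - LinearMap.trace ℝ V S.P)⁻¹ • (M.B (S.P u) (S.P v) •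
      (M.B.toDual M.nondeg).symm (δ ∘ₗ S.P) - δ (S.P v) • S.P u))
    (by intros; simp only [map_add, LinearMap.add_apply]; module)
    (by intros; simp only [map_smul, LinearMap.smul_apply, smul_eq_mul]; module)
    (by intros; simp only [map_add]; module)
    (by intros; simp only [map_smul, smul_eq_mul]; module)

theorem Splitting.adjust_apply {M : MetricBracket V} (S : Splitting M) (δ : Module.Dual ℝ V)
    (u v w : V) : M.B (S.adjust δ u v) w = (1 - LinearMap.trace ℝ V S.P)⁻¹ *
      (M.B (S.P u) (S.P v) * δ (S.P w) - δ (S.P v) * M.B (S.P u) (S.P w)) := by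
  have : M.B (S.P u) w = M.B (S.P u) (S.P w) := by rw [← S.adjoint, S.PP]
  simp only [adjust, LinearMap.mk₂_apply, map_smul, map_sub, LinearMap.smul_apply,
    LinearMap.sub_apply, smul_eq_mul, LinearMap.BilinForm.apply_toDual_symm_apply,
    LinearMap.comp_apply, this]

/-- If the range of `P` has dimension `n`, the two terms of `adjust` contribute `δ a₊` and `-n δ a₊`
before normalization. This explains the factor `(1 - n)⁻¹` and the exclusion of `n = 1`. -/
theorem Splitting.trace_adjust {M : MetricBracket V} (S : Splitting M) (δ : Module.Dual ℝ V)
    (hP : LinearMap.trace ℝ V S.P ≠ 1) (a : V) :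
    LinearMap.trace ℝ V ((S.adjust δ).flip a) = δ (S.P a) := by
  have e : (S.adjust δ).flip a = (1 - LinearMap.trace ℝ V S.P)⁻¹ •
      ((M.B.flip (S.P a) ∘ₗ S.P).smulRight ((M.B.toDual M.nondeg).symm (δ ∘ₗ S.P))
        - δ (S.P a) • S.P) := by
    ext u
    simp [adjust]
  rw [e, map_smul, map_sub, map_smul, LinearMap.trace_smulRight]
  have h2 : (M.B.flip (S.P a) ∘ₗ S.P) ((M.B.toDual M.nondeg).symm (δ ∘ₗ S.P)) = δ (S.P a) := by
    change M.B (S.P _) (S.P a) = _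
    rw [S.adjoint, S.PP, LinearMap.BilinForm.apply_toDual_symm_apply, LinearMap.comp_apply, S.PP]
  rw [h2, smul_eq_mul, smul_eq_mul]
  have : 1 - LinearMap.trace ℝ V S.P ≠ 0 := sub_ne_zero.2 hP.symm
  field_simp

/-- The summand of a torsion-free connection given by the bracket. -/
noncomputable def Splitting.brPart {M : MetricBracket V} (S : Splitting M) :
    V →ₗ[ℝ] V →ₗ[ℝ] V :=
  (M.br.compl₁₂ S.Q S.P).compr₂ S.P + (1 / 3 : ℝ) • (M.br.compl₁₂ S.P S.P).compr₂ S.P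

theorem Splitting.brPart_apply {M : MetricBracket V} (S : Splitting M) (u v w : V) :
    M.B (S.brPart u v) w = M.B (M.br (S.Q u) (S.P v)) (S.P w)
      + 1 / 3 * M.B (M.br (S.P u) (S.P v)) (S.P w) := by
  simp [brPart, S.adjoint]

/-- The mixed summand sends the range of `Q` to that of `P` and is zero on the latter; the pure
summand is skew. -/
theorem Splitting.trace_brPart {M : MetricBracket V} (S : Splitting M) (a : V) :
    LinearMap.trace ℝ V (S.brPart.flip a) = 0 := by
  have e : S.brPart.flip a = S.P ∘ₗ M.br.flip (S.P a) ∘ₗ S.Q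
      + (1 / 3 : ℝ) • (S.P ∘ₗ M.br.flip (S.P a) ∘ₗ S.P) := by
    ext u
    simp [brPart]
  have h1 : LinearMap.trace ℝ V (S.P ∘ₗ M.br.flip (S.P a) ∘ₗ S.Q) = 0 := by
    rw [LinearMap.trace_comp_comm']
    have : (M.br.flip (S.P a) ∘ₗ S.Q) ∘ₗ S.P = 0 := by
      ext u
      simp [S.QP]
    rw [this, map_zero]
  have h2 : LinearMap.trace ℝ V (S.P ∘ₗ M.br.flip (S.P a) ∘ₗ S.P) = 0 := by
    refine M.trace_eq_zero_of_skew _ fun v w => ?_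
    simp only [LinearMap.comp_apply, LinearMap.flip_apply]
    rw [S.adjoint, ← S.adjoint v, M.symm (S.P v), M.skew, M.skew', neg_neg, M.skew]
  rw [e, map_add, map_smul, h1, h2, smul_zero, add_zero]

/-- For metric `Γ`, torsion-freeness says that the cyclic sum of `⟨Γ u v, w⟩` is `⟨[u, v], w⟩`. On
arguments of mixed type one cyclic term of the two `brPart`s survives; on arguments of a single type
three equal terms do, whence the coefficient `1 / 3`. The cyclic sum of `adjust` is zero, so it
changes only the divergence. -/
theorem Splitting.exists_isAlgLC {M : MetricBracket V} (S : Splitting M) (δ : Module.Dual ℝ V)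
    (hP : LinearMap.trace ℝ V S.P ≠ 1) (hQ : LinearMap.trace ℝ V S.Q ≠ 1) :
    ∃ Γ, IsAlgLC M S Γ ∧ ∀ a, LinearMap.trace ℝ V (Γ.flip a) = δ a := by
  refine ⟨S.brPart + S.swap.brPart + S.adjust δ + S.swap.adjust δ, ⟨?_, ?_, ?_⟩, ?_⟩
  · intro u v w
    simp only [LinearMap.add_apply, map_add]
    rw [M.symm v, M.symm v, M.symm v, M.symm v]
    simp only [Splitting.brPart_apply, Splitting.adjust_apply]
    rw [M.skew' _ (S.P w), M.skew' _ (S.P w), M.skew' _ (S.swap.P w), M.skew' _ (S.swap.P w)]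
    ring
  · intro u v w
    simp only [LinearMap.add_apply, map_add, map_sub, LinearMap.sub_apply]
    rw [M.symm v, M.symm v, M.symm v, M.symm v]
    simp only [Splitting.brPart_apply, Splitting.adjust_apply]
    have h : M.B (M.br u v) w = M.B (M.br (S.P u + S.Q u) (S.P v + S.Q v)) (S.P w + S.Q w) := by
      simp only [S.add]
    rw [h]
    simp only [map_add, LinearMap.add_apply, Splitting.swap]
    have cyc : ∀ a b c, M.B (M.br a b) c = M.B (M.br b c) a := fun a b c => by
      rw [M.skew, M.skew', neg_neg]
    rw [cyc (S.Q w) (S.P u) (S.P v), cyc (S.P w) (S.Q u) (S.Q v), cyc (S.P w) (S.P u) (S.P v),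
      cyc (S.Q w) (S.Q u) (S.Q v), M.skew (S.P v), M.skew (S.P v), M.skew (S.Q v) (S.P u),
      M.skew (S.Q v) (S.Q u), M.symm (S.P v) (S.P u), M.symm (S.P w) (S.P u),
      M.symm (S.P w) (S.P v), M.symm (S.Q v) (S.Q u), M.symm (S.Q w) (S.Q u),
      M.symm (S.Q w) (S.Q v)]
    ring
  · intro u v
    refine M.ext_B fun z => ?_
    rw [S.adjoint]
    simp only [LinearMap.add_apply, map_add, Splitting.brPart_apply, Splitting.adjust_apply]
    simp [S.PQ, Splitting.swap, S.QP]
  · intro a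
    rw [show (S.brPart + S.swap.brPart + S.adjust δ + S.swap.adjust δ).flip a
      = S.brPart.flip a + S.swap.brPart.flip a + (S.adjust δ).flip a + (S.swap.adjust δ).flip a
      from rfl, map_add, map_add, map_add, S.trace_brPart, S.swap.trace_brPart,
      S.trace_adjust δ hP, S.swap.trace_adjust δ hQ, zero_add, zero_add, ← map_add]
    exact congrArg δ (S.add a)

end MetricBracket

/-! ### Traces over subspaces. -/

section RestrictedTrace

variable {V W : Type*} [AddCommGroup V] [Module ℝ V] [Module.Finite ℝ V] [AddCommGroup W]
  [Module ℝ W]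

/-- A trace over the subspace on which a projection `P` is the identity, computed on the whole
space. -/
theorem hasTraceOn_iff {A : Submodule ℝ W} (e : W ≃ₗ[ℝ] V) {P : V →ₗ[ℝ] V}
    (hP : ∀ v, P (P v) = P v) (hA : ∀ w, w ∈ A ↔ P (e w) = e w) {φ : W → W} {R : V →ₗ[ℝ] V}
    (hR : ∀ v, P (R (P v)) = R (P v)) (hφ : ∀ w ∈ A, e (φ w) = R (e w)) (t : ℝ) :
    HasTraceOn A φ t ↔ LinearMap.trace ℝ V (R ∘ₗ P) = t := by
  have : Module.Finite ℝ W := Module.Finite.equiv e.symm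
  let i : A →ₗ[ℝ] V := e.toLinearMap ∘ₗ A.subtype
  let p : V →ₗ[ℝ] A := (e.symm.toLinearMap ∘ₗ P).codRestrict A fun v =>
    (hA _).2 (by simp [hP])
  have hip : i ∘ₗ p = P := by
    ext v
    simp [i, p]
  have hpi : ∀ w : A, ((p (R (i w)) : A) : W) = φ w := by
    intro w
    have h1 : R (e w) = P (R (e w)) := by
      rw [← (hA w).1 w.2, hR]
    simp only [p, i, LinearMap.codRestrict_apply, LinearMap.comp_apply, Submodule.subtype_apply,
      LinearEquiv.coe_coe]
    rw [← h1, ← hφ w w.2, e.symm_apply_apply]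
  -- Since `i ∘ p = P`, this is the cyclicity `tr (p R i) = tr (R i p)`.
  have htr : LinearMap.trace ℝ A (p ∘ₗ R ∘ₗ i) = LinearMap.trace ℝ V (R ∘ₗ P) := by
    rw [LinearMap.trace_comp_comm', LinearMap.comp_assoc, hip]
  constructor
  · rintro ⟨T, hT, rfl⟩
    rw [← htr]
    congr 1
    ext w
    rw [hT w]
    exact hpi w
  · intro h
    exact ⟨p ∘ₗ R ∘ₗ i, hpi, htr.trans h⟩

end RestrictedTrace

/-! ### The bracket of left-invariant sections -/

section Gen

variable {L : Type*} [AddCommGroup L] [Module ℝ L]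

/-- The scalar product on `L ⊕ L* ⊕ ℝ`. -/
noncomputable def genPairing (L : Type*) [AddCommGroup L] [Module ℝ L] :
    LinearMap.BilinForm ℝ (L × Module.Dual ℝ L × ℝ) :=
  LinearMap.mk₂ ℝ (fun p q => (1 / 2) * (p.2.1 q.1 + q.2.1 p.1) + p.2.2 * q.2.2)
    (by intro p p' q; simp; ring) (by intro c p q; simp; ring)
    (by intro p q q'; simp; ring) (by intro c p q; simp; ring)

theorem genPairing_apply (p q : L × Module.Dual ℝ L × ℝ) :
    genPairing L p q = (1 / 2) * (p.2.1 q.1 + q.2.1 p.1) + p.2.2 * q.2.2 := rfl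

theorem genPairing_symm (p q : L × Module.Dual ℝ L × ℝ) :
    genPairing L p q = genPairing L q p := by
  simp only [genPairing_apply]
  ring

theorem genPairing_nondegenerate : (genPairing L).Nondegenerate := by
  have h : ∀ p : L × Module.Dual ℝ L × ℝ, (∀ q, genPairing L p q = 0) → p = 0 := by
    rintro ⟨X, ξ, a⟩ h
    have h1 : X = 0 := by
      rw [← Module.forall_dual_apply_eq_zero_iff ℝ]
      intro η
      simpa [genPairing_apply] using h (0, η, 0)
    have h2 : ξ = 0 := by
      ext Z
      simpa [genPairing_apply] using h (Z, 0, 0)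
    have h3 : a = 0 := by simpa [genPairing_apply] using h (0, 0, 1)
    rw [h1, h2, h3]
    rfl
  exact ⟨h, fun q hq => h q fun p => by rw [genPairing_symm]; exact hq p⟩

/-- A two-form as a bilinear map. -/
def bilinOfForm (F : L [⋀^Fin 2]→ₗ[ℝ] ℝ) : L →ₗ[ℝ] L →ₗ[ℝ] ℝ :=
  LinearMap.mk₂ ℝ (fun X Y => F ![X, Y]) (fun X X' Y => F.map_vecCons_add _ _ _)
    (fun c X Y => F.map_vecCons_smul _ _ _)
    (fun X Y Y' => (F.curryLeft X).map_vecCons_add ![] _ _)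
    (fun c X Y => (F.curryLeft X).map_vecCons_smul ![] _ _)

theorem bilinOfForm_swap (F : L [⋀^Fin 2]→ₗ[ℝ] ℝ) (X Y : L) :
    bilinOfForm F X Y = -bilinOfForm F Y X := by
  have h := F.map_swap ![Y, X] (i := 0) (j := 1) (by decide)
  rw [show (![Y, X] ∘ ⇑(Equiv.swap (0 : Fin 2) 1)) = ![X, Y] by ext i; fin_cases i <;> rfl] at h
  exact h

/-- A three-form as a trilinear map. -/
def trilinOfForm (H : L [⋀^Fin 3]→ₗ[ℝ] ℝ) : L →ₗ[ℝ] L →ₗ[ℝ] L →ₗ[ℝ] ℝ :=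
  LinearMap.mk₂ ℝ (fun X Y => bilinOfForm (H.curryLeft X) Y)
    (fun X X' Y => by ext Z; exact H.map_vecCons_add _ _ _)
    (fun c X Y => by ext Z; exact H.map_vecCons_smul _ _ _)
    (fun X Y Y' => map_add _ _ _) (fun c X Y => map_smul _ _ _)

theorem trilinOfForm_swap' (H : L [⋀^Fin 3]→ₗ[ℝ] ℝ) (X Y Z : L) :
    trilinOfForm H X Y Z = -trilinOfForm H X Z Y :=
  bilinOfForm_swap (H.curryLeft X) Y Z

theorem trilinOfForm_swap (H : L [⋀^Fin 3]→ₗ[ℝ] ℝ) (X Y Z : L) :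
    trilinOfForm H X Y Z = -trilinOfForm H Y X Z := by
  have h := H.map_swap ![Y, X, Z] (i := 0) (j := 1) (by decide)
  rw [show (![Y, X, Z] ∘ ⇑(Equiv.swap (0 : Fin 3) 1)) = ![X, Y, Z] by
    ext i; fin_cases i <;> rfl] at h
  exact h

/-- The three-form `⟨[u, v], w⟩` on left-invariant sections. -/
noncomputable def genForm (β : L →ₗ[ℝ] L →ₗ[ℝ] L) (H : L [⋀^Fin 3]→ₗ[ℝ] ℝ)
    (F : L [⋀^Fin 2]→ₗ[ℝ] ℝ) :
    (L × Module.Dual ℝ L × ℝ) →ₗ[ℝ] (L × Module.Dual ℝ L × ℝ) →ₗ[ℝ]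
      Module.Dual ℝ (L × Module.Dual ℝ L × ℝ) :=
  LinearMap.mk₂ ℝ (fun u v =>
    ((1 / 2 : ℝ) • (v.2.1 ∘ₗ β.flip u.1 + u.2.1 ∘ₗ β v.1 - trilinOfForm H u.1 v.1)
      + u.2.2 • bilinOfForm F v.1 - v.2.2 • bilinOfForm F u.1).coprod
    (((1 / 2 : ℝ) • LinearMap.applyₗ (β u.1 v.1)).coprod
      (bilinOfForm F u.1 v.1 • LinearMap.id)))
    (by intros; ext <;> simp <;> ring) (by intros; ext <;> simp <;> ring)
    (by intros; ext <;> simp <;> ring) (by intros; ext <;> simp <;> ring)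

/-- Written out, the form is visibly invariant under cyclic permutations of `u`, `v`, `w`. -/
theorem genForm_apply (β : L →ₗ[ℝ] L →ₗ[ℝ] L) (H : L [⋀^Fin 3]→ₗ[ℝ] ℝ)
    (F : L [⋀^Fin 2]→ₗ[ℝ] ℝ) (u v w : L × Module.Dual ℝ L × ℝ) :
    genForm β H F u v w = 1 / 2 * (w.2.1 (β u.1 v.1) + v.2.1 (β w.1 u.1) + u.2.1 (β v.1 w.1)
      - trilinOfForm H u.1 v.1 w.1) + w.2.2 * bilinOfForm F u.1 v.1
      + u.2.2 * bilinOfForm F v.1 w.1 + v.2.2 * bilinOfForm F w.1 u.1 := by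
  rw [bilinOfForm_swap F w.1 u.1]
  simp [genForm]
  ring

variable [Module.Finite ℝ L]

/-- The space of left-invariant sections of `E`, with its scalar product and bracket. -/
noncomputable def genBracket (β : L →ₗ[ℝ] L →ₗ[ℝ] L) (hβ : ∀ X Y, β X Y = -β Y X)
    (H : L [⋀^Fin 3]→ₗ[ℝ] ℝ) (F : L [⋀^Fin 2]→ₗ[ℝ] ℝ) :
    MetricBracket (L × Module.Dual ℝ L × ℝ) where
  B := genPairing L
  nondeg := genPairing_nondegenerate
  symm := genPairing_symm
  -- The bracket arises from the three-form by raising an index. Its total skewness needs neither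
  -- the Jacobi identity nor closedness of `F`.
  br := (genForm β H F).compr₂
    ((genPairing L).toDual genPairing_nondegenerate).symm.toLinearMap
  skew u v w := by
    simp only [LinearMap.compr₂_apply, LinearEquiv.coe_coe,
      LinearMap.BilinForm.apply_toDual_symm_apply, genForm_apply]
    rw [hβ v.1 u.1, hβ w.1 v.1, hβ u.1 w.1, trilinOfForm_swap H v.1, bilinOfForm_swap F v.1 u.1,
      bilinOfForm_swap F w.1 v.1, bilinOfForm_swap F u.1 w.1]
    simp only [map_neg]
    ring
  skew' u v w := by
    simp only [LinearMap.compr₂_apply, LinearEquiv.coe_coe,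
      LinearMap.BilinForm.apply_toDual_symm_apply, genForm_apply]
    rw [hβ v.1 u.1, hβ w.1 v.1, hβ u.1 w.1, trilinOfForm_swap' H u.1, bilinOfForm_swap F v.1 u.1,
      bilinOfForm_swap F w.1 v.1, bilinOfForm_swap F u.1 w.1]
    simp only [map_neg]
    ring

theorem genPairing_br (β : L →ₗ[ℝ] L →ₗ[ℝ] L) (hβ : ∀ X Y, β X Y = -β Y X)
    (H : L [⋀^Fin 3]→ₗ[ℝ] ℝ) (F : L [⋀^Fin 2]→ₗ[ℝ] ℝ) (u v w : L × Module.Dual ℝ L × ℝ) :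
    genPairing L ((genBracket β hβ H F).br u v) w = genForm β H F u v w :=
  LinearMap.BilinForm.apply_toDual_symm_apply (hB := genPairing_nondegenerate) _ _

/-! ### The splitting given by a pseudo-Riemannian metric -/

section Metric

variable (g : LinearMap.BilinForm ℝ L) (hg : g.Nondegenerate)

/-- `X ↦ X - g X`. -/
def minusMap : L →ₗ[ℝ] L × Module.Dual ℝ L × ℝ := LinearMap.id.prod ((-g).prod 0)

/-- `(X, a) ↦ X + g X + a`. -/
def plusMap : L × ℝ →ₗ[ℝ] L × Module.Dual ℝ L × ℝ :=
  (LinearMap.fst ℝ L ℝ).prod ((g ∘ₗ LinearMap.fst ℝ L ℝ).prod (LinearMap.snd ℝ L ℝ))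

theorem minusMap_apply (X : L) : minusMap g X = (X, -g X, 0) := rfl

theorem plusMap_apply (Y : L × ℝ) : plusMap g Y = (Y.1, g Y.1, Y.2) := rfl

/-- The component in `L` of the projection to `E₋`. -/
noncomputable def minusComp : L × Module.Dual ℝ L × ℝ →ₗ[ℝ] L :=
  (1 / 2 : ℝ) • (LinearMap.fst ℝ _ _
    - (g.toDual hg).symm.toLinearMap ∘ₗ LinearMap.fst ℝ _ _ ∘ₗ LinearMap.snd ℝ _ _)

/-- The component in `L ⊕ ℝ` of the projection to `E₊`. -/
noncomputable def plusComp : L × Module.Dual ℝ L × ℝ →ₗ[ℝ] L × ℝ :=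
  ((1 / 2 : ℝ) • (LinearMap.fst ℝ _ _
    + (g.toDual hg).symm.toLinearMap ∘ₗ LinearMap.fst ℝ _ _ ∘ₗ LinearMap.snd ℝ _ _)).prod
    (LinearMap.snd ℝ _ _ ∘ₗ LinearMap.snd ℝ _ _)

theorem minusComp_apply (X : L) (ξ : Module.Dual ℝ L) (a : ℝ) :
    minusComp g hg (X, ξ, a) = (1 / 2 : ℝ) • (X - (g.toDual hg).symm ξ) := rfl

theorem plusComp_apply (X : L) (ξ : Module.Dual ℝ L) (a : ℝ) :
    plusComp g hg (X, ξ, a) = ((1 / 2 : ℝ) • (X + (g.toDual hg).symm ξ), a) := rfl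

theorem toDual_symm_self (X : L) : (g.toDual hg).symm (g X) = X :=
  (g.toDual hg).symm_apply_apply X

theorem apply_toDual_symm (ξ : Module.Dual ℝ L) : g ((g.toDual hg).symm ξ) = ξ :=
  (g.toDual hg).apply_symm_apply ξ

theorem minusComp_minusMap (X : L) : minusComp g hg (minusMap g X) = X := by
  rw [minusMap_apply, minusComp_apply, map_neg, toDual_symm_self]
  module

theorem minusComp_plusMap (Y : L × ℝ) : minusComp g hg (plusMap g Y) = 0 := by
  rw [plusMap_apply, minusComp_apply, toDual_symm_self]
  module

theorem plusComp_plusMap (Y : L × ℝ) : plusComp g hg (plusMap g Y) = Y := by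
  rw [plusMap_apply, plusComp_apply, toDual_symm_self]
  refine Prod.ext ?_ rfl
  dsimp only
  module

theorem plusComp_minusMap (X : L) : plusComp g hg (minusMap g X) = 0 := by
  rw [minusMap_apply, plusComp_apply, map_neg, toDual_symm_self]
  refine Prod.ext ?_ rfl
  dsimp only [Prod.fst_zero]
  module

theorem plusMap_add_minusMap (v : L × Module.Dual ℝ L × ℝ) :
    plusMap g (plusComp g hg v) + minusMap g (minusComp g hg v) = v := by
  obtain ⟨X, ξ, a⟩ := v
  rw [plusComp_apply, minusComp_apply, plusMap_apply, minusMap_apply]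
  dsimp only
  rw [map_smul, map_add, map_smul, map_sub, apply_toDual_symm, Prod.mk_add_mk, Prod.mk_add_mk,
    add_zero]
  refine Prod.ext ?_ (Prod.ext ?_ rfl)
  · dsimp only
    module
  · dsimp only
    module

/-- The splitting into `E₊` and `E₋`. -/
noncomputable def genSplitting (hs : ∀ X Y, g X Y = g Y X) (M : MetricBracket (L × Module.Dual ℝ L × ℝ))
    (hM : M.B = genPairing L) : Splitting M where
  P := plusMap g ∘ₗ plusComp g hg
  Q := minusMap g ∘ₗ minusComp g hg
  add v := plusMap_add_minusMap g hg v
  PQ v := by simp only [LinearMap.comp_apply, plusComp_minusMap, map_zero]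
  QP v := by simp only [LinearMap.comp_apply, minusComp_plusMap, map_zero]
  ortho v w := by
    rw [hM, LinearMap.comp_apply, LinearMap.comp_apply, genPairing_apply, plusMap_apply,
      minusMap_apply]
    simp only [LinearMap.neg_apply]
    rw [hs]
    ring

theorem trace_plus : LinearMap.trace ℝ _ (plusMap g ∘ₗ plusComp g hg) = Module.finrank ℝ L + 1 := by
  have h : plusComp g hg ∘ₗ plusMap g = LinearMap.id :=
    LinearMap.ext fun Y => plusComp_plusMap g hg Y
  rw [LinearMap.trace_comp_comm', h, LinearMap.trace_id, Module.finrank_prod]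
  simp

theorem trace_minus : LinearMap.trace ℝ _ (minusMap g ∘ₗ minusComp g hg) = Module.finrank ℝ L := by
  have h : minusComp g hg ∘ₗ minusMap g = LinearMap.id :=
    LinearMap.ext fun Y => minusComp_minusMap g hg Y
  rw [LinearMap.trace_comp_comm', h, LinearMap.trace_id]

end Metric

end Gen

/-! ### Derivatives of the components of a trivialized section. -/

section GenValued

variable {G : Type*} [TopologicalSpace G] [ChartedSpace E3 G] [Group G] [LieGroup (𝓡 3) ∞ G]
  {L : Type*} [AddCommGroup L] [Module ℝ L] [Module.Finite ℝ L]

theorem vecD_fst {X : VF G} {U : G → L × Module.Dual ℝ L × ℝ} (hU : SmoothVec U) (x : G) :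
    vecD X (fun y => (U y).1) x = (vecD X U x).1 :=
  vecD_map (LinearMap.fst ℝ L (Module.Dual ℝ L × ℝ)) X hU x

theorem dirD_snd_fst {X : VF G} {U : G → L × Module.Dual ℝ L × ℝ} (hU : SmoothVec U) (z : L)
    (x : G) : dirD X (fun y => (U y).2.1 z) x = (vecD X U x).2.1 z :=
  (dual_vecD ((LinearMap.applyₗ z : Module.Dual ℝ L →ₗ[ℝ] ℝ) ∘ₗ
    LinearMap.fst ℝ (Module.Dual ℝ L) ℝ ∘ₗ LinearMap.snd ℝ L (Module.Dual ℝ L × ℝ)) X hU x).symm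

theorem dirD_snd_snd {X : VF G} {U : G → L × Module.Dual ℝ L × ℝ} (hU : SmoothVec U) (x : G) :
    dirD X (fun y => (U y).2.2) x = (vecD X U x).2.2 :=
  (dual_vecD (LinearMap.snd ℝ (Module.Dual ℝ L) ℝ ∘ₗ
    LinearMap.snd ℝ L (Module.Dual ℝ L × ℝ)) X hU x).symm

theorem dirD_form_vec {X : VF G} {U W : G → L × Module.Dual ℝ L × ℝ} (hU : SmoothVec U)
    (hW : SmoothVec W) (x : G) : dirD X (fun y => (U y).2.1 (W y).1) x
      = (vecD X U x).2.1 (W x).1 + (U x).2.1 (vecD X W x).1 :=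
  dirD_bilin ((LinearMap.id : Module.Dual ℝ L →ₗ[ℝ] L →ₗ[ℝ] ℝ).compl₁₂
    (LinearMap.fst ℝ (Module.Dual ℝ L) ℝ ∘ₗ LinearMap.snd ℝ L (Module.Dual ℝ L × ℝ))
    (LinearMap.fst ℝ L (Module.Dual ℝ L × ℝ))) X hU hW x

end GenValued

/-! ### The Lie bracket of vector fields in the left trivialization. -/

section Dorfman

variable {G : Type*} [TopologicalSpace G] [ChartedSpace E3 G] [Group G] [LieGroup (𝓡 3) ∞ G]

variable (G) in
/-- The bracket of the Lie algebra of `G` as a bilinear map. -/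
noncomputable def lieBil : LieAlg G →ₗ[ℝ] LieAlg G →ₗ[ℝ] LieAlg G :=
  LinearMap.mk₂ ℝ (fun X Y => ⁅X, Y⁆) add_lie smul_lie lie_add (fun c X Y => lie_smul c X Y)

theorem lieBil_swap (X Y : LieAlg G) : lieBil G X Y = -lieBil G Y X := (lie_skew X Y).symm

theorem mlieBracket_leftInv (a b : LieAlg G) (x : G) :
    VectorField.mlieBracket (𝓡 3) (fun y : G => dL y a) (fun y : G => dL y b) x
      = dL x (lieBil G a b) :=
  (congrFun (mulInvariantVector_mlieBracket (I := 𝓡 3) (G := G) a b) x).symm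

theorem mlieBracket_smul_right' (X : VF G) {f : G → ℝ} {Y : VF G} (hf : SmoothFn f)
    (hY : SmoothVF Y) (x : G) :
    VectorField.mlieBracket (𝓡 3) X (fun y => f y • Y y) x
      = dirD X f x • Y x + f x • VectorField.mlieBracket (𝓡 3) X Y x :=
  VectorField.mlieBracket_smul_right (hf.mdifferentiableAt x) (hY.mdifferentiableAt x)

theorem mlieBracket_sum_smul_right (X : VF G) {ι : Type*} (s : Finset ι) {f : ι → G → ℝ}
    {Y : ι → VF G} (hf : ∀ i, SmoothFn (f i)) (hY : ∀ i, SmoothVF (Y i)) (x : G) :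
    VectorField.mlieBracket (𝓡 3) X (fun y => ∑ i ∈ s, f i y • Y i y) x
      = ∑ i ∈ s, (dirD X (f i) x • Y i x
        + f i x • VectorField.mlieBracket (𝓡 3) X (Y i) x) := by
  classical
  induction s using Finset.induction_on with
  | empty =>
    simp only [Finset.sum_empty]
    exact congrFun (VectorField.mlieBracket_zero_right (I := 𝓡 3) (W := X)) x
  | insert i s hi ih =>
    have h := VectorField.mlieBracket_add_right (I := 𝓡 3) (V := X)
      ((SmoothVF.smul (hf i) (hY i)).mdifferentiableAt x)
      ((SmoothVF.sum s fun j => SmoothVF.smul (hf j) (hY j)).mdifferentiableAt x)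
    simp only [Finset.sum_insert hi]
    refine h.trans ?_
    rw [mlieBracket_smul_right' X (hf i) (hY i), ih]

theorem mc_mlieBracket_leftInv {Y : VF G} (a : LieAlg G) (hY : SmoothVF Y) (x : G) :
    mc x (VectorField.mlieBracket (𝓡 3) (fun y : G => dL y a) Y x)
      = vecD (fun y => dL y a) (fun y => mc y (Y y)) x + lieBil G a (mc x (Y x)) := by
  have e := mlieBracket_sum_smul_right (fun y : G => dL y a) Finset.univ
    (fun i => smoothFn_dual_mc hY ((Module.finBasis ℝ (LieAlg G)).coord i))
    (fun i => smoothVF_leftInv (Module.finBasis ℝ (LieAlg G) i)) x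
  have e2 : Y = fun y => ∑ i, (Module.finBasis ℝ (LieAlg G)).coord i (mc y (Y y)) •
      dL y (Module.finBasis ℝ (LieAlg G) i) := funext (vf_eq_sum _ Y)
  rw [← e2] at e
  rw [e, map_sum, vecD, map_eq_sum_coord (lieBil G a) (mc x (Y x)), ← Finset.sum_add_distrib]
  refine Finset.sum_congr rfl fun i _ => ?_
  rw [map_add, map_smul, map_smul, mc_dL, mlieBracket_leftInv, mc_dL]

/-- Expanding `Y` in a left-invariant frame leaves brackets of `X` with left-invariant fields; by
antisymmetry these are covered by `mc_mlieBracket_leftInv`. -/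
theorem mc_mlieBracket {X Y : VF G} (hX : SmoothVF X) (hY : SmoothVF Y) (x : G) :
    mc x (VectorField.mlieBracket (𝓡 3) X Y x)
      = vecD X (fun y => mc y (Y y)) x - vecD Y (fun y => mc y (X y)) x
        + lieBil G (mc x (X x)) (mc x (Y x)) := by
  have e := mlieBracket_sum_smul_right X Finset.univ
    (fun i => smoothFn_dual_mc hY ((Module.finBasis ℝ (LieAlg G)).coord i))
    (fun i => smoothVF_leftInv (Module.finBasis ℝ (LieAlg G) i)) x
  have e2 : Y = fun y => ∑ i, (Module.finBasis ℝ (LieAlg G)).coord i (mc y (Y y)) •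
      dL y (Module.finBasis ℝ (LieAlg G) i) := funext (vf_eq_sum _ Y)
  rw [← e2] at e
  -- At `x`, the derivative depends only on the value of `Y`, hence is a combination of derivatives
  -- along the frame.
  have e3 : vecD Y (fun y => mc y (X y)) x
      = ∑ i, (Module.finBasis ℝ (LieAlg G)).coord i (mc x (Y x)) •
        vecD (fun y => dL y (Module.finBasis ℝ (LieAlg G) i)) (fun y => mc y (X y)) x := by
    simp only [vecD, Finset.smul_sum]
    rw [Finset.sum_comm]
    refine Finset.sum_congr rfl fun j _ => ?_
    simp only [smul_smul, ← Finset.sum_smul]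
    congr 1
    conv_lhs => rw [dirD_congr (vf_eq_sum (Module.finBasis ℝ (LieAlg G)) Y x)
      (Y := fun z => ∑ i, (Module.finBasis ℝ (LieAlg G)).coord i (mc x (Y x)) •
        dL z (Module.finBasis ℝ (LieAlg G) i))]
    refine (map_sum (mvfderiv (𝓡 3) _ x) _ _).trans ?_
    exact Finset.sum_congr rfl fun i _ => map_smul (mvfderiv (𝓡 3) _ x) _ _
  have e4 := map_eq_sum_coord (lieBil G (mc x (X x))) (mc x (Y x))
  rw [e, map_sum, e3, e4, vecD, ← Finset.sum_sub_distrib, ← Finset.sum_add_distrib]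
  refine Finset.sum_congr rfl fun i _ => ?_
  rw [map_add, map_smul, map_smul, mc_dL, VectorField.mlieBracket_swap_apply, map_neg,
    mc_mlieBracket_leftInv _ hX, lieBil_swap (mc x (X x))]
  module

/-- The field `extVF z` is left-invariant, so its trivialization is constant and only one derivative
term remains. -/
theorem mc_mlieBracket_extVF {X : VF G} (hX : SmoothVF X) {x : G} (z : TangentSpace (𝓡 3) x) :
    mc x (VectorField.mlieBracket (𝓡 3) X (extVF z) x)
      = lieBil G (mc x (X x)) (mc x z) - vecD (extVF z) (fun y => mc y (X y)) x := by
  have h := mc_mlieBracket hX (smoothVF_leftInv (mc x z)) x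
  refine h.trans ?_
  have : (fun y => mc y (dL y (mc x z))) = fun _ : G => mc x z := funext fun y => mc_dL y _
  rw [this, vecD_const, mc_dL]
  change 0 - vecD (extVF z) _ x + _ = _
  abel

/-! ### The Dorfman bracket in the left trivialization -/

variable (H : InvForm G 3) (F : InvForm G 2)

variable (G) in
/-- Left-invariant sections of `E`. -/
abbrev GenAlg : Type _ := LieAlg G × Module.Dual ℝ (LieAlg G) × ℝ

/-- The space of left-invariant sections of `E`, with its scalar product and Dorfman bracket. -/
noncomputable def dorfmanAlg : MetricBracket (GenAlg G) := genBracket (lieBil G) lieBil_swap H F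

theorem dorfmanAlg_B : (dorfmanAlg H F).B = genPairing (LieAlg G) := rfl

theorem pairing_eq (x : G) (p q : Fib x) :
    pairing x p q = (dorfmanAlg H F).B (triv x p) (triv x q) := pairing_eq_triv x p q

/-- A section in the left trivialization. -/
noncomputable def Sec.triv (u : Sec G) : G → GenAlg G := fun x => OddGen.triv x (u x)

theorem SmoothSec.triv {u : Sec G} (hu : SmoothSec u) : SmoothVec u.triv := smoothSec_iff.1 hu

theorem form_eq_triv (u : Sec G) (x : G) (z : TangentSpace (𝓡 3) x) :
    u.form x z = (u.triv x).2.1 (mc x z) := congrArg (u.form x) (dL_mc x z).symm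

theorem vec_eq_triv (u : Sec G) (x : G) : mc x (u.vec x) = (u.triv x).1 := rfl

theorem fn_eq_triv (u : Sec G) (x : G) : u.fn x = (u.triv x).2.2 := rfl

theorem lieForm_eq {u v : Sec G} (hu : SmoothSec u) (hv : SmoothSec v) (x : G)
    (z : TangentSpace (𝓡 3) x) :
    lieForm u.vec v.form x z = (vecD u.vec v.triv x).2.1 (mc x z)
      + (v.triv x).2.1 ((vecD (extVF z) u.triv x).1)
      - (v.triv x).2.1 (lieBil G (u.triv x).1 (mc x z)) := by
  rw [lieForm, form_eq_triv, mc_mlieBracket_extVF hu.vec]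
  have h1 : (fun y => v.form y (extVF z y)) = fun y => (v.triv y).2.1 (mc x z) := rfl
  have h2 : (fun y => mc y (u.vec y)) = fun y => (u.triv y).1 := rfl
  rw [h1, h2, dirD_snd_fst hv.triv, vecD_fst hu.triv, vec_eq_triv, map_sub]
  ring

theorem dForm_eq {u v : Sec G} (hu : SmoothSec u) (hv : SmoothSec v) (x : G)
    (z : TangentSpace (𝓡 3) x) :
    dForm u.form v.vec x z = (vecD v.vec u.triv x).2.1 (mc x z)
      - (vecD (extVF z) u.triv x).2.1 (v.triv x).1
      - (u.triv x).2.1 (lieBil G (v.triv x).1 (mc x z)) := by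
  rw [dForm, form_eq_triv, mc_mlieBracket_extVF hv.vec]
  have h1 : (fun y => u.form y (extVF z y)) = fun y => (u.triv y).2.1 (mc x z) := rfl
  have h2 : (fun y => mc y (v.vec y)) = fun y => (v.triv y).1 := rfl
  have h3 : (fun y => u.form y (v.vec y)) = fun y => (u.triv y).2.1 ((v.triv y).1) :=
    funext fun y => form_eq_triv u y _
  rw [h1, h2, h3, dirD_snd_fst hu.triv, vec_eq_triv, map_sub, dirD_form_vec hu.triv hv.triv,
    vecD_fst hv.triv]
  ring

/-- The one-form part of the Dorfman bracket, in the left trivialization. -/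
noncomputable def dorfmanFormTriv (u v : Sec G) (x : G) : Module.Dual ℝ (LieAlg G) where
  toFun z := (vecD u.vec v.triv x - vecD v.vec u.triv x).2.1 z
    + 2 * genPairing (LieAlg G) (vecD (fun y => dL y z) u.triv x) (v.triv x)
    + 2 * genForm (lieBil G) H F (u.triv x) (v.triv x) (z, 0, 0)
  map_add' z z' := by
    have h1 : vecD (fun y => dL y (z + z')) u.triv x
        = vecD (fun y => dL y z) u.triv x + vecD (fun y => dL y z') u.triv x := by
      rw [← vecD_add_left]
      exact vecD_congr (map_add _ _ _) _
    have h2 : ((z + z', 0, 0) : GenAlg G) = (z, 0, 0) + (z', 0, 0) := by simp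
    rw [h1, h2, map_add, map_add, map_add, LinearMap.add_apply]
    ring
  map_smul' c z := by
    have h1 : vecD (fun y => dL y (c • z)) u.triv x = c • vecD (fun y => dL y z) u.triv x := by
      rw [← vecD_smul_left (fun _ => c)]
      exact vecD_congr (map_smul _ _ _) _
    have h2 : ((c • z, 0, 0) : GenAlg G) = c • (z, 0, 0) := by simp
    rw [h1, h2, map_smul, map_smul, map_smul, LinearMap.smul_apply]
    simp only [smul_eq_mul, RingHom.id_apply]
    ring

theorem dorfmanForm_eq {u v : Sec G} (hu : SmoothSec u) (hv : SmoothSec v) (x : G)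
    (z : TangentSpace (𝓡 3) x) :
    dorfmanForm H F u v x z = dorfmanFormTriv H F u v x (mc x z) := by
  -- In `i_X i_Y H` the vector `Y` occupies the first slot, whence the sign.
  have h1 : evalH H x (v.vec x) (u.vec x) z
      = -trilinOfForm H (u.triv x).1 (v.triv x).1 (mc x z) := by
    rw [trilinOfForm_swap, neg_neg]
    rfl
  have h2 : ∀ w : Sec G, evalF F x (w.vec x) z = bilinOfForm F (w.triv x).1 (mc x z) :=
    fun _ => rfl
  have h3 : dirD (extVF z) u.fn x = (vecD (extVF z) u.triv x).2.2 := dirD_snd_snd hu.triv x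
  rw [dorfmanForm, lieForm_eq hu hv, dForm_eq hu hv, h1, h2, h2, h3, fn_eq_triv, fn_eq_triv]
  change _ = (vecD u.vec v.triv x - vecD v.vec u.triv x).2.1 (mc x z)
    + 2 * genPairing (LieAlg G) (vecD (extVF z) u.triv x) (v.triv x)
    + 2 * genForm (lieBil G) H F (u.triv x) (v.triv x) (mc x z, 0, 0)
  rw [genForm_apply, genPairing_apply, bilinOfForm_swap F (mc x z), lieBil_swap (mc x z),
    Prod.snd_sub, Prod.fst_sub, LinearMap.sub_apply]
  simp only [map_neg, LinearMap.zero_apply]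
  ring

/-- Pairing with `w` merges the three components of the bracket: the derivative terms are those of
the case of vanishing structure constants, `H` and `F`, and all the remaining data sit in the
constant three-form `genForm`. -/
theorem dorfman_triv {u v : Sec G} (hu : SmoothSec u) (hv : SmoothSec v) (x : G) (w : GenAlg G) :
    genPairing (LieAlg G) ((dorfman H F u v).triv x) w
      = genPairing (LieAlg G) (vecD u.vec v.triv x - vecD v.vec u.triv x) w
        + genPairing (LieAlg G) (vecD (fun y => dL y w.1) u.triv x) (v.triv x)
        + genForm (lieBil G) H F (u.triv x) (v.triv x) w := by
  have h1 : ((dorfman H F u v).triv x).1 = (vecD u.vec v.triv x - vecD v.vec u.triv x).1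
      + lieBil G (u.triv x).1 (v.triv x).1 := by
    have := mc_mlieBracket hu.vec hv.vec x
    refine this.trans ?_
    congr 1
    exact congrArg₂ (· - ·) (vecD_fst hv.triv x) (vecD_fst hu.triv x)
  have h2 : ((dorfman H F u v).triv x).2.1 = dorfmanFormTriv H F u v x := by
    have h3 : (dorfman H F u v x).2.1 = dorfmanFormTriv H F u v x ∘ₗ mc x := by
      refine (Module.finBasis ℝ (TangentSpace (𝓡 3) x)).ext fun i => ?_
      refine (Module.Basis.constr_basis _ _ _ _).trans ?_
      exact dorfmanForm_eq H F hu hv x _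
    refine LinearMap.ext fun z => ?_
    have h4 : ((dorfman H F u v).triv x).2.1 z = (dorfman H F u v x).2.1 (dL x z) := rfl
    rw [h4, h3, LinearMap.comp_apply, mc_dL]
  have h5 : ((dorfman H F u v).triv x).2.2 = (vecD u.vec v.triv x - vecD v.vec u.triv x).2.2
      + bilinOfForm F (u.triv x).1 (v.triv x).1 := by
    have h6 : dirD u.vec v.fn x = (vecD u.vec v.triv x).2.2 := dirD_snd_snd hv.triv x
    have h7 : dirD v.vec u.fn x = (vecD v.vec u.triv x).2.2 := dirD_snd_snd hu.triv x
    exact congrArg₂ (· + ·) (congrArg₂ (· - ·) h6 h7) rfl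
  have h8 : dorfmanFormTriv H F u v x w.1 = (vecD u.vec v.triv x - vecD v.vec u.triv x).2.1 w.1
    + 2 * genPairing (LieAlg G) (vecD (fun y => dL y w.1) u.triv x) (v.triv x)
    + 2 * genForm (lieBil G) H F (u.triv x) (v.triv x) (w.1, 0, 0) := rfl
  rw [genPairing_apply, h1, h2, h5, h8, genForm_apply, genForm_apply,
    genPairing_apply (vecD u.vec v.triv x - vecD v.vec u.triv x) w, map_add]
  simp only [LinearMap.zero_apply]
  ring

end Dorfman

section Connection

variable {G : Type*} [TopologicalSpace G] [ChartedSpace E3 G] [Group G] [LieGroup (𝓡 3) ∞ G]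
  (H : InvForm G 3) (F : InvForm G 2)

theorem leftInv_triv (a : GenAlg G) : (leftInv a : Sec G).triv = fun _ => a :=
  funext fun x => triv_leftInv a x

theorem smoothSec_leftInv (a : GenAlg G) : SmoothSec (leftInv a : Sec G) := by
  refine smoothSec_iff.2 ?_
  change SmoothVec (leftInv a : Sec G).triv
  rw [leftInv_triv]
  exact smoothVec_const a

theorem Sec.ext_triv {u v : Sec G} (h : ∀ x, u.triv x = v.triv x) : u = v :=
  funext fun x => (OddGen.triv x).injective (h x)

theorem triv_add (u v : Sec G) (x : G) : (u + v).triv x = u.triv x + v.triv x :=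
  map_add (OddGen.triv x) _ _

theorem triv_smul (f : G → ℝ) (u : Sec G) (x : G) :
    Sec.triv (fun y => f y • u y) x = f x • u.triv x :=
  map_smul (OddGen.triv x) _ _

theorem smoothSec_iff_triv {u : Sec G} : SmoothSec u ↔ SmoothVec u.triv := smoothSec_iff

theorem SmoothSec.add {u v : Sec G} (hu : SmoothSec u) (hv : SmoothSec v) : SmoothSec (u + v) := by
  rw [smoothSec_iff_triv, show (u + v).triv = fun x => u.triv x + v.triv x from
    funext (triv_add u v)]
  exact hu.triv.add hv.triv

theorem SmoothSec.smul {f : G → ℝ} {u : Sec G} (hf : SmoothFn f) (hu : SmoothSec u) :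
    SmoothSec (fun x => f x • u x) := by
  rw [smoothSec_iff_triv, show Sec.triv (fun x => f x • u x) = fun x => f x • u.triv x from
    funext (triv_smul f u)]
  exact SmoothVec.smul hf hu.triv

theorem dorfman_leftInv (a b : GenAlg G) :
    dorfman H F (leftInv a) (leftInv b) = leftInv ((dorfmanAlg H F).br a b) := by
  refine Sec.ext_triv fun x => (dorfmanAlg H F).ext_B fun w => ?_
  have h := dorfman_triv H F (smoothSec_leftInv a) (smoothSec_leftInv b) x w
  rw [leftInv_triv, leftInv_triv, vecD_const, vecD_const, vecD_const, sub_zero, map_zero,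
    LinearMap.zero_apply, LinearMap.zero_apply, zero_add, zero_add] at h
  rw [leftInv_triv]
  exact h.trans (genPairing_br _ _ _ _ _ _ _).symm

/-! ### The generalized metric in the left trivialization -/

variable {g : LinearMap.BilinForm ℝ (LieAlg G)}

/-- The splitting of the space of left-invariant sections into `E₊` and `E₋`. -/
noncomputable def metricSplitting (hg : g.Nondegenerate) (hs : ∀ X Y, g X Y = g Y X) :
    Splitting (dorfmanAlg H F) := genSplitting g hg hs _ rfl

theorem mem_Eminus_iff (hg : g.Nondegenerate) (hs : ∀ X Y, g X Y = g Y X) {x : G} (w : Fib x) :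
    w ∈ Eminus g x ↔ (metricSplitting H F hg hs).Q (triv x w) = triv x w := by
  constructor
  · rintro ⟨X, rfl⟩
    have : triv x (((LinearMap.id : TangentSpace (𝓡 3) x →ₗ[ℝ] _).prod
        ((-evalG g x).prod 0)) X) = minusMap g (mc x X) := by
      refine Prod.ext rfl (Prod.ext ?_ rfl)
      ext z
      change -(g (mc x X) (mc x (dL x z))) = -(g (mc x X) z)
      rw [mc_dL]
    rw [this]
    exact congrArg (minusMap g) (minusComp_minusMap g hg _)
  · intro h
    refine ⟨dL x (minusComp g hg (triv x w)), (triv x).injective ?_⟩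
    refine Eq.trans ?_ h
    refine Prod.ext (mc_dL x _) (Prod.ext ?_ rfl)
    ext z
    change -(g (mc x (dL x (minusComp g hg (triv x w)))) (mc x (dL x z))) = _
    rw [mc_dL, mc_dL]
    rfl

theorem mem_Eplus_iff (hg : g.Nondegenerate) (hs : ∀ X Y, g X Y = g Y X) {x : G} (w : Fib x) :
    w ∈ Eplus g x ↔ (metricSplitting H F hg hs).P (triv x w) = triv x w := by
  set S := metricSplitting H F hg hs
  rw [Eplus, LinearMap.BilinForm.mem_orthogonal_iff]
  constructor
  · intro h
    have h1 : S.Q (triv x w) = 0 := by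
      refine (dorfmanAlg H F).ext_B fun z => ?_
      have h2 : (triv x).symm (S.Q z) ∈ Eminus g x := by
        rw [mem_Eminus_iff H F hg hs, LinearEquiv.apply_symm_apply]
        exact S.swap.PP z
      have h3 := h _ h2
      change pairing x _ _ = 0 at h3
      rw [pairing_eq H F, LinearEquiv.apply_symm_apply] at h3
      rw [show (dorfmanAlg H F).B (S.Q (triv x w)) z = (dorfmanAlg H F).B (triv x w) (S.Q z) from
        S.swap.adjoint _ _, (dorfmanAlg H F).symm, h3, map_zero, LinearMap.zero_apply]
    have := S.add (triv x w)
    rwa [h1, add_zero] at this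
  · intro h n hn
    change pairing x _ _ = 0
    rw [mem_Eminus_iff H F hg hs] at hn
    rw [pairing_eq H F, ← hn, ← h, (dorfmanAlg H F).symm]
    exact S.ortho _ _

/-! ### Connection coefficients -/

section Coefficients

variable {D : Sec G → Sec G → Sec G} (hD : IsGenConnection D)

include hD

theorem conn_leftInv_add_left (a a' : GenAlg G) {v : Sec G} (hv : SmoothSec v) (x : G) :
    D (leftInv (a + a')) v x = D (leftInv a) v x + D (leftInv a') v x := by
  have h := hD.add_left (leftInv a) (leftInv a') v (smoothSec_leftInv a)
    (smoothSec_leftInv a') hv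
  rw [← show leftInv (a + a') = (leftInv a + leftInv a' : Sec G) from
    funext fun x => map_add (triv x).symm a a'] at h
  exact congrFun h x

theorem conn_leftInv_smul_left (c : ℝ) (a : GenAlg G) {v : Sec G} (hv : SmoothSec v) (x : G) :
    D (leftInv (c • a)) v x = c • D (leftInv a) v x := by
  have h := hD.smul_left (fun _ => c) (leftInv a) v (smoothFn_const c) (smoothSec_leftInv a) hv
  rw [← show leftInv (c • a) = (fun x => c • leftInv a x : Sec G) from
    funext fun x => map_smul (triv x).symm c a] at h
  exact congrFun h x

theorem conn_zero_right {u : Sec G} (hu : SmoothSec u) : D u 0 = 0 := by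
  have h0 : SmoothSec (0 : Sec G) := by
    have := smoothSec_leftInv (0 : GenAlg G)
    rwa [show leftInv (0 : GenAlg G) = (0 : Sec G) from
      funext fun x => map_zero (triv x).symm] at this
  have h := hD.add_right u 0 0 hu h0 h0
  rw [add_zero] at h
  exact left_eq_add.1 h

/-- Smoothness of the sum is part of the induction because additivity of `D` is only available on
smooth sections. -/
theorem conn_sum_smul {u : Sec G} (hu : SmoothSec u) {ι : Type*} (s : Finset ι) {f : ι → G → ℝ}
    (hf : ∀ i, SmoothFn (f i)) {v : ι → Sec G} (hv : ∀ i, SmoothSec (v i)) :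
    SmoothSec (∑ i ∈ s, fun x => f i x • v i x : Sec G) ∧
    D u (∑ i ∈ s, fun x => f i x • v i x) = ∑ i ∈ s, fun x => dirD u.vec (f i) x • v i x
      + f i x • D u (v i) x := by
  classical
  induction s using Finset.induction_on with
  | empty =>
    simp only [Finset.sum_empty]
    refine ⟨?_, conn_zero_right hD hu⟩
    have := smoothSec_leftInv (0 : GenAlg G)
    rwa [show leftInv (0 : GenAlg G) = (0 : Sec G) from
      funext fun x => map_zero (triv x).symm] at this
  | insert i s hi ih =>
    rw [Finset.sum_insert hi, Finset.sum_insert hi]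
    refine ⟨(SmoothSec.smul (hf i) (hv i)).add ih.1, ?_⟩
    rw [hD.add_right u _ _ hu (SmoothSec.smul (hf i) (hv i)) ih.1, ih.2,
      hD.leibniz _ _ _ (hf i) hu (hv i)]

/-- The coefficients at `x` of a connection, in the left trivialization. -/
noncomputable def connCoeff (x : G) : GenAlg G →ₗ[ℝ] GenAlg G →ₗ[ℝ] GenAlg G :=
  LinearMap.mk₂ ℝ (fun a b => (D (leftInv a) (leftInv b)).triv x)
    (fun a a' b => (congrArg (triv x)
      (conn_leftInv_add_left hD a a' (smoothSec_leftInv b) x)).trans (map_add _ _ _))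
    (fun c a b => (congrArg (triv x)
      (conn_leftInv_smul_left hD c a (smoothSec_leftInv b) x)).trans (map_smul _ _ _))
    (fun a b b' => by
      have h := hD.add_right (leftInv a) (leftInv b) (leftInv b') (smoothSec_leftInv a)
        (smoothSec_leftInv b) (smoothSec_leftInv b')
      rw [← show leftInv (b + b') = (leftInv b + leftInv b' : Sec G) from
        funext fun x => map_add (triv x).symm b b'] at h
      rw [h, triv_add])
    (fun c a b => by
      have h := hD.leibniz (fun _ => c) (leftInv a) (leftInv b) (smoothFn_const c)
        (smoothSec_leftInv a) (smoothSec_leftInv b)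
      rw [← show leftInv (c • b) = (fun x => c • leftInv b x : Sec G) from
        funext fun x => map_smul (triv x).symm c b] at h
      rw [h]
      refine (map_add (triv x) _ _).trans ?_
      rw [dirD_const, zero_smul, map_zero, zero_add, map_smul]
      rfl)

theorem connCoeff_apply (x : G) (a b : GenAlg G) :
    connCoeff hD x a b = (D (leftInv a) (leftInv b)).triv x := rfl

theorem smoothVec_connCoeff (a b : GenAlg G) : SmoothVec (fun x => connCoeff hD x a b) :=
  (hD.smooth _ _ (smoothSec_leftInv a) (smoothSec_leftInv b)).triv

/-- The section is expanded in a left-invariant frame and the Leibniz rule applied. As `D` is not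
assumed left-invariant, its coefficients depend on `x`. -/
theorem conn_leftInv_triv (a : GenAlg G) {s : Sec G} (hs : SmoothSec s) (x : G) :
    (D (leftInv a) s).triv x
      = vecD (fun y => dL y a.1) s.triv x + connCoeff hD x a (s.triv x) := by
  have e : s = ∑ i, fun x => (Module.finBasis ℝ (GenAlg G)).coord i (s.triv x) •
      (leftInv (Module.finBasis ℝ (GenAlg G) i) : Sec G) x := by
    funext x
    rw [Finset.sum_apply]
    refine (triv x).injective ?_
    rw [map_sum]
    refine ((Module.finBasis ℝ (GenAlg G)).sum_repr (s.triv x)).symm.trans ?_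
    refine Finset.sum_congr rfl fun i _ => ?_
    rw [map_smul, triv_leftInv]
    rfl
  have h := (conn_sum_smul hD (smoothSec_leftInv a) Finset.univ
    (fun i => hs.triv ((Module.finBasis ℝ (GenAlg G)).coord i))
    (fun i => smoothSec_leftInv (Module.finBasis ℝ (GenAlg G) i))).2
  rw [← e] at h
  have h1 := congrArg (triv x) (congrFun h x)
  rw [Finset.sum_apply, map_sum] at h1
  refine h1.trans ?_
  rw [map_eq_sum_coord (connCoeff hD x a) (s.triv x), vecD, ← Finset.sum_add_distrib]
  refine Finset.sum_congr rfl fun i _ => ?_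
  rw [map_add, map_smul, map_smul, triv_leftInv]
  rfl

end Coefficients

theorem trace_eq_sum_coord {V : Type*} [AddCommGroup V] [Module ℝ V] [Module.Finite ℝ V]
    (A : V →ₗ[ℝ] V) : LinearMap.trace ℝ V A
      = ∑ i, (Module.finBasis ℝ V).coord i (A (Module.finBasis ℝ V i)) := by
  rw [LinearMap.trace_eq_matrix_trace ℝ (Module.finBasis ℝ V), Matrix.trace]
  refine Finset.sum_congr rfl fun i _ => ?_
  rw [Matrix.diag_apply, LinearMap.toMatrix_apply]
  rfl

/-- The trace of a derivative is the derivative of the trace. -/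
theorem trace_vecD {V : Type*} [AddCommGroup V] [Module ℝ V] [Module.Finite ℝ V] (X : VF G)
    {A : G → V →ₗ[ℝ] V} (hA : ∀ w, SmoothVec (fun y => A y w)) (x : G) {E : V →ₗ[ℝ] V}
    (hE : ∀ w, E w = vecD X (fun y => A y w) x) :
    LinearMap.trace ℝ V E = dirD X (fun y => LinearMap.trace ℝ V (A y)) x := by
  simp only [trace_eq_sum_coord]
  rw [dirD_sum X _ fun i => hA _ _]
  refine Finset.sum_congr rfl fun i _ => ?_
  rw [hE, dual_vecD _ _ (hA _)]

theorem exists_vecD_linearMap {V : Type*} [AddCommGroup V] [Module ℝ V] [Module.Finite ℝ V]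
    (X : VF G) {A : G → V →ₗ[ℝ] V} (hA : ∀ w, SmoothVec (fun y => A y w)) (x : G) :
    ∃ E : V →ₗ[ℝ] V, ∀ w, E w = vecD X (fun y => A y w) x := by
  refine ⟨⟨⟨fun w => vecD X (fun y => A y w) x, fun w w' => ?_⟩, fun c w => ?_⟩, fun w => rfl⟩
  · rw [← vecD_add _ (hA w) (hA w')]
    simp only [map_add]
  · change vecD X (fun y => A y (c • w)) x = c • vecD X (fun y => A y w) x
    rw [show (fun y => A y (c • w)) = fun y => (c • LinearMap.id : V →ₗ[ℝ] V) (A y w) from by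
      funext y; simp, vecD_map _ _ (hA w)]
    rfl

/-- A constant trace has zero derivative. This removes the derivatives of the connection
coefficients from the Ricci tensor. -/
theorem trace_vecD_comp {V : Type*} [AddCommGroup V] [Module ℝ V] [Module.Finite ℝ V] (X : VF G)
    {A : G → V →ₗ[ℝ] V} (hA : ∀ w, SmoothVec (fun y => A y w)) (x : G) {E : V →ₗ[ℝ] V}
    (hE : ∀ w, E w = vecD X (fun y => A y w) x) (P : V →ₗ[ℝ] V) (c : ℝ)
    (hc : ∀ y, LinearMap.trace ℝ V (A y ∘ₗ P) = c) : LinearMap.trace ℝ V (E ∘ₗ P) = 0 := by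
  rw [trace_vecD X (A := fun y => A y ∘ₗ P) (fun w => hA (P w)) x (fun w => hE (P w))]
  simp only [hc, dirD_const]

/-! ### The Ricci tensors of a Levi-Civita generalized connection -/

section Ricci

variable {H F} {D : Sec G → Sec G → Sec G}

theorem isAlgLC_connCoeff (hg : g.Nondegenerate) (hs : ∀ X Y, g X Y = g Y X)
    (hD : IsLeviCivita H F g D) (x : G) :
    IsAlgLC (dorfmanAlg H F) (metricSplitting H F hg hs) (connCoeff hD.toIsGenConnection x) where
  metric a b c := by
    have h := hD.metric _ _ _ (smoothSec_leftInv a) (smoothSec_leftInv b) (smoothSec_leftInv c) x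
    have h1 : (fun y : G => pairing y (leftInv b y) (leftInv c y))
        = fun _ => (dorfmanAlg H F).B b c := by
      funext y
      rw [pairing_eq H F, triv_leftInv, triv_leftInv]
    rw [h1, dirD_const, pairing_eq H F, pairing_eq H F, triv_leftInv, triv_leftInv] at h
    exact h.symm
  torsion a b c := by
    have h := hD.torsion_free _ _ _ (smoothSec_leftInv a) (smoothSec_leftInv b)
      (smoothSec_leftInv c) x
    rw [pairing_eq H F, pairing_eq H F, triv_leftInv, triv_leftInv, map_sub (triv x),
      map_sub (triv x), dorfman_leftInv, triv_leftInv] at h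
    exact h
  preserves a b := by
    have h := hD.preserves (leftInv a) (leftInv ((metricSplitting H F hg hs).Q b))
      (smoothSec_leftInv _) (smoothSec_leftInv _) (fun y => by
        rw [mem_Eminus_iff H F hg hs, triv_leftInv]
        exact (metricSplitting H F hg hs).swap.PP b) x
    rw [mem_Eminus_iff H F hg hs] at h
    rw [connCoeff_apply, Sec.triv, ← h, (metricSplitting H F hg hs).PQ]

theorem hasDivergence_iff (hD : IsGenConnection D) {δ : Module.Dual ℝ (Fib (1 : G))} :
    HasDivergence D δ ↔ ∀ x a, LinearMap.trace ℝ (GenAlg G) ((connCoeff hD x).flip a) = δ a := by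
  rw [HasDivergence, forall_comm]
  refine forall_congr' fun x => forall_congr' fun a => ?_
  refine (hasTraceOn_iff (triv x) (P := LinearMap.id) (R := (connCoeff hD x).flip a) (fun _ => rfl)
    (fun w => by simp) (fun _ => rfl) (fun w _ => rfl) _).trans ?_
  rw [LinearMap.comp_id]

theorem triv_curv (H : InvForm G 3) (F : InvForm G 2) (D : Sec G → Sec G → Sec G) (u v w : Sec G)
    (x : G) : triv x (curv H F D u v w x) = (D u (D v w)).triv x - (D v (D u w)).triv x
      - (D (dorfman H F u v) w).triv x :=
  (map_sub (triv x) (D u (D v w) x - D v (D u w) x) (D (dorfman H F u v) w x)).trans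
    (congrArg (· - triv x (D (dorfman H F u v) w x))
      (map_sub (triv x) (D u (D v w) x) (D v (D u w) x)))

/-- Here `D u v` is of mixed type, so it has constant components and `D w (D u v)` is purely
algebraic. Only `D u (D w v)` involves a derivative of the coefficients, namely `E`, and `E` has
trace zero over the range of `P` since the divergence is constant. -/
theorem hasTraceOn_curv {S : Splitting (dorfmanAlg H F)} (hD : IsGenConnection D)
    (hS : ∀ x, IsAlgLC (dorfmanAlg H F) S (connCoeff hD x)) {δ : Module.Dual ℝ (Fib (1 : G))}
    (hδ : ∀ x a, LinearMap.trace ℝ (GenAlg G) ((connCoeff hD x).flip a) = δ a) (x : G)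
    {A : Submodule ℝ (Fib x)} (hA : ∀ w, w ∈ A ↔ S.P (triv x w) = triv x w) {u v : GenAlg G}
    (hu : S.Q u = u) (hv : S.P v = v) (t : ℝ) :
    HasTraceOn A (fun w => curv H F D (extSec w) (leftInv u) (leftInv v) x) t
      ↔ S.ric δ u v = t := by
  obtain ⟨E, hE⟩ := exists_vecD_linearMap (fun y => dL y u.1)
    (A := fun y => (connCoeff hD y).flip v) (fun w => smoothVec_connCoeff hD w v) x
  have hEP : LinearMap.trace ℝ _ (E ∘ₗ S.P) = 0 := by
    refine trace_vecD_comp _ (fun w => smoothVec_connCoeff hD w v) x hE S.P (δ v) fun y => ?_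
    have := (hS y).trace_comp (hδ y) v
    rwa [hv] at this
  have hmix : ∀ y, connCoeff hD y u v = S.P ((dorfmanAlg H F).br u v) := fun y => by
    have := (hS y).mixed u v
    rwa [hu, hv] at this
  have hric := (hS x).trace_curvature (hδ x) u v E hEP
  rw [hu, hv] at hric
  rw [← hric]
  refine hasTraceOn_iff (triv x) S.PP hA ?_ ?_ t
  · intro w
    have hPv : ∀ y a, S.P (connCoeff hD y a v) = connCoeff hD y a v := fun y a => by
      rw [(hS y).commute, hv]
    have h1 : S.P (E (S.P w)) = E (S.P w) := by
      have h2 := vecD_map S.P (fun y => dL y u.1) (smoothVec_connCoeff hD (S.P w) v) x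
      simp only [hPv] at h2
      exact (congrArg S.P (hE (S.P w))).trans (h2.symm.trans (hE (S.P w)).symm)
    simp only [LinearMap.sub_apply, LinearMap.comp_apply, LinearMap.flip_apply, map_sub]
    rw [h1, (hS x).commute _ (connCoeff hD x u v), (hS x).commute _ (connCoeff hD x _ v), hPv, hPv,
      hPv]
  · intro w _
    have e1 : (D (leftInv (triv x w)) (D (leftInv u) (leftInv v))).triv x
        = connCoeff hD x (triv x w) (connCoeff hD x u v) := by
      have h := conn_leftInv_triv hD (triv x w)
        (hD.smooth _ _ (smoothSec_leftInv u) (smoothSec_leftInv v)) x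
      have h3 : (D (leftInv u) (leftInv v)).triv = fun _ => S.P ((dorfmanAlg H F).br u v) :=
        funext hmix
      rw [h3, vecD_const, zero_add] at h
      rw [h, hmix]
    have e2 : (D (leftInv u) (D (leftInv (triv x w)) (leftInv v))).triv x
        = E (triv x w) + connCoeff hD x u (connCoeff hD x (triv x w) v) := by
      exact (conn_leftInv_triv hD u
        (hD.smooth _ _ (smoothSec_leftInv (triv x w)) (smoothSec_leftInv v)) x).trans
        (congrArg (· + _) (hE (triv x w)).symm)
    have e3 : (D (dorfman H F (leftInv (triv x w)) (leftInv u)) (leftInv v)).triv x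
        = connCoeff hD x ((dorfmanAlg H F).br (triv x w) u) v := by
      rw [dorfman_leftInv, connCoeff_apply]
    have e4 : triv x (curv H F D (extSec w) (leftInv u) (leftInv v) x)
      = (D (leftInv (triv x w)) (D (leftInv u) (leftInv v))).triv x
        - (D (leftInv u) (D (leftInv (triv x w)) (leftInv v))).triv x
        - (D (dorfman H F (leftInv (triv x w)) (leftInv u)) (leftInv v)).triv x := by
      rw [extSec_eq]
      exact triv_curv H F D _ _ _ x
    refine e4.trans ((congrArg₂ (· - ·) (congrArg₂ (· - ·) e1 e2) e3).trans ?_)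
    have h : ∀ a b c d : GenAlg G, a - (b + c) - d = a - b - c - d := by intros; abel
    exact h _ _ _ _

/-- The criterion involves neither `D` nor the point. Both conditions come from `hasTraceOn_curv`,
for the splitting and for its interchange; they may be stated for all `u` and `v` because `ric` only
sees their projections. -/
theorem ricciFlat_iff (hg : g.Nondegenerate) (hs : ∀ X Y, g X Y = g Y X)
    (hD : IsLeviCivita H F g D) {δ : Module.Dual ℝ (Fib (1 : G))} (hδ : HasDivergence D δ) :
    RicciFlat H F g D ↔ (∀ u v, (metricSplitting H F hg hs).ric δ u v = 0) ∧
      ∀ u v, (metricSplitting H F hg hs).swap.ric δ u v = 0 := by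
  set S := metricSplitting H F hg hs
  rw [hasDivergence_iff hD.toIsGenConnection] at hδ
  have hS := isAlgLC_connCoeff hg hs hD
  have hQ : ∀ v, S.Q (S.Q v) = S.Q v := S.swap.PP
  have hric : ∀ u v, S.ric δ (S.Q u) (S.P v) = S.ric δ u v := fun u v => by
    rw [Splitting.ric, Splitting.ric, Splitting.doubleBr, Splitting.doubleBr, S.PP, hQ]
  have hric' : ∀ u v, S.swap.ric δ (S.P u) (S.Q v) = S.swap.ric δ u v := fun u v => by
    rw [Splitting.ric, Splitting.ric, Splitting.doubleBr, Splitting.doubleBr,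
      show S.swap.P (S.Q v) = S.swap.P v from hQ v, show S.swap.Q (S.P u) = S.swap.Q u from S.PP u]
  have key := fun (x : G) u v (hu : S.Q u = u) (hv : S.P v = v) =>
    hasTraceOn_curv hD.toIsGenConnection hS hδ x (mem_Eplus_iff H F hg hs) hu hv 0
  have key' := fun (x : G) u v (hu : S.P u = u) (hv : S.Q v = v) =>
    hasTraceOn_curv (S := S.swap) hD.toIsGenConnection (fun x => (hS x).swap) hδ x
      (mem_Eminus_iff H F hg hs) hu hv 0
  constructor
  · intro h
    refine ⟨fun u v => ?_, fun u v => ?_⟩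
    · rw [← hric]
      refine (key 1 _ _ (hQ u) (S.PP v)).1 ?_
      have := (h 1).1 ((triv 1).symm (S.Q u)) ((mem_Eminus_iff H F hg hs _).2 (by
        rw [LinearEquiv.apply_symm_apply]; exact hQ u)) ((triv 1).symm (S.P v))
        ((mem_Eplus_iff H F hg hs _).2 (by rw [LinearEquiv.apply_symm_apply]; exact S.PP v))
      simpa only [extSec_eq, LinearEquiv.apply_symm_apply] using this
    · rw [← hric']
      refine (key' 1 _ _ (S.PP u) (hQ v)).1 ?_
      have := (h 1).2 ((triv 1).symm (S.P u)) ((mem_Eplus_iff H F hg hs _).2 (by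
        rw [LinearEquiv.apply_symm_apply]; exact S.PP u)) ((triv 1).symm (S.Q v))
        ((mem_Eminus_iff H F hg hs _).2 (by rw [LinearEquiv.apply_symm_apply]; exact hQ v))
      simpa only [extSec_eq, LinearEquiv.apply_symm_apply] using this
  · intro h x
    refine ⟨fun u hu v hv => ?_, fun u hu v hv => ?_⟩
    · exact (key x _ _ ((mem_Eminus_iff H F hg hs _).1 hu)
        ((mem_Eplus_iff H F hg hs _).1 hv)).2 (h.1 _ _)
    · exact (key' x _ _ ((mem_Eplus_iff H F hg hs _).1 hu)
        ((mem_Eminus_iff H F hg hs _).1 hv)).2 (h.2 _ _)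

end Ricci

end Connection

/-! ### Existence of Levi-Civita generalized connections with prescribed divergence. -/

section Existence

variable {G : Type*} [TopologicalSpace G] [ChartedSpace E3 G] [Group G] [LieGroup (𝓡 3) ∞ G]

/-- The left-invariant connection with coefficients `Γ`. -/
noncomputable def invConn (Γ : GenAlg G →ₗ[ℝ] GenAlg G →ₗ[ℝ] GenAlg G) (u v : Sec G) : Sec G :=
  fun x => (triv x).symm (vecD u.vec v.triv x + Γ (u.triv x) (v.triv x))

variable (Γ : GenAlg G →ₗ[ℝ] GenAlg G →ₗ[ℝ] GenAlg G)

theorem invConn_triv (u v : Sec G) (x : G) :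
    (invConn Γ u v).triv x = vecD u.vec v.triv x + Γ (u.triv x) (v.triv x) :=
  (triv x).apply_symm_apply _

theorem triv_invConn (u v : Sec G) (x : G) :
    triv x (invConn Γ u v x) = vecD u.vec v.triv x + Γ (u.triv x) (v.triv x) :=
  (triv x).apply_symm_apply _

theorem SmoothSec.invConn {u v : Sec G} (hu : SmoothSec u) (hv : SmoothSec v) :
    SmoothSec (invConn Γ u v) := by
  rw [smoothSec_iff_triv, show (OddGen.invConn Γ u v).triv
    = fun x => vecD u.vec v.triv x + Γ (u.triv x) (v.triv x) from funext (invConn_triv Γ u v)]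
  exact (hv.triv.vecD hu.vec).add (SmoothVec.bilin Γ hu.triv hv.triv)

variable {H : InvForm G 3} {F : InvForm G 2} {S : Splitting (dorfmanAlg H F)}

theorem isGenConnection_invConn (hΓ : IsAlgLC (dorfmanAlg H F) S Γ) :
    IsGenConnection (invConn Γ) where
  smooth u v hu hv := hu.invConn Γ hv
  add_left u u' v _ _ _ := Sec.ext_triv fun x => by
    rw [triv_add, invConn_triv, invConn_triv, invConn_triv, triv_add, map_add,
      LinearMap.add_apply, show (u + u').vec = fun y => u.vec y + u'.vec y from rfl, vecD_add_left]
    abel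
  smul_left f u v _ _ _ := Sec.ext_triv fun x => by
    rw [triv_smul, invConn_triv, invConn_triv, triv_smul, map_smul, LinearMap.smul_apply, smul_add,
      show Sec.vec (fun y => f y • u y) = fun y => f y • u.vec y from rfl, vecD_smul_left]
  add_right u v v' _ hv hv' := Sec.ext_triv fun x => by
    rw [triv_add, invConn_triv, invConn_triv, invConn_triv, triv_add, map_add,
      show (v + v').triv = fun y => v.triv y + v'.triv y from funext (triv_add v v'),
      vecD_add _ hv.triv hv'.triv]
    abel
  leibniz f u v hf _ hv := Sec.ext_triv fun x => by
    have h : Sec.triv (fun x => dirD u.vec f x • v x + f x • invConn Γ u v x) x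
        = dirD u.vec f x • v.triv x + f x • (invConn Γ u v).triv x := by
      refine (map_add (triv x) _ _).trans ?_
      rw [map_smul, map_smul]
      rfl
    rw [h, invConn_triv, invConn_triv, triv_smul, map_smul,
      show Sec.triv (fun y => f y • v y) = fun y => f y • v.triv y from funext (triv_smul f v),
      vecD_smul _ hf hv.triv]
    module
  metric u v w _ hv hw x := by
    have h1 : (fun y => pairing y (v y) (w y))
        = fun y => (dorfmanAlg H F).B (v.triv y) (w.triv y) := funext fun y => pairing_eq H F y _ _
    have h2 := hΓ.metric (u.triv x) (v.triv x) (w.triv x)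
    rw [h1, dirD_bilin _ _ hv.triv hw.triv, pairing_eq H F, pairing_eq H F, triv_invConn,
      triv_invConn, map_add, map_add, LinearMap.add_apply]
    change _ = (dorfmanAlg H F).B (vecD u.vec v.triv x) (w.triv x)
      + (dorfmanAlg H F).B (Γ (u.triv x) (v.triv x)) (w.triv x)
      + ((dorfmanAlg H F).B (v.triv x) (vecD u.vec w.triv x) + (dorfmanAlg H F).B (v.triv x) (Γ (u.triv x) (w.triv x)))
    linear_combination -h2

/-- The derivative terms of the connection match those in `dorfman_triv`, so the torsion is that of
the coefficients `Γ`. -/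
theorem isLeviCivita_invConn {g : LinearMap.BilinForm ℝ (LieAlg G)} (hg : g.Nondegenerate)
    (hs : ∀ X Y, g X Y = g Y X) (hΓ : IsAlgLC (dorfmanAlg H F) (metricSplitting H F hg hs) Γ) :
    IsLeviCivita H F g (invConn Γ) where
  toIsGenConnection := isGenConnection_invConn Γ hΓ
  torsion_free u v w hu hv _ x := by
    have h1 := hΓ.torsion (u.triv x) (v.triv x) (w.triv x)
    have h2 := dorfman_triv H F hu hv x (w.triv x)
    have h3 : vecD w.vec u.triv x = vecD (fun y => dL y (w.triv x).1) u.triv x :=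
      vecD_congr (dL_mc x (w.vec x)).symm _
    have h4 : (dorfmanAlg H F).B ((dorfmanAlg H F).br (u.triv x) (v.triv x)) (w.triv x)
      = genForm (lieBil G) H F (u.triv x) (v.triv x) (w.triv x) := genPairing_br _ _ _ _ _ _ _
    have h5 : triv x (invConn Γ u v x - invConn Γ v u x - dorfman H F u v x)
        = (invConn Γ u v).triv x - (invConn Γ v u).triv x - (dorfman H F u v).triv x :=
      (map_sub (triv x) _ _).trans (congrArg (· - _) (map_sub (triv x) _ _))
    rw [← dorfmanAlg_B H F] at h2
    rw [pairing_eq H F, pairing_eq H F, h5, triv_invConn, invConn_triv, invConn_triv, h3]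
    change (dorfmanAlg H F).B _ (w.triv x) + (dorfmanAlg H F).B (v.triv x) _ = 0
    rw [(dorfmanAlg H F).symm (v.triv x)] at h1 ⊢
    simp only [map_add, map_sub, LinearMap.add_apply, LinearMap.sub_apply] at h1 h2 ⊢
    linear_combination h1 - h2 + h4
  preserves u v _ hv hm x := by
    have hP : ∀ y, (metricSplitting H F hg hs).Q (v.triv y) = v.triv y := fun y =>
      (mem_Eminus_iff H F hg hs _).1 (hm y)
    have h2 := vecD_map (metricSplitting H F hg hs).Q u.vec hv.triv x
    simp only [hP] at h2
    rw [mem_Eminus_iff H F hg hs, triv_invConn, map_add, ← h2,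
      show (metricSplitting H F hg hs).Q (Γ (u.triv x) (v.triv x)) = _ from hΓ.swap.commute _ _]
    exact congrArg (fun z => _ + Γ (u.triv x) z) (hP x)

theorem finrank_lieAlg : Module.finrank ℝ (LieAlg G) = 3 :=
  (finrank_euclideanSpace (𝕜 := ℝ) (ι := Fin 3)).trans (Fintype.card_fin 3)

theorem exists_leviCivita (H : InvForm G 3) (F : InvForm G 2)
    {g : LinearMap.BilinForm ℝ (LieAlg G)} (hg : g.Nondegenerate)
    (hs : ∀ X Y, g X Y = g Y X) (δ : Module.Dual ℝ (Fib (1 : G))) :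
    ∃ D, IsLeviCivita H F g D ∧ HasDivergence D δ := by
  have h1 : LinearMap.trace ℝ (GenAlg G) (metricSplitting H F hg hs).P = 4 := by
    refine (trace_plus g hg).trans ?_
    rw [finrank_lieAlg]
    norm_num
  have h2 : LinearMap.trace ℝ (GenAlg G) (metricSplitting H F hg hs).Q = 3 := by
    refine (trace_minus g hg).trans ?_
    rw [finrank_lieAlg]
    norm_num
  obtain ⟨Γ, hΓ, hδ⟩ := (metricSplitting H F hg hs).exists_isAlgLC δ (by rw [h1]; norm_num)
    (by rw [h2]; norm_num)
  refine ⟨invConn Γ, isLeviCivita_invConn Γ hg hs hΓ, ?_⟩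
  rw [hasDivergence_iff (isGenConnection_invConn Γ hΓ)]
  intro x a
  rw [← hδ a]
  congr 1
  refine LinearMap.ext fun b => ?_
  rw [LinearMap.flip_apply, LinearMap.flip_apply, connCoeff_apply, invConn_triv, leftInv_triv,
    leftInv_triv, vecD_const, zero_add]

/-- Odd generalized Einstein metrics, in terms of the space of left-invariant sections. -/
theorem isOddEinstein_iff (H : InvForm G 3) (F : InvForm G 2)
    {g : LinearMap.BilinForm ℝ (LieAlg G)} (hg : g.Nondegenerate)
    (hs : ∀ X Y, g X Y = g Y X) (δ : Module.Dual ℝ (Fib (1 : G))) :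
    IsOddEinstein H F g δ ↔ IsClosedForm F ∧
      (∀ u v, (metricSplitting H F hg hs).ric δ u v = 0) ∧
      ∀ u v, (metricSplitting H F hg hs).swap.ric δ u v = 0 := by
  constructor
  · intro h
    -- A single connection suffices, since the criterion in `ricciFlat_iff` does not depend on it.
    obtain ⟨D, hD, hδ⟩ := h.exists_connection
    exact ⟨h.closed, (ricciFlat_iff hg hs hD hδ).1 (h.ricci D hD hδ)⟩
  · rintro ⟨hF, h⟩
    exact ⟨hF, hs, hg, exists_leviCivita H F hg hs δ,
      fun D hD hδ => (ricciFlat_iff hg hs hD hδ).2 h⟩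

end Existence

/-! ### The Ricci tensors in a frame -/

section RicBilinear

variable {V : Type*} [AddCommGroup V] [Module ℝ V] [Module.Finite ℝ V] {M : MetricBracket V}

/-- The Ricci tensor as a bilinear form. -/
noncomputable def Splitting.ricBil (S : Splitting M) (δ : Module.Dual ℝ V) :
    LinearMap.BilinForm ℝ V :=
  LinearMap.mk₂ ℝ (S.ric δ)
    (fun u u' v => by
      have : S.doubleBr (u + u') v = S.doubleBr u v + S.doubleBr u' v := by
        ext w
        simp [doubleBr]
      simp only [ric, this, map_add, LinearMap.add_apply]
      ring)
    (fun c u v => by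
      have : S.doubleBr (c • u) v = c • S.doubleBr u v := by
        ext w
        simp [doubleBr]
      simp only [ric, this, map_smul, LinearMap.smul_apply, smul_eq_mul]
      ring)
    (fun u v v' => by
      have : S.doubleBr u (v + v') = S.doubleBr u v + S.doubleBr u v' := by
        ext w
        simp [doubleBr]
      simp only [ric, this, map_add]
      ring)
    (fun c u v => by
      have : S.doubleBr u (c • v) = c • S.doubleBr u v := by
        ext w
        simp [doubleBr]
      simp only [ric, this, map_smul, smul_eq_mul]
      ring)

theorem Splitting.ric_proj (S : Splitting M) (δ : Module.Dual ℝ V) (u v : V) :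
    S.ric δ (S.Q u) (S.P v) = S.ric δ u v := by
  rw [ric, ric, doubleBr, doubleBr, S.PP, show S.Q (S.Q u) = S.Q u from S.swap.PP u]

end RicBilinear

variable {L : Type*} [AddCommGroup L] [Module ℝ L]

/-- A basis in which the Gram matrix of `g` is a signed permutation matrix of an involution. -/
structure GramFrame (g : LinearMap.BilinForm ℝ L) where
  b : Module.Basis (Fin 3) ℝ L
  σ : Fin 3 → Fin 3
  s : Fin 3 → ℝ
  invol : ∀ i, σ (σ i) = i
  sq : ∀ i, s (σ i) * s i = 1
  gram : ∀ i j, g (b i) (b j) = if j = σ i then s i else 0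

namespace GramFrame

variable {g : LinearMap.BilinForm ℝ L} (f : GramFrame g)

/-- The number `g (b (σ i)) (b i) = s (σ i)` is inverse to `s i`, so `b (σ i)` is dual to `b i` up
to the factor `s i`. -/
theorem expand (X : L) : ∑ i, (f.s i * g X (f.b i)) • f.b (f.σ i) = X := by
  have h : ∑ i, (f.s i • LinearMap.flip g (f.b i)).smulRight (f.b (f.σ i)) = LinearMap.id := by
    refine f.b.ext fun k => ?_
    simp only [LinearMap.sum_apply, LinearMap.smulRight_apply, LinearMap.smul_apply,
      LinearMap.flip_apply, f.gram, smul_eq_mul, mul_ite, mul_zero, ite_smul, zero_smul,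
      Finset.sum_ite_eq', Finset.mem_univ, if_true, f.sq, f.invol, one_smul, LinearMap.id_apply]
  have h2 := LinearMap.congr_fun h X
  simpa only [LinearMap.sum_apply, LinearMap.smulRight_apply, LinearMap.smul_apply,
    LinearMap.flip_apply, smul_eq_mul, LinearMap.id_apply] using h2

theorem coord_eq (X : L) (i : Fin 3) : f.b.repr X i = f.s (f.σ i) * g X (f.b (f.σ i)) := by
  conv_lhs => rw [← f.expand X]
  rw [map_sum, Finset.sum_apply', Finset.sum_eq_single (f.σ i)]
  · simp [f.invol]
  · intro j _ hj
    have : f.σ j ≠ i := fun h => hj (by rw [← h, f.invol])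
    simp [this]
  · simp

include f in
theorem nondegenerate (hs : ∀ X Y, g X Y = g Y X) : g.Nondegenerate := by
  have h : ∀ X, (∀ Y, g X Y = 0) → X = 0 := fun X hX => by
    rw [← f.expand X]
    simp [hX]
  exact ⟨h, fun X hX => h X fun Y => by rw [hs]; exact hX Y⟩

end GramFrame

section Components

variable [Module.Finite ℝ L] (g : LinearMap.BilinForm ℝ L) (β : L →ₗ[ℝ] L →ₗ[ℝ] L) (H : L [⋀^Fin 3]→ₗ[ℝ] ℝ)
  (F : L [⋀^Fin 2]→ₗ[ℝ] ℝ)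

/-- The connection of `g` with skew torsion `κ H`. -/
noncomputable def nablaForm (κ : ℝ) (X Y Z : L) : ℝ :=
  1 / 2 * (g Z (β X Y) + g Y (β Z X) - g X (β Y Z) + κ * trilinOfForm H X Y Z)

/-- The scalar product is `g` on vectors `X + g X` and `-g` on `E₋`. The mixed components of the
three-form therefore become Koszul expressions, with torsion `-H` on `E₊` and `H` on `E₋`;
components containing the unit vector `(0, 1)` once give `F`. -/
theorem genForm_mpp (X Y Z : L) :
    genForm β H F (minusMap g X) (plusMap g (Y, 0)) (plusMap g (Z, 0))
      = nablaForm g β H (-1) X Y Z := by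
  rw [genForm_apply, minusMap_apply, plusMap_apply, plusMap_apply, nablaForm]
  simp only [LinearMap.neg_apply]
  ring

theorem genForm_pmm (X Y Z : L) :
    genForm β H F (plusMap g (X, 0)) (minusMap g Y) (minusMap g Z)
      = -nablaForm g β H 1 X Y Z := by
  rw [genForm_apply, plusMap_apply, minusMap_apply, minusMap_apply, nablaForm]
  simp only [LinearMap.neg_apply]
  ring

theorem genForm_mpr (X Y : L) :
    genForm β H F (minusMap g X) (plusMap g (Y, 0)) (plusMap g (0, 1)) = bilinOfForm F X Y := by
  rw [genForm_apply, minusMap_apply, plusMap_apply, plusMap_apply]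
  simp only [map_zero, LinearMap.zero_apply]
  ring

theorem genForm_mmr (X Y : L) :
    genForm β H F (minusMap g X) (minusMap g Y) (plusMap g (0, 1)) = bilinOfForm F X Y := by
  rw [genForm_apply, minusMap_apply, minusMap_apply, plusMap_apply]
  simp only [map_zero, LinearMap.zero_apply]
  ring

theorem genForm_mrr (X : L) :
    genForm β H F (minusMap g X) (plusMap g (0, 1)) (plusMap g (0, 1)) = 0 := by
  rw [genForm_apply, minusMap_apply, plusMap_apply]
  simp only [map_zero, LinearMap.zero_apply]
  ring

variable {g} (hg : g.Nondegenerate) (hs : ∀ X Y, g X Y = g Y X)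

include hs in
theorem genPairing_plusMap (w : L × Module.Dual ℝ L × ℝ) (Y : L × ℝ) :
    genPairing L w (plusMap g Y) = g (plusComp g hg w).1 Y.1 + (plusComp g hg w).2 * Y.2 := by
  obtain ⟨X, ξ, a⟩ := w
  rw [plusComp_apply, plusMap_apply, genPairing_apply]
  simp only [map_smul, map_add, LinearMap.smul_apply, LinearMap.add_apply, apply_toDual_symm,
    smul_eq_mul]
  rw [hs Y.1 X]
  ring

include hs in
theorem genPairing_minusMap (w : L × Module.Dual ℝ L × ℝ) (Y : L) :
    genPairing L w (minusMap g Y) = -g (minusComp g hg w) Y := by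
  obtain ⟨X, ξ, a⟩ := w
  rw [minusComp_apply, minusMap_apply, genPairing_apply]
  simp only [map_smul, map_sub, LinearMap.smul_apply, LinearMap.sub_apply, apply_toDual_symm,
    smul_eq_mul, LinearMap.neg_apply]
  rw [hs Y X]
  ring

variable (f : GramFrame g)

include hs in
theorem map_plus_expand {U : Type*} [AddCommGroup U] [Module ℝ U]
    (φ : L × Module.Dual ℝ L × ℝ →ₗ[ℝ] U) (w : L × Module.Dual ℝ L × ℝ) :
    φ (plusMap g (plusComp g hg w))
      = ∑ i, (f.s i * genPairing L w (plusMap g (f.b i, 0))) • φ (plusMap g (f.b (f.σ i), 0))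
        + genPairing L w (plusMap g (0, 1)) • φ (plusMap g (0, 1)) := by
  have h : plusComp g hg w = ∑ i, (f.s i * genPairing L w (plusMap g (f.b i, 0))) •
      ((f.b (f.σ i), 0) : L × ℝ) + genPairing L w (plusMap g (0, 1)) • ((0, 1) : L × ℝ) := by
    simp only [genPairing_plusMap hg hs, mul_zero, add_zero, map_zero, zero_add, mul_one]
    refine Prod.ext ?_ ?_
    · simp only [Prod.fst_add, Prod.fst_sum, Prod.smul_fst, smul_zero, add_zero]
      exact (f.expand _).symm
    · simp [Prod.snd_sum]
  conv_lhs => rw [h]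
  simp only [map_add, map_sum, map_smul]

include hs in
theorem map_minus_expand {U : Type*} [AddCommGroup U] [Module ℝ U]
    (φ : L × Module.Dual ℝ L × ℝ →ₗ[ℝ] U) (w : L × Module.Dual ℝ L × ℝ) :
    φ (minusMap g (minusComp g hg w))
      = -∑ i, (f.s i * genPairing L w (minusMap g (f.b i))) • φ (minusMap g (f.b (f.σ i))) := by
  conv_lhs => rw [← f.expand (minusComp g hg w)]
  simp only [map_sum, map_smul, genPairing_minusMap hg hs, mul_neg, neg_smul,
    Finset.sum_neg_distrib, neg_neg]

include hs in
theorem trace_plus_eq (A : L × Module.Dual ℝ L × ℝ →ₗ[ℝ] L × Module.Dual ℝ L × ℝ) :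
    LinearMap.trace ℝ _ (plusMap g ∘ₗ plusComp g hg ∘ₗ A ∘ₗ plusMap g ∘ₗ plusComp g hg)
      = ∑ i, f.s (f.σ i) * genPairing L (A (plusMap g (f.b i, 0))) (plusMap g (f.b (f.σ i), 0))
        + genPairing L (A (plusMap g (0, 1))) (plusMap g (0, 1)) := by
  have h1 : plusMap g ∘ₗ plusComp g hg ∘ₗ A ∘ₗ plusMap g ∘ₗ plusComp g hg
      = (plusMap g ∘ₗ plusComp g hg ∘ₗ A ∘ₗ plusMap g) ∘ₗ plusComp g hg := rfl
  have h2 : plusComp g hg ∘ₗ (plusMap g ∘ₗ plusComp g hg ∘ₗ A ∘ₗ plusMap g)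
      = plusComp g hg ∘ₗ A ∘ₗ plusMap g :=
    LinearMap.ext fun Y => plusComp_plusMap g hg _
  rw [h1, LinearMap.trace_comp_comm', h2,
    LinearMap.trace_eq_matrix_trace ℝ (f.b.prod (Module.Basis.singleton Unit ℝ)), Matrix.trace,
    Fintype.sum_sum_type]
  simp only [genPairing_plusMap hg hs, mul_zero, add_zero, map_zero, zero_add, mul_one]
  refine congrArg₂ _ (Finset.sum_congr rfl fun i _ => ?_) ?_
  · rw [Matrix.diag_apply, LinearMap.toMatrix_apply, ← f.coord_eq]
    simp
  · simp [Matrix.diag_apply, LinearMap.toMatrix_apply]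

include hs in
theorem trace_minus_eq (A : L × Module.Dual ℝ L × ℝ →ₗ[ℝ] L × Module.Dual ℝ L × ℝ) :
    LinearMap.trace ℝ _ (minusMap g ∘ₗ minusComp g hg ∘ₗ A ∘ₗ minusMap g ∘ₗ minusComp g hg)
      = -∑ i, f.s (f.σ i) *
        genPairing L (A (minusMap g (f.b i))) (minusMap g (f.b (f.σ i))) := by
  have h1 : minusMap g ∘ₗ minusComp g hg ∘ₗ A ∘ₗ minusMap g ∘ₗ minusComp g hg
      = (minusMap g ∘ₗ minusComp g hg ∘ₗ A ∘ₗ minusMap g) ∘ₗ minusComp g hg := rfl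
  have h2 : minusComp g hg ∘ₗ (minusMap g ∘ₗ minusComp g hg ∘ₗ A ∘ₗ minusMap g)
      = minusComp g hg ∘ₗ A ∘ₗ minusMap g :=
    LinearMap.ext fun Y => minusComp_minusMap g hg _
  rw [h1, LinearMap.trace_comp_comm', h2, LinearMap.trace_eq_matrix_trace ℝ f.b, Matrix.trace,
    ← Finset.sum_neg_distrib]
  refine Finset.sum_congr rfl fun i _ => ?_
  rw [Matrix.diag_apply, LinearMap.toMatrix_apply, genPairing_minusMap hg hs, f.coord_eq,
    LinearMap.comp_apply, LinearMap.comp_apply]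
  ring

variable {β H F} (hβ : ∀ X Y, β X Y = -β Y X) (δ : Module.Dual ℝ (L × Module.Dual ℝ L × ℝ))

theorem genForm_cycle (u v w : L × Module.Dual ℝ L × ℝ) :
    genForm β H F u v w = genForm β H F w u v := by
  have h := (trilinOfForm_swap' H u.1 v.1 w.1).trans
    (congrArg Neg.neg (trilinOfForm_swap H u.1 w.1 v.1))
  rw [genForm_apply, genForm_apply]
  linarith

/-- The contraction of the two connections `∇^±` which occurs in the Ricci tensors. -/
noncomputable def GramFrame.contr (β : L →ₗ[ℝ] L →ₗ[ℝ] L) (H : L [⋀^Fin 3]→ₗ[ℝ] ℝ)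
    (F : L [⋀^Fin 2]→ₗ[ℝ] ℝ) (X Y : L) : ℝ :=
  ∑ i, ∑ j, f.s (f.σ i) * f.s j * nablaForm g β H 1 (f.b i) X (f.b j) *
      nablaForm g β H (-1) (f.b (f.σ j)) Y (f.b (f.σ i))
    - ∑ j, f.s j * bilinOfForm F X (f.b j) * bilinOfForm F (f.b (f.σ j)) Y

/-- The contraction of `∇⁺` and `F` which occurs in the Ricci tensors. -/
noncomputable def GramFrame.contrF (β : L →ₗ[ℝ] L →ₗ[ℝ] L) (H : L [⋀^Fin 3]→ₗ[ℝ] ℝ)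
    (F : L [⋀^Fin 2]→ₗ[ℝ] ℝ) (X : L) : ℝ :=
  ∑ i, ∑ j, f.s (f.σ i) * f.s j * nablaForm g β H 1 (f.b i) X (f.b j) *
      bilinOfForm F (f.b (f.σ i)) (f.b (f.σ j))

theorem GramFrame.sum_σ (φ : Fin 3 → ℝ) : ∑ i, φ (f.σ i) = ∑ i, φ i :=
  Equiv.sum_comp (⟨f.σ, f.σ, f.invol, f.invol⟩ : Equiv.Perm (Fin 3)) φ

/-- Expanding the divergence term and the inner projection of `doubleBr` in the frame turns every
bracket into a value of `genForm`. -/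
theorem ric_plus_aux {M : MetricBracket (L × Module.Dual ℝ L × ℝ)} (hM : M.B = genPairing L)
    (hT : ∀ x y z, genPairing L (M.br x y) z = genForm β H F x y z) (u v : L × Module.Dual ℝ L × ℝ)
    (hu : minusMap g (minusComp g hg u) = u) (hv : plusMap g (plusComp g hg v) = v) :
    (genSplitting g hg hs M hM).ric δ u v
      = ∑ i, f.s i * genForm β H F u v (plusMap g (f.b i, 0)) * δ (plusMap g (f.b (f.σ i), 0))
        + genForm β H F u v (plusMap g (0, 1)) * δ (plusMap g (0, 1))
        + (∑ i, ∑ j, f.s (f.σ i) * f.s j *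
            genForm β H F (plusMap g (f.b i, 0)) u (minusMap g (f.b j)) *
            genForm β H F (minusMap g (f.b (f.σ j))) v (plusMap g (f.b (f.σ i), 0))
          + ∑ j, f.s j * genForm β H F (plusMap g (0, 1)) u (minusMap g (f.b j)) *
            genForm β H F (minusMap g (f.b (f.σ j))) v (plusMap g (0, 1))) := by
  have hA : ∀ x z, genPairing L (M.br (minusMap g (minusComp g hg (M.br x u))) v) z
      = -∑ j, f.s j * genForm β H F x u (minusMap g (f.b j)) *
          genForm β H F (minusMap g (f.b (f.σ j))) v z := by
    intro x z
    have h := map_minus_expand hg hs f (LinearMap.flip (genPairing L) z ∘ₗ M.br.flip v) (M.br x u)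
    simpa only [LinearMap.comp_apply, LinearMap.flip_apply, hT, smul_eq_mul] using h
  have h1 := map_plus_expand hg hs f δ (M.br u v)
  have h2 := trace_plus_eq hg hs f
    (M.br.flip v ∘ₗ (minusMap g ∘ₗ minusComp g hg) ∘ₗ M.br.flip u)
  have h3 : (genSplitting g hg hs M hM).doubleBr u v = plusMap g ∘ₗ plusComp g hg ∘ₗ
      (M.br.flip v ∘ₗ (minusMap g ∘ₗ minusComp g hg) ∘ₗ M.br.flip u) ∘ₗ
      plusMap g ∘ₗ plusComp g hg := by
    refine LinearMap.ext fun w => ?_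
    change plusMap g (plusComp g hg (M.br (minusMap g (minusComp g hg (M.br (plusMap g
      (plusComp g hg w)) (minusMap g (minusComp g hg u))))) (plusMap g (plusComp g hg v)))) = _
    rw [hu, hv]
    rfl
  have h4 : (genSplitting g hg hs M hM).ric δ u v = δ (plusMap g (plusComp g hg (M.br u v)))
      - LinearMap.trace ℝ _ ((genSplitting g hg hs M hM).doubleBr u v) := by
    change δ (plusMap g (plusComp g hg (M.br (minusMap g (minusComp g hg u))
      (plusMap g (plusComp g hg v))))) - _ = _
    rw [hu, hv]
  rw [h4, h3, h2, h1]
  simp only [LinearMap.comp_apply, LinearMap.flip_apply, hA, hT, smul_eq_mul, mul_neg,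
    Finset.sum_neg_distrib, Finset.mul_sum, mul_assoc]
  ring

theorem ric_minus_aux {M : MetricBracket (L × Module.Dual ℝ L × ℝ)} (hM : M.B = genPairing L)
    (hT : ∀ x y z, genPairing L (M.br x y) z = genForm β H F x y z) (u v : L × Module.Dual ℝ L × ℝ)
    (hu : plusMap g (plusComp g hg u) = u) (hv : minusMap g (minusComp g hg v) = v) :
    (genSplitting g hg hs M hM).swap.ric δ u v
      = -∑ i, f.s i * genForm β H F u v (minusMap g (f.b i)) * δ (minusMap g (f.b (f.σ i)))
        + (∑ j, ∑ i, f.s (f.σ j) * f.s i *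
            genForm β H F (minusMap g (f.b j)) u (plusMap g (f.b i, 0)) *
            genForm β H F (plusMap g (f.b (f.σ i), 0)) v (minusMap g (f.b (f.σ j)))
          + ∑ j, f.s (f.σ j) * genForm β H F (minusMap g (f.b j)) u (plusMap g (0, 1)) *
            genForm β H F (plusMap g (0, 1)) v (minusMap g (f.b (f.σ j)))) := by
  have hA : ∀ x z, genPairing L (M.br (plusMap g (plusComp g hg (M.br x u))) v) z
      = ∑ i, f.s i * genForm β H F x u (plusMap g (f.b i, 0)) *
          genForm β H F (plusMap g (f.b (f.σ i), 0)) v z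
        + genForm β H F x u (plusMap g (0, 1)) * genForm β H F (plusMap g (0, 1)) v z := by
    intro x z
    have h := map_plus_expand hg hs f (LinearMap.flip (genPairing L) z ∘ₗ M.br.flip v) (M.br x u)
    simpa only [LinearMap.comp_apply, LinearMap.flip_apply, hT, smul_eq_mul] using h
  have h1 := map_minus_expand hg hs f δ (M.br u v)
  have h2 := trace_minus_eq hg hs f
    (M.br.flip v ∘ₗ (plusMap g ∘ₗ plusComp g hg) ∘ₗ M.br.flip u)
  have h3 : (genSplitting g hg hs M hM).swap.doubleBr u v = minusMap g ∘ₗ minusComp g hg ∘ₗ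
      (M.br.flip v ∘ₗ (plusMap g ∘ₗ plusComp g hg) ∘ₗ M.br.flip u) ∘ₗ
      minusMap g ∘ₗ minusComp g hg := by
    refine LinearMap.ext fun w => ?_
    change minusMap g (minusComp g hg (M.br (plusMap g (plusComp g hg (M.br (minusMap g
      (minusComp g hg w)) (plusMap g (plusComp g hg u))))) (minusMap g (minusComp g hg v)))) = _
    rw [hu, hv]
    rfl
  have h4 : (genSplitting g hg hs M hM).swap.ric δ u v
      = δ (minusMap g (minusComp g hg (M.br u v)))
      - LinearMap.trace ℝ _ ((genSplitting g hg hs M hM).swap.doubleBr u v) := by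
    change δ (minusMap g (minusComp g hg (M.br (plusMap g (plusComp g hg u))
      (minusMap g (minusComp g hg v))))) - _ = _
    rw [hu, hv]
  rw [h4, h3, h2, h1]
  simp only [LinearMap.comp_apply, LinearMap.flip_apply, hA, hT, smul_eq_mul, mul_neg, mul_add,
    Finset.sum_neg_distrib, Finset.mul_sum, mul_assoc, Finset.sum_add_distrib]
  ring

theorem ric_minus_plus (X Y : L) :
    (genSplitting g hg hs (genBracket β hβ H F) rfl).ric δ (minusMap g X) (plusMap g (Y, 0))
      = ∑ i, f.s i * nablaForm g β H (-1) X Y (f.b i) * δ (plusMap g (f.b (f.σ i), 0))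
        + bilinOfForm F X Y * δ (plusMap g (0, 1)) - f.contr β H F X Y := by
  rw [ric_plus_aux hg hs f δ rfl (genPairing_br β hβ H F) _ _ (by rw [minusComp_minusMap]) (by rw [plusComp_plusMap])]
  have h : ∀ Z, genForm β H F (plusMap g (0, 1)) (minusMap g X) (minusMap g Z)
      = bilinOfForm F X Z := fun Z => by rw [← genForm_cycle, genForm_mmr]
  simp only [genForm_mpp, genForm_pmm, genForm_mpr, h, GramFrame.contr, mul_neg, neg_mul,
    Finset.sum_neg_distrib]
  ring

theorem genForm_mrp (X Z : L) :
    genForm β H F (minusMap g X) (plusMap g (0, 1)) (plusMap g (Z, 0)) = bilinOfForm F Z X := by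
  rw [genForm_apply, minusMap_apply, plusMap_apply, plusMap_apply]
  simp only [map_zero, LinearMap.zero_apply]
  ring

theorem genForm_rmm (X Y : L) :
    genForm β H F (plusMap g (0, 1)) (minusMap g X) (minusMap g Y) = bilinOfForm F X Y := by
  rw [← genForm_cycle, genForm_mmr]

theorem ric_minus_one (X : L) :
    (genSplitting g hg hs (genBracket β hβ H F) rfl).ric δ (minusMap g X) (plusMap g (0, 1))
      = ∑ i, f.s i * bilinOfForm F (f.b i) X * δ (plusMap g (f.b (f.σ i), 0))
        - f.contrF β H F X := by
  rw [ric_plus_aux hg hs f δ rfl (genPairing_br β hβ H F) _ _ (by rw [minusComp_minusMap])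
    (by rw [plusComp_plusMap])]
  simp only [genForm_mrr, genForm_pmm, genForm_mrp, GramFrame.contrF, mul_neg, neg_mul, zero_mul,
    mul_zero, Finset.sum_neg_distrib, Finset.sum_const_zero]
  ring

/-- After reindexing by `σ`, the trace is the same contraction as in `ric_minus_plus`, so the two
Ricci tensors differ only in their divergence terms. -/
theorem ric_plus_minus (X Y : L) :
    (genSplitting g hg hs (genBracket β hβ H F) rfl).swap.ric δ (plusMap g (Y, 0)) (minusMap g X)
      = ∑ i, f.s i * nablaForm g β H 1 Y X (f.b i) * δ (minusMap g (f.b (f.σ i)))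
        - f.contr β H F X Y := by
  rw [ric_minus_aux hg hs f δ rfl (genPairing_br β hβ H F) _ _ (by rw [plusComp_plusMap])
    (by rw [minusComp_minusMap])]
  have h1 : f.contr β H F X Y = ∑ j, ∑ i, f.s (f.σ j) * f.s i *
      nablaForm g β H (-1) (f.b j) Y (f.b i) * nablaForm g β H 1 (f.b (f.σ i)) X (f.b (f.σ j))
      - ∑ j, f.s (f.σ j) * bilinOfForm F (f.b j) Y * bilinOfForm F X (f.b (f.σ j)) := by
    rw [GramFrame.contr]
    refine congrArg₂ _ ?_ ?_
    · rw [Finset.sum_comm, ← f.sum_σ]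
      refine Finset.sum_congr rfl fun j _ => ?_
      rw [← f.sum_σ]
      refine Finset.sum_congr rfl fun i _ => ?_
      rw [f.invol, f.invol]
      ring
    · rw [← f.sum_σ]
      refine Finset.sum_congr rfl fun j _ => ?_
      rw [f.invol]
      ring
  simp only [genForm_mpp, genForm_pmm, genForm_mpr, genForm_rmm, h1, mul_neg, neg_mul,
    Finset.sum_neg_distrib]
  ring

theorem ric_one_minus (X : L) :
    (genSplitting g hg hs (genBracket β hβ H F) rfl).swap.ric δ (plusMap g (0, 1)) (minusMap g X)
      = ∑ i, f.s i * bilinOfForm F (f.b i) X * δ (minusMap g (f.b (f.σ i)))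
        - f.contrF β H F X := by
  rw [ric_minus_aux hg hs f δ rfl (genPairing_br β hβ H F) _ _ (by rw [plusComp_plusMap])
    (by rw [minusComp_minusMap])]
  have h1 : f.contrF β H F X = ∑ j, ∑ i, f.s (f.σ j) * f.s i *
      bilinOfForm F (f.b i) (f.b j) * nablaForm g β H 1 (f.b (f.σ i)) X (f.b (f.σ j)) := by
    rw [GramFrame.contrF, Finset.sum_comm, ← f.sum_σ]
    refine Finset.sum_congr rfl fun j _ => ?_
    rw [← f.sum_σ]
    refine Finset.sum_congr rfl fun i _ => ?_
    rw [f.invol, f.invol]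
    ring
  simp only [genForm_mrp, genForm_pmm, genForm_mrr, genForm_rmm, h1, mul_neg, neg_mul, mul_zero,
    zero_mul, Finset.sum_neg_distrib, Finset.sum_const_zero, bilinOfForm_swap F X (f.b _)]
  ring

/-- The vanishing of both Ricci tensors, in a frame. -/
theorem ric_eq_zero_iff :
    ((∀ u v, (genSplitting g hg hs (genBracket β hβ H F) rfl).ric δ u v = 0) ∧
      ∀ u v, (genSplitting g hg hs (genBracket β hβ H F) rfl).swap.ric δ u v = 0) ↔
    ∀ k, (∀ l, ∑ i, f.s i * nablaForm g β H (-1) (f.b k) (f.b l) (f.b i) *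
            δ (plusMap g (f.b (f.σ i), 0)) + bilinOfForm F (f.b k) (f.b l) * δ (plusMap g (0, 1))
            = f.contr β H F (f.b k) (f.b l) ∧
          ∑ i, f.s i * nablaForm g β H 1 (f.b l) (f.b k) (f.b i) * δ (minusMap g (f.b (f.σ i)))
            = f.contr β H F (f.b k) (f.b l)) ∧
        ∑ i, f.s i * bilinOfForm F (f.b i) (f.b k) * δ (plusMap g (f.b (f.σ i), 0))
          = f.contrF β H F (f.b k) ∧
        ∑ i, f.s i * bilinOfForm F (f.b i) (f.b k) * δ (minusMap g (f.b (f.σ i)))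
          = f.contrF β H F (f.b k) := by
  set S := genSplitting g hg hs (genBracket β hβ H F) rfl with hS
  have hQ : ∀ u, S.Q u = minusMap g (minusComp g hg u) := fun _ => rfl
  have hP : ∀ u, S.P u = plusMap g (plusComp g hg u) := fun _ => rfl
  have e1 : (∀ u v, S.ric δ u v = 0) ↔
      ∀ k, (∀ l, S.ric δ (minusMap g (f.b k)) (plusMap g (f.b l, 0)) = 0) ∧
        S.ric δ (minusMap g (f.b k)) (plusMap g (0, 1)) = 0 := by
    constructor
    · exact fun h k => ⟨fun l => h _ _, h _ _⟩
    · intro h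
      -- By bilinearity it suffices to test frame vectors and the unit vector of `ℝ`.
      have h2 : (S.ricBil δ).compl₁₂ (minusMap g) (plusMap g) = 0 := by
        refine f.b.ext fun k => LinearMap.prod_ext (f.b.ext fun l => ?_) (LinearMap.ext_ring ?_)
        · exact (h k).1 l
        · exact (h k).2
      intro u v
      rw [← S.ric_proj, hQ, hP]
      exact LinearMap.congr_fun (LinearMap.congr_fun h2 _) _
  have e2 : (∀ u v, S.swap.ric δ u v = 0) ↔
      ∀ k, (∀ l, S.swap.ric δ (plusMap g (f.b l, 0)) (minusMap g (f.b k)) = 0) ∧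
        S.swap.ric δ (plusMap g (0, 1)) (minusMap g (f.b k)) = 0 := by
    constructor
    · exact fun h k => ⟨fun l => h _ _, h _ _⟩
    · intro h
      have h2 : (S.swap.ricBil δ).compl₁₂ (plusMap g) (minusMap g) = 0 := by
        refine LinearMap.prod_ext (f.b.ext fun l => f.b.ext fun k => ?_)
          (LinearMap.ext_ring (f.b.ext fun k => ?_))
        · exact (h k).1 l
        · exact (h k).2
      intro u v
      rw [← S.swap.ric_proj]
      exact LinearMap.congr_fun (LinearMap.congr_fun h2 (plusComp g hg u)) (minusComp g hg v)
  rw [e1, e2, ← forall_and]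
  refine forall_congr' fun k => ?_
  simp only [hS, ric_minus_plus hg hs f hβ δ, ric_minus_one hg hs f hβ δ,
    ric_plus_minus hg hs f hβ δ, ric_one_minus hg hs f hβ δ, sub_eq_zero, forall_and]
  tauto

end Components

/-! ### The Ricci tensors in a frame adapted to the unimodular kernel -/

section AdaptedFrame

variable {L : Type*} [AddCommGroup L] [Module ℝ L] [Module.Finite ℝ L]
  {g : LinearMap.BilinForm ℝ L} {β : L →ₗ[ℝ] L →ₗ[ℝ] L} {H : L [⋀^Fin 3]→ₗ[ℝ] ℝ}
  {F : L [⋀^Fin 2]→ₗ[ℝ] ℝ}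

/-- The bracket is the one of `ℝ ⋉_A ℝ²` with `A = !![a, b; c, d]`, the two-form `F` vanishes on
`ℝ²` and has the other components `p`, `q`, and `H` has the component `h`. -/
structure IsAdapted (b : Module.Basis (Fin 3) ℝ L) (β : L →ₗ[ℝ] L →ₗ[ℝ] L)
    (H : L [⋀^Fin 3]→ₗ[ℝ] ℝ) (F : L [⋀^Fin 2]→ₗ[ℝ] ℝ) (A : Matrix (Fin 2) (Fin 2) ℝ)
    (p q h : ℝ) : Prop where
  br01 : β (b 0) (b 1) = A 0 0 • b 1 + A 1 0 • b 2
  br02 : β (b 0) (b 2) = A 0 1 • b 1 + A 1 1 • b 2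
  br12 : β (b 1) (b 2) = 0
  F01 : bilinOfForm F (b 0) (b 1) = p
  F02 : bilinOfForm F (b 0) (b 2) = q
  F12 : bilinOfForm F (b 1) (b 2) = 0
  H012 : trilinOfForm H (b 0) (b 1) (b 2) = h

/-- The structure constants of `ℝ ⋉_A ℝ²`. -/
def structConst (A : Matrix (Fin 2) (Fin 2) ℝ) : Fin 3 → Fin 3 → Fin 3 → ℝ :=
  ![![![0, 0, 0], ![0, A 0 0, A 1 0], ![0, A 0 1, A 1 1]],
    ![![0, -A 0 0, -A 1 0], ![0, 0, 0], ![0, 0, 0]],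
    ![![0, -A 0 1, -A 1 1], ![0, 0, 0], ![0, 0, 0]]]

/-- The components of a two-form. -/
def formConst (p q : ℝ) : Fin 3 → Fin 3 → ℝ := ![![0, p, q], ![-p, 0, 0], ![-q, 0, 0]]

/-- The sign of a permutation of three letters. -/
def levi : Fin 3 → Fin 3 → Fin 3 → ℝ :=
  ![![![0, 0, 0], ![0, 0, 1], ![0, -1, 0]], ![![0, 0, -1], ![0, 0, 0], ![1, 0, 0]],
    ![![0, 1, 0], ![-1, 0, 0], ![0, 0, 0]]]

namespace IsAdapted

variable {b : Module.Basis (Fin 3) ℝ L} {A : Matrix (Fin 2) (Fin 2) ℝ} {p q h : ℝ}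

theorem br (hb : IsAdapted b β H F A p q h) (hβ : ∀ X Y, β X Y = -β Y X) (i j : Fin 3) :
    β (b i) (b j) = ∑ m, structConst A i j m • b m := by
  have h0 : ∀ X, β X X = 0 := fun X => by
    have h2 : (2 : ℝ) • β X X = 0 := by
      rw [two_smul]
      nth_rw 1 [hβ]
      exact neg_add_cancel _
    exact (smul_eq_zero.1 h2).resolve_left two_ne_zero
  fin_cases i <;> fin_cases j <;>
    simp [structConst, Fin.sum_univ_three, h0, hb.br01, hb.br02, hb.br12,
      hβ (b 1) (b 0), hβ (b 2) (b 0), hβ (b 2) (b 1)] <;> abel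

theorem form (hb : IsAdapted b β H F A p q h) (i j : Fin 3) :
    bilinOfForm F (b i) (b j) = formConst p q i j := by
  have h0 : ∀ X, bilinOfForm F X X = 0 := fun X => by
    have := bilinOfForm_swap F X X
    linarith
  fin_cases i <;> fin_cases j <;>
    simp [formConst, h0, hb.F01, hb.F02, hb.F12, bilinOfForm_swap F (b 1) (b 0),
      bilinOfForm_swap F (b 2) (b 0), bilinOfForm_swap F (b 2) (b 1)]

theorem triform (hb : IsAdapted b β H F A p q h) (i j k : Fin 3) :
    trilinOfForm H (b i) (b j) (b k) = h * levi i j k := by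
  have h1 : ∀ X Y, trilinOfForm H X X Y = 0 := fun X Y => by
    have := trilinOfForm_swap H X X Y
    linarith
  have h2 : ∀ X Y, trilinOfForm H X Y Y = 0 := fun X Y => by
    have := trilinOfForm_swap' H X Y Y
    linarith
  have h3 : ∀ X Y, trilinOfForm H X Y X = 0 := fun X Y => by
    rw [trilinOfForm_swap, h2, neg_zero]
  have e1 : trilinOfForm H (b 0) (b 2) (b 1) = -h := by rw [trilinOfForm_swap', hb.H012]
  have e2 : trilinOfForm H (b 1) (b 0) (b 2) = -h := by rw [trilinOfForm_swap, hb.H012]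
  have e3 : trilinOfForm H (b 2) (b 0) (b 1) = h := by rw [trilinOfForm_swap, e1, neg_neg]
  have e4 : trilinOfForm H (b 1) (b 2) (b 0) = h := by rw [trilinOfForm_swap', e2, neg_neg]
  have e5 : trilinOfForm H (b 2) (b 1) (b 0) = -h := by rw [trilinOfForm_swap, e4]
  fin_cases i <;> fin_cases j <;> fin_cases k <;>
    simp [levi, h1, h2, h3, hb.H012, e1, e2, e3, e4, e5]

end IsAdapted

/-- The components of the connection of a metric with skew torsion `κ h`. -/
noncomputable def nablaConst (A : Matrix (Fin 2) (Fin 2) ℝ) (σ : Fin 3 → Fin 3) (s : Fin 3 → ℝ)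
    (κ : ℝ) (i j k : Fin 3) : ℝ :=
  1 / 2 * (structConst A i j (σ k) * s k + structConst A k i (σ j) * s j
    - structConst A j k (σ i) * s i + κ * levi i j k)

theorem nablaForm_frame {f : GramFrame g} {A : Matrix (Fin 2) (Fin 2) ℝ} {p q h : ℝ}
    (hb : IsAdapted f.b β H F A p q h) (hβ : ∀ X Y, β X Y = -β Y X) (κ : ℝ) (i j k : Fin 3) :
    nablaForm g β H κ (f.b i) (f.b j) (f.b k) = nablaConst A f.σ f.s (κ * h) i j k := by
  have hG : ∀ i j k, g (f.b k) (β (f.b i) (f.b j)) = structConst A i j (f.σ k) * f.s k := by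
    intro i j k
    rw [hb.br hβ, map_sum]
    simp only [map_smul, f.gram, smul_eq_mul, mul_ite, mul_zero, Finset.sum_ite_eq',
      Finset.mem_univ, if_true]
  rw [nablaForm, nablaConst, hG, hG, hG, hb.triform]
  ring

/-- The contraction of `∇⁺` and `∇⁻` in a frame. -/
noncomputable def contrConst (A : Matrix (Fin 2) (Fin 2) ℝ) (σ : Fin 3 → Fin 3) (s : Fin 3 → ℝ)
    (p q h : ℝ) (k l : Fin 3) : ℝ :=
  ∑ i, ∑ j, s (σ i) * s j * nablaConst A σ s h i k j * nablaConst A σ s (-h) (σ j) l (σ i)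
    - ∑ j, s j * formConst p q k j * formConst p q (σ j) l

/-- The contraction of `∇⁺` and `F` in a frame. -/
noncomputable def contrFConst (A : Matrix (Fin 2) (Fin 2) ℝ) (σ : Fin 3 → Fin 3) (s : Fin 3 → ℝ)
    (p q h : ℝ) (k : Fin 3) : ℝ :=
  ∑ i, ∑ j, s (σ i) * s j * nablaConst A σ s h i k j * formConst p q (σ i) (σ j)

/-- The vanishing of the Ricci tensors in a frame; `u`, `m` and `r` are the components of the
divergence. -/
def FrameRicciFlat (A : Matrix (Fin 2) (Fin 2) ℝ) (σ : Fin 3 → Fin 3) (s : Fin 3 → ℝ)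
    (p q h : ℝ) (u m : Fin 3 → ℝ) (r : ℝ) : Prop :=
  ∀ k, (∀ l, ∑ i, s i * nablaConst A σ s (-h) k l i * u (σ i) + formConst p q k l * r
        = contrConst A σ s p q h k l ∧
      ∑ i, s i * nablaConst A σ s h l k i * m (σ i) = contrConst A σ s p q h k l) ∧
    ∑ i, s i * formConst p q i k * u (σ i) = contrFConst A σ s p q h k ∧
    ∑ i, s i * formConst p q i k * m (σ i) = contrFConst A σ s p q h k

theorem ric_eq_zero_iff_frame (hg : g.Nondegenerate) (hs : ∀ X Y, g X Y = g Y X)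
    (hβ : ∀ X Y, β X Y = -β Y X) (δ : Module.Dual ℝ (L × Module.Dual ℝ L × ℝ)) (f : GramFrame g)
    {A : Matrix (Fin 2) (Fin 2) ℝ} {p q h : ℝ} (hb : IsAdapted f.b β H F A p q h) :
    ((∀ u v, (genSplitting g hg hs (genBracket β hβ H F) rfl).ric δ u v = 0) ∧
      ∀ u v, (genSplitting g hg hs (genBracket β hβ H F) rfl).swap.ric δ u v = 0) ↔
    FrameRicciFlat A f.σ f.s p q h (fun i => δ (plusMap g (f.b i, 0)))
      (fun i => δ (minusMap g (f.b i))) (δ (plusMap g (0, 1))) := by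
  rw [ric_eq_zero_iff hg hs f hβ δ]
  simp only [FrameRicciFlat, GramFrame.contr, GramFrame.contrF, nablaForm_frame hb hβ, hb.form,
    contrConst, contrFConst, one_mul, neg_mul]

theorem forall_fin_three {P : Fin 3 → Prop} : (∀ i, P i) ↔ P 0 ∧ P 1 ∧ P 2 :=
  ⟨fun h => ⟨h 0, h 1, h 2⟩, fun h i => by fin_cases i; exacts [h.1, h.2.1, h.2.2]⟩

end AdaptedFrame

/-! ### Solutions of the Einstein equations in adapted frames -/

section Solutions

variable {a b c d p q h e : ℝ}

/-- Divergence-free solutions in a frame whose second vector is in the radical. -/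
theorem eigenvector_of_frameRicciFlat
    (H : FrameRicciFlat !![a, b; c, d] ![1, 0, 2] ![1, 1, e] p q h 0 0 0)
    (htr : a + d ≠ 0) (he : e * e = 1) : c = 0 := by
  have h1 := ((H 0).1 2).1
  have h2 := ((H 2).1 0).1
  have h3 := ((H 2).1 2).1
  simp [contrConst, Fin.sum_univ_three, nablaConst, structConst, formConst, levi] at h1 h2 h3
  -- The contributions of `F` to the entries `(0, 2)` and `(2, 0)` agree, so they drop out of the
  -- difference.
  have h4 : (a + d) * h = 0 := by linear_combination h1 - h2 - d * h * he
  have h5 : h = 0 := (mul_eq_zero.1 h4).resolve_left htr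
  subst h5
  -- The entry `(2, 2)` does not involve `F`, since the components of `F` meeting `b₂` pair with the
  -- null vector `b₁`.
  have h6 : c * c = 0 := by linear_combination (-2) * h3 - c * c * he
  exact mul_self_eq_zero.1 h6

set_option maxHeartbeats 1000000 in
-- Here `q = 0`, that is, `b₂` is in the kernel of `F`. The equations contracted with `F` give `u 0
-- = -a` and `h = -c e₂`. Substituted into the other entries, they leave relations between the
-- entries of `A` and the signs, whose solutions have eigenvalues `a, 0` or `a, 2a`.
theorem cases_of_frameRicciFlat_orth {e₀ e₁ e₂ : ℝ} (h₀ : e₀ * e₀ = 1) (h₁ : e₁ * e₁ = 1)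
    (h₂ : e₂ * e₂ = 1) {u m : Fin 3 → ℝ} {r : ℝ}
    (H : FrameRicciFlat !![a, b; c, d] ![0, 1, 2] ![e₀, e₁, e₂] p 0 h u m r)
    (htr : a + d ≠ 0) (hp : p ≠ 0) :
    ((b = 0 ∧ d = 0) ∨ (c = 0 ∧ d = 2 * a ∧ b ^ 2 = 4 * a ^ 2)) ∧ u 0 ≠ 0 := by
  have h00 := ((H 0).1 0).1
  have h11 := ((H 1).1 1).1
  have h12 := ((H 1).1 2).1
  have h21 := ((H 2).1 1).1
  have h22 := ((H 2).1 2).1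
  have hr1 := (H 1).2.1
  have hr2 := (H 2).2.1
  simp [contrConst, contrFConst, Fin.sum_univ_three, nablaConst, structConst, formConst, levi]
    at h00 h11 h12 h21 h22 hr1 hr2
  clear H
  have e00 : e₀ ≠ 0 := by rintro rfl; simp at h₀
  have e10 : e₁ ≠ 0 := by rintro rfl; simp at h₁
  have ht : u 0 = -a := by
    have : e₀ * p * (u 0 + a) = 0 := by linear_combination hr1 - a * e₀ * p * h₁
    have := (mul_eq_zero.1 this).resolve_left (mul_ne_zero e00 hp)
    linarith
  have hh : h = -(c * e₂) := by
    have : e₀ * e₁ * p * (h + c * e₂) = 0 := by linear_combination hr2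
    have := (mul_eq_zero.1 this).resolve_left (mul_ne_zero (mul_ne_zero e00 e10) hp)
    linarith
  rw [ht] at h11 h12 h21 h22
  subst hh
  have s0 := mul_self_eq_one_iff.1 h₀
  have s1 := mul_self_eq_one_iff.1 h₁
  have s2 := mul_self_eq_one_iff.1 h₂
  have q1 : e₁ ^ 2 = 1 := by rw [sq, h₁]
  have q2 : e₂ ^ 2 = 1 := by rw [sq, h₂]
  have c1 : e₁ ^ 3 = e₁ := by rw [pow_succ, q1, one_mul]
  have c2 : e₂ ^ 3 = e₂ := by rw [pow_succ, q2, one_mul]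
  have d1 : e₁ ^ 4 = 1 := by rw [pow_succ, c1, h₁]
  have d2 : e₂ ^ 4 = 1 := by rw [pow_succ, c2, h₂]
  ring_nf at h00 h11 h12 h21 h22
  simp only [q1, q2, c1, c2, d1, d2, one_mul, mul_one] at h00 h11 h12 h21 h22
  clear hr1 hr2 h₀ h₁ h₂ e00 e10 q1 q2 c1 c2 d1 d2
  -- For each choice of the signs, this and the next three relations are linear combinations, with
  -- numerical coefficients, of the entries and the relations already found.
  have hdc : d * c = 0 := by
    rcases s0 with rfl | rfl <;> rcases s1 with rfl | rfl <;> rcases s2 with rfl | rfl <;>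
      linarith only [h12, h21]
  have hb2 : b ^ 2 = -2 * (e₁ * e₂) * (a * d) := by
    rcases s0 with rfl | rfl <;> rcases s1 with rfl | rfl <;> rcases s2 with rfl | rfl <;>
      linarith only [h22]
  have hbd : b * (d - 2 * a) = 0 := by
    rcases s0 with rfl | rfl <;> rcases s1 with rfl | rfl <;> rcases s2 with rfl | rfl <;>
      linarith only [h12, h21, hdc]
  have hk : b ^ 2 * (e₁ * e₂) + b * c + d * d = 0 := by
    rcases s0 with rfl | rfl <;> rcases s1 with rfl | rfl <;> rcases s2 with rfl | rfl <;>
      linarith only [h00, h11, hb2]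
  have he : e₁ * e₂ = 1 ∨ e₁ * e₂ = -1 := by
    rcases s1 with rfl | rfl <;> rcases s2 with rfl | rfl <;> norm_num
  rw [ht]
  have hb0 : d = 0 → b = 0 := fun hd => by
    rw [hd, mul_zero, mul_zero] at hb2
    exact pow_eq_zero_iff two_ne_zero |>.1 hb2
  by_cases hd : d = 0
  · exact ⟨Or.inl ⟨hb0 hd, hd⟩, fun h => htr (by linarith)⟩
  · have hc : c = 0 := (mul_eq_zero.1 hdc).resolve_left hd
    subst hc
    have hd2 : d = 2 * a := by
      have : d * (d - 2 * a) = 0 := by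
        rcases he with he | he <;> rw [he] at hb2 hk <;> linarith only [hb2, hk, hbd]
      linarith [(mul_eq_zero.1 this).resolve_left hd]
    have ha : a ≠ 0 := fun h => hd (by linarith)
    refine ⟨Or.inr ⟨rfl, hd2, ?_⟩, neg_ne_zero.2 ha⟩
    rw [hd2] at hb2
    rcases he with he | he <;> rw [he] at hb2
    -- For equal signs, that is for `g` definite on `𝔲`, the relation reads `b² = -4a²` and would
    -- force `a = 0`.
    · exact absurd (by nlinarith [sq_nonneg b, sq_nonneg a] : a ^ 2 = 0) (pow_ne_zero 2 ha)
    · linarith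

/-- Now `b₂` is null and in the kernel of `F`. The equations contracted with `F` give `b = 0` and `u
0 = h - d`, so `A` is triangular with eigenvalues `a` and `d`; the entries `(0, 0)`, `(1, 2)` and
`(2, 1)` restrict these. -/
theorem cases_of_frameRicciFlat_null {e₀ : ℝ} (h₀ : e₀ * e₀ = 1) {u m : Fin 3 → ℝ} {r : ℝ}
    (H : FrameRicciFlat !![a, b; c, d] ![0, 2, 1] ![e₀, 1, 1] p 0 h u m r)
    (htr : a + d ≠ 0) (hp : p ≠ 0) :
    b = 0 ∧ a ≠ 0 ∧ (d = 0 ∨ d = -2 * a) ∧ u 0 ≠ 0 := by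
  have h00 := ((H 0).1 0).1
  have h12 := ((H 1).1 2).1
  have h21 := ((H 2).1 1).1
  have hr1 := (H 1).2.1
  have hr2 := (H 2).2.1
  simp [contrConst, contrFConst, Fin.sum_univ_three, nablaConst, structConst, formConst, levi]
    at h00 h12 h21 hr1 hr2
  clear H
  have e00 : e₀ ≠ 0 := by rintro rfl; simp at h₀
  have hb : b = 0 := by grind
  have ht : u 0 = h - d := by grind
  grind

/-- This serves the case in which `b₁` is not an eigenvector. By `eigenvector_of_frameRicciFlat` the
divergence cannot be zero here if `d ≠ 0`. -/
theorem frameRicciFlat_deg₁ (b d : ℝ) : FrameRicciFlat !![0, b; 1, d] ![1, 0, 2] ![1, 1, -1]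
    1 d 1 ![0, 0, 1] ![0, 0, 1] (-1) := by
  intro k
  refine ⟨fun l => ⟨?_, ?_⟩, ?_, ?_⟩
  all_goals fin_cases k
  all_goals try fin_cases l
  all_goals
    simp [contrConst, contrFConst, Fin.sum_univ_three, nablaConst, structConst, formConst, levi]
  all_goals ring

/-- With `b₁` an eigenvector, `H = 0` and `F` supported on `b₀, b₂`, only the entries `(0, 0)` are
not satisfied identically; they are the hypothesis on `q`. -/
theorem frameRicciFlat_deg₂ {t : ℝ} (hq : q ^ 2 = a ^ 2 + d ^ 2 + a * t) :
    FrameRicciFlat !![a, b; 0, d] ![1, 0, 2] ![1, 1, -1]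
    0 q 0 ![t, 0, 0] ![t, 0, 0] 0 := by
  intro k
  refine ⟨fun l => ⟨?_, ?_⟩, ?_, ?_⟩
  all_goals fin_cases k
  all_goals try fin_cases l
  all_goals
    simp [contrConst, contrFConst, Fin.sum_univ_three, nablaConst, structConst, formConst, levi]
  all_goals linear_combination hq

/-- The first case of `cases_of_frameRicciFlat_orth`, with `a = 1` and `u 0 = -a`. -/
theorem frameRicciFlat_tau2 : FrameRicciFlat !![1, 0; 0, 0] ![0, 1, 2] ![1, -1, 1]
    1 0 0 ![-1, 0, 0] ![-1, 0, 0] 0 := by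
  intro k
  refine ⟨fun l => ⟨?_, ?_⟩, ?_, ?_⟩
  all_goals fin_cases k
  all_goals try fin_cases l
  all_goals
    simp [contrConst, contrFConst, Fin.sum_univ_three, nablaConst, structConst, formConst, levi]
  all_goals norm_num

/-- The second case of `cases_of_frameRicciFlat_orth`, with `a = 1 / 2`; the entry `b = 1` is
required by `b² = 4a²`. -/
theorem frameRicciFlat_tau3_half (hp : p ^ 2 = 3 / 4) :
    FrameRicciFlat !![1 / 2, 1; 0, 1] ![0, 1, 2] ![1, -1, 1]
    p 0 0 ![-(1 / 2), 0, 0] ![-(1 / 2), 0, 0] 0 := by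
  intro k
  refine ⟨fun l => ⟨?_, ?_⟩, ?_, ?_⟩
  all_goals fin_cases k
  all_goals try fin_cases l
  all_goals
    simp [contrConst, contrFConst, Fin.sum_univ_three, nablaConst, structConst, formConst, levi]
  all_goals linarith

/-- The case `d = -2a` of `cases_of_frameRicciFlat_null`, with `a = -1` and `u 0 = h - d`. -/
theorem frameRicciFlat_tau3_neg_half : FrameRicciFlat !![-1, 0; 2, 2] ![0, 2, 1] ![1, 1, 1]
    2 0 1 ![-1, 0, 0] ![-1, 0, 0] 0 := by
  intro k
  refine ⟨fun l => ⟨?_, ?_⟩, ?_, ?_⟩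
  all_goals fin_cases k
  all_goals try fin_cases l
  all_goals
    simp [contrConst, contrFConst, Fin.sum_univ_three, nablaConst, structConst, formConst, levi]
  all_goals norm_num

end Solutions

/-! ### Three-dimensional non-unimodular Lie algebras -/

section LieStructure

variable {𝔤 : Type*} [LieRing 𝔤] [LieAlgebra ℝ 𝔤]

/-- The basis identifies the Lie algebra with `ℝ ⋉_A ℝ²`. -/
structure IsSemiBasis (b : Module.Basis (Fin 3) ℝ 𝔤) (A : Matrix (Fin 2) (Fin 2) ℝ) : Prop where
  lie01 : ⁅b 0, b 1⁆ = A 0 0 • b 1 + A 1 0 • b 2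
  lie02 : ⁅b 0, b 2⁆ = A 0 1 • b 1 + A 1 1 • b 2
  lie12 : ⁅b 1, b 2⁆ = 0

/-- The form `x ↦ tr (ad x)`. -/
noncomputable def traceAd (𝔤 : Type*) [LieRing 𝔤] [LieAlgebra ℝ 𝔤] : 𝔤 →ₗ[ℝ] ℝ :=
  LinearMap.trace ℝ 𝔤 ∘ₗ (LieAlgebra.ad ℝ 𝔤 : 𝔤 →ₗ[ℝ] _)

theorem traceAd_lie (x y : 𝔤) : traceAd 𝔤 ⁅x, y⁆ = 0 := by
  have h : (LieAlgebra.ad ℝ 𝔤 ⁅x, y⁆ : Module.End ℝ 𝔤)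
      = LieAlgebra.ad ℝ 𝔤 x * LieAlgebra.ad ℝ 𝔤 y - LieAlgebra.ad ℝ 𝔤 y * LieAlgebra.ad ℝ 𝔤 x :=
    LinearMap.ext fun z => lie_lie x y z
  change LinearMap.trace ℝ 𝔤 (LieAlgebra.ad ℝ 𝔤 ⁅x, y⁆) = 0
  rw [h, map_sub, LinearMap.trace_mul_comm, sub_self]

namespace IsSemiBasis

variable {b : Module.Basis (Fin 3) ℝ 𝔤} {A : Matrix (Fin 2) (Fin 2) ℝ}

theorem lie_eq (hb : IsSemiBasis b A) (X Y : 𝔤) :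
    ⁅X, Y⁆ = (b.repr X 0 * b.repr Y 1 - b.repr X 1 * b.repr Y 0) • (A 0 0 • b 1 + A 1 0 • b 2)
      + (b.repr X 0 * b.repr Y 2 - b.repr X 2 * b.repr Y 0) • (A 0 1 • b 1 + A 1 1 • b 2) := by
  have h10 : ⁅b 1, b 0⁆ = -(A 0 0 • b 1 + A 1 0 • b 2) := by rw [← lie_skew, hb.lie01]
  have h20 : ⁅b 2, b 0⁆ = -(A 0 1 • b 1 + A 1 1 • b 2) := by rw [← lie_skew, hb.lie02]
  have h21 : ⁅b 2, b 1⁆ = 0 := by rw [← lie_skew, hb.lie12, neg_zero]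
  conv_lhs => rw [← b.sum_repr X, ← b.sum_repr Y, Fin.sum_univ_three, Fin.sum_univ_three]
  simp only [add_lie, lie_add, smul_lie, lie_smul, lie_self, hb.lie01, hb.lie02, hb.lie12, h10,
    h20, h21]
  module

theorem traceAd_eq (hb : IsSemiBasis b A) (X : 𝔤) :
    traceAd 𝔤 X = b.repr X 0 * (A 0 0 + A 1 1) := by
  change LinearMap.trace ℝ 𝔤 (LieAlgebra.ad ℝ 𝔤 X) = _
  rw [LinearMap.trace_eq_matrix_trace ℝ b, Matrix.trace, Fin.sum_univ_three]
  simp only [Matrix.diag_apply, LinearMap.toMatrix_apply, LieAlgebra.ad_apply, hb.lie_eq X]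
  simp
  ring

theorem mem_ker_iff (hb : IsSemiBasis b A) (htr : A 0 0 + A 1 1 ≠ 0) (X : 𝔤) :
    X ∈ LinearMap.ker (traceAd 𝔤) ↔ b.repr X 0 = 0 := by
  rw [LinearMap.mem_ker, hb.traceAd_eq, mul_eq_zero, or_iff_left htr]

/-- The basis with the elements `s b₀`, `P₀₀ b₁ + P₁₀ b₂`, `P₀₁ b₁ + P₁₁ b₂`. -/
theorem change (hb : IsSemiBasis b A) {P B : Matrix (Fin 2) (Fin 2) ℝ} {s : ℝ} (hs : s ≠ 0)
    (hP : P.det ≠ 0) (h : s • (A * P) = P * B) : ∃ b' : Module.Basis (Fin 3) ℝ 𝔤,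
      IsSemiBasis b' B := by
  -- The matrix of `ad (s b₀)` on `𝔲` is `s A`, and the hypothesis says that `P` conjugates it to
  -- `B`.
  let M : Matrix (Fin 3) (Fin 3) ℝ := !![s, 0, 0; 0, P 0 0, P 0 1; 0, P 1 0, P 1 1]
  have hM : IsUnit M.det := by
    rw [Matrix.det_fin_two] at hP
    rw [isUnit_iff_ne_zero, Matrix.det_fin_three]
    have : s * (P 0 0 * P 1 1 - P 0 1 * P 1 0) ≠ 0 := mul_ne_zero hs hP
    simpa [M, mul_sub, mul_assoc] using this
  have hb' : ∀ j, (b.map (Matrix.toLinearEquiv b M hM)) j = ∑ i, M i j • b i := fun j => by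
    rw [Module.Basis.map_apply]
    exact Matrix.toLin_self b b M j
  have e := fun i j => congrFun (congrFun h i) j
  simp only [Matrix.smul_apply, Matrix.mul_apply, Fin.sum_univ_two, smul_eq_mul] at e
  refine ⟨b.map (Matrix.toLinearEquiv b M hM), ?_, ?_, ?_⟩
  · rw [hb', hb', hb', hb.lie_eq]
    simp [M, Fin.sum_univ_three]
    linear_combination (norm := module) (e 0 0) • b 1 + (e 1 0) • b 2
  · rw [hb', hb', hb', hb.lie_eq]
    simp [M, Fin.sum_univ_three]
    linear_combination (norm := module) (e 0 1) • b 1 + (e 1 1) • b 2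
  · rw [hb', hb', hb.lie_eq]
    simp [M, Fin.sum_univ_three]

end IsSemiBasis

/-! ### The model Lie algebras -/

/-- The standard basis of `ℝ ⋉_A ℝ²`. -/
noncomputable def SemiDir.basis (A : Matrix (Fin 2) (Fin 2) ℝ) :
    Module.Basis (Fin 3) ℝ (SemiDir A) :=
  Module.Basis.ofEquivFun
    { toFun := fun x => ![x.t, x.x 0, x.x 1]
      invFun := fun v => ⟨v 0, ![v 1, v 2]⟩
      map_add' := fun x y => by
        ext i
        fin_cases i <;> rfl
      map_smul' := fun c x => by
        ext i
        fin_cases i <;> rfl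
      left_inv := fun x => by
        refine SemiDir.ext rfl ?_
        ext i
        fin_cases i <;> rfl
      right_inv := fun v => by
        ext i
        fin_cases i <;> rfl }

theorem SemiDir.basis_apply (A : Matrix (Fin 2) (Fin 2) ℝ) (i : Fin 3) : SemiDir.basis A i =
    ⟨(Pi.single i 1 : Fin 3 → ℝ) 0, ![(Pi.single i 1 : Fin 3 → ℝ) 1, (Pi.single i 1 : Fin 3 → ℝ) 2]⟩ := by
  rw [SemiDir.basis, Module.Basis.coe_ofEquivFun]
  rfl

theorem SemiDir.isSemiBasis (A : Matrix (Fin 2) (Fin 2) ℝ) : IsSemiBasis (SemiDir.basis A) A := by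
  refine ⟨?_, ?_, ?_⟩
  all_goals
    simp only [SemiDir.basis_apply]
    refine SemiDir.ext ?_ ?_
    · simp [SemiDir.lie_t, SemiDir.add_t, SemiDir.smul_t, SemiDir.zero_t]
    · ext i
      fin_cases i <;> simp [SemiDir.lie_x, SemiDir.add_x, SemiDir.smul_x, SemiDir.zero_x]

theorem nonempty_lieEquiv_iff (A : Matrix (Fin 2) (Fin 2) ℝ) :
    Nonempty (𝔤 ≃ₗ⁅ℝ⁆ SemiDir A) ↔ ∃ b : Module.Basis (Fin 3) ℝ 𝔤, IsSemiBasis b A := by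
  constructor
  · rintro ⟨e⟩
    have h : ∀ i, ((SemiDir.basis A).map e.symm.toLinearEquiv) i = e.symm (SemiDir.basis A i) :=
      fun i => Module.Basis.map_apply _ _ _
    have hA := SemiDir.isSemiBasis A
    refine ⟨(SemiDir.basis A).map e.symm.toLinearEquiv, ?_, ?_, ?_⟩
    · rw [h, h, h, ← LieEquiv.map_lie, hA.lie01, map_add, map_smul, map_smul]
    · rw [h, h, h, ← LieEquiv.map_lie, hA.lie02, map_add, map_smul, map_smul]
    · rw [h, h, ← LieEquiv.map_lie, hA.lie12, map_zero]
  · rintro ⟨b, hb⟩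
    let e : 𝔤 ≃ₗ[ℝ] SemiDir A := b.equiv (SemiDir.basis A) (Equiv.refl _)
    have he : ∀ i, e (b i) = SemiDir.basis A i := fun i => b.equiv_apply i _ _
    have hr : ∀ X i, (SemiDir.basis A).repr (e X) i = b.repr X i := fun X i => by
      have : e X = ∑ j, b.repr X j • SemiDir.basis A j := by
        conv_lhs => rw [← b.sum_repr X, map_sum]
        simp only [map_smul, he]
      rw [this, Module.Basis.repr_sum_self]
    refine ⟨{ e with map_lie' := fun {X Y} => ?_ }⟩
    change e ⁅X, Y⁆ = ⁅e X, e Y⁆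
    rw [hb.lie_eq, (SemiDir.isSemiBasis A).lie_eq]
    simp only [map_add, map_smul, he, hr]

/-! ### Bases of non-unimodular Lie algebras -/

/-- A vector outside and two independent vectors inside of the unimodular kernel form a basis which
identifies the Lie algebra with some `ℝ ⋉_A ℝ²`. -/
theorem exists_isSemiBasis_of_mem (h3 : Module.finrank ℝ 𝔤 = 3) {x y z : 𝔤}
    (hx : traceAd 𝔤 x ≠ 0) (hy : traceAd 𝔤 y = 0) (hz : traceAd 𝔤 z = 0)
    (hyz : ∀ α β : ℝ, α • y + β • z = 0 → α = 0 ∧ β = 0) :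
    ∃ (b : Module.Basis (Fin 3) ℝ 𝔤) (A : Matrix (Fin 2) (Fin 2) ℝ),
      b 0 = x ∧ b 1 = y ∧ b 2 = z ∧ IsSemiBasis b A ∧ A 0 0 + A 1 1 ≠ 0 := by
  have : Module.Finite ℝ 𝔤 := Module.finite_of_finrank_pos (by omega)
  have hli : LinearIndependent ℝ ![x, y, z] := by
    rw [Fintype.linearIndependent_iff]
    intro c hc
    simp only [Fin.sum_univ_three, Matrix.cons_val_zero, Matrix.cons_val_one, Matrix.cons_val] at hc
    have h0 := congrArg (traceAd 𝔤) hc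
    simp only [map_add, map_smul, hy, hz, map_zero, smul_eq_mul, mul_zero, add_zero,
      mul_eq_zero, or_iff_left hx] at h0
    rw [h0, zero_smul, zero_add] at hc
    obtain ⟨h1, h2⟩ := hyz _ _ hc
    intro i
    fin_cases i
    exacts [h0, h1, h2]
  let b : Module.Basis (Fin 3) ℝ 𝔤 :=
    basisOfLinearIndependentOfCardEqFinrank hli (by rw [h3, Fintype.card_fin])
  have e0 : b 0 = x := by simp [b]
  have e1 : b 1 = y := by simp [b]
  have e2 : b 2 = z := by simp [b]
  have hr : ∀ X Y : 𝔤, b.repr ⁅X, Y⁆ 0 = 0 := fun X Y => by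
    have h1 := congrArg (traceAd 𝔤) (b.sum_repr ⁅X, Y⁆)
    rw [traceAd_lie, Fin.sum_univ_three, e0, e1, e2] at h1
    simpa [hy, hz, hx] using h1
  have hl : ∀ X Y : 𝔤, ⁅X, Y⁆ = b.repr ⁅X, Y⁆ 1 • b 1 + b.repr ⁅X, Y⁆ 2 • b 2 := fun X Y => by
    conv_lhs => rw [← b.sum_repr ⁅X, Y⁆, Fin.sum_univ_three, hr, zero_smul, zero_add]
  have htr : ∀ X, traceAd 𝔤 X = ∑ i, b.repr ⁅X, b i⁆ i := fun X => by
    change LinearMap.trace ℝ 𝔤 (LieAlgebra.ad ℝ 𝔤 X) = _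
    rw [LinearMap.trace_eq_matrix_trace ℝ b, Matrix.trace]
    simp only [Matrix.diag_apply, LinearMap.toMatrix_apply, LieAlgebra.ad_apply]
  -- Commutators have no `b₀`-component, and the two other components of `[b₁, b₂]` are, up to sign,
  -- the traces of `ad b₁` and `ad b₂`. Both vanish, so `𝔲` is abelian.
  have h1 := htr (b 1)
  have h2 := htr (b 2)
  have h0 := htr (b 0)
  rw [Fin.sum_univ_three, hr] at h0
  rw [Fin.sum_univ_three, hr, lie_self, map_zero] at h1 h2
  rw [e1, hy, ← e1] at h1
  rw [e2, hz, ← e2, ← lie_skew, map_neg] at h2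
  simp only [Finsupp.zero_apply, Finsupp.neg_apply] at h0 h1 h2
  refine ⟨b, !![b.repr ⁅b 0, b 1⁆ 1, b.repr ⁅b 0, b 2⁆ 1; b.repr ⁅b 0, b 1⁆ 2, b.repr ⁅b 0, b 2⁆ 2],
    e0, e1, e2, ⟨hl _ _, hl _ _, ?_⟩, ?_⟩
  · rw [hl, show b.repr ⁅b 1, b 2⁆ 1 = 0 by linarith, show b.repr ⁅b 1, b 2⁆ 2 = 0 by linarith]
    simp
  · rw [e0] at h0
    intro h
    refine hx ?_
    rw [h0, ← e0]
    simpa [add_assoc] using h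

theorem exists_isSemiBasis (h3 : Module.finrank ℝ 𝔤 = 3) (h : LinearMap.ker (traceAd 𝔤) ≠ ⊤) :
    ∃ (b : Module.Basis (Fin 3) ℝ 𝔤) (A : Matrix (Fin 2) (Fin 2) ℝ),
      IsSemiBasis b A ∧ A 0 0 + A 1 1 ≠ 0 := by
  have : Module.Finite ℝ 𝔤 := Module.finite_of_finrank_pos (by omega)
  obtain ⟨x, hx⟩ : ∃ x, traceAd 𝔤 x ≠ 0 := by
    by_contra! hc
    exact h (LinearMap.ker_eq_top.2 (LinearMap.ext hc))
  have hr : LinearMap.range (traceAd 𝔤) = ⊤ := LinearMap.range_eq_top.2 fun t =>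
    ⟨(t / traceAd 𝔤 x) • x, by rw [map_smul, smul_eq_mul, div_mul_cancel₀ _ hx]⟩
  have h2 : Module.finrank ℝ (LinearMap.ker (traceAd 𝔤)) = 2 := by
    have := LinearMap.finrank_range_add_finrank_ker (traceAd 𝔤)
    rw [hr, finrank_top, Module.finrank_self, h3] at this
    omega
  let c := Module.finBasisOfFinrankEq ℝ _ h2
  obtain ⟨b, A, -, -, -, hA⟩ := exists_isSemiBasis_of_mem h3 hx (c 0).2 (c 1).2 (by
    intro α β hαβ
    have h1 : ∑ i, ![α, β] i • c i = 0 := by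
      rw [Fin.sum_univ_two]
      exact Subtype.ext hαβ
    have h2 := Fintype.linearIndependent_iff.1 c.linearIndependent _ h1
    exact ⟨h2 0, h2 1⟩)
  exact ⟨b, A, hA⟩

end LieStructure

/-! ### Forms with prescribed components -/

section Prescribed

variable {L : Type*} [AddCommGroup L] [Module ℝ L] (b : Module.Basis (Fin 3) ℝ L)

/-- The bilinear form with the Gram matrix `s i` at `(i, σ i)`. -/
noncomputable def gramForm (σ : Fin 3 → Fin 3) (s : Fin 3 → ℝ) : LinearMap.BilinForm ℝ L :=
  ∑ i, (b.coord i).smulRight (s i • b.coord (σ i))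

theorem gramForm_apply (σ : Fin 3 → Fin 3) (s : Fin 3 → ℝ) (i j : Fin 3) :
    gramForm b σ s (b i) (b j) = if j = σ i then s i else 0 := by
  simp [gramForm, LinearMap.sum_apply, Finsupp.single_apply]

/-- The frame given by a basis, for the form with a prescribed Gram matrix. -/
noncomputable def gramFrame (σ : Fin 3 → Fin 3) (s : Fin 3 → ℝ) (hσ : ∀ i, σ (σ i) = i)
    (hs : ∀ i, s (σ i) * s i = 1) : GramFrame (gramForm b σ s) where
  b := b
  σ := σ
  s := s
  invol := hσ
  sq := hs
  gram := gramForm_apply b σ s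

theorem gramForm_symm (σ : Fin 3 → Fin 3) (s : Fin 3 → ℝ) (hσ : ∀ i, σ (σ i) = i)
    (hs : ∀ i, s (σ i) = s i) (X Y : L) : gramForm b σ s X Y = gramForm b σ s Y X := by
  have h : gramForm b σ s = LinearMap.flip (gramForm b σ s) := by
    refine LinearMap.BilinForm.ext_basis b fun i j => ?_
    rw [LinearMap.flip_apply, gramForm_apply, gramForm_apply]
    by_cases hij : j = σ i
    · rw [if_pos hij, if_pos (by rw [hij, hσ]), hij, hs]
    · rw [if_neg hij, if_neg fun h => hij (by rw [h, hσ])]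
  exact LinearMap.congr_fun₂ h X Y

/-- The two-form which vanishes on the span of `b₁` and `b₂` and has the other components
`p` and `q`. -/
noncomputable def twoForm (p q : ℝ) : L [⋀^Fin 2]→ₗ[ℝ] ℝ := b.det.curryLeft (-q • b 1 + p • b 2)

theorem det_apply_three (X Y Z : L) : b.det ![X, Y, Z] =
    Matrix.det !![b.repr X 0, b.repr Y 0, b.repr Z 0; b.repr X 1, b.repr Y 1, b.repr Z 1;
      b.repr X 2, b.repr Y 2, b.repr Z 2] := by
  rw [Module.Basis.det_apply]
  congr 1
  ext i j
  fin_cases i <;> fin_cases j <;> rfl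

/-- The determinant is contracted with a vector that is to lie in the kernel of the form. -/
theorem twoForm_apply (p q : ℝ) (X Y : L) : bilinOfForm (twoForm b p q) X Y =
    p * (b.repr X 0 * b.repr Y 1 - b.repr X 1 * b.repr Y 0)
      + q * (b.repr X 0 * b.repr Y 2 - b.repr X 2 * b.repr Y 0) := by
  refine (det_apply_three b _ X Y).trans ?_
  rw [Matrix.det_fin_three]
  simp
  ring

theorem twoForm_ne_zero {p q : ℝ} (h : p ≠ 0 ∨ q ≠ 0) : twoForm b p q ≠ 0 := by
  intro h0
  have h1 := twoForm_apply b p q (b 0) (b 1)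
  have h2 := twoForm_apply b p q (b 0) (b 2)
  rw [h0] at h1 h2
  have e : ∀ X Y : L, bilinOfForm (0 : L [⋀^Fin 2]→ₗ[ℝ] ℝ) X Y = 0 := fun X Y => rfl
  rw [e] at h1 h2
  rcases h with h | h
  · simp [h.symm] at h1
  · simp [h.symm] at h2

theorem trilinOfForm_det (h : ℝ) : trilinOfForm (h • b.det) (b 0) (b 1) (b 2) = h := by
  change h • b.det ![b 0, b 1, b 2] = h
  rw [det_apply_three]
  simp [Matrix.det_fin_three]

variable [Module.Finite ℝ L] {g : LinearMap.BilinForm ℝ L} (hg : g.Nondegenerate)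

/-- The divergence operator with prescribed components. -/
noncomputable def divForm (u m : Fin 3 → ℝ) (r : ℝ) : Module.Dual ℝ (L × Module.Dual ℝ L × ℝ) :=
  (b.constr ℝ u ∘ₗ LinearMap.fst ℝ _ _ + r • LinearMap.snd ℝ _ _) ∘ₗ plusComp g hg
    + b.constr ℝ m ∘ₗ minusComp g hg

theorem divForm_plusMap (u m : Fin 3 → ℝ) (r : ℝ) (Y : L × ℝ) :
    divForm b hg u m r (plusMap g Y) = b.constr ℝ u Y.1 + r * Y.2 := by
  simp [divForm, plusComp_plusMap, minusComp_plusMap]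

theorem divForm_minusMap (u m : Fin 3 → ℝ) (r : ℝ) (X : L) :
    divForm b hg u m r (minusMap g X) = b.constr ℝ m X := by
  simp [divForm, plusComp_minusMap, minusComp_minusMap]

theorem divForm_zero : divForm b hg 0 0 0 = 0 := by
  have : b.constr ℝ (0 : Fin 3 → ℝ) = 0 := map_zero _
  simp [divForm, this]

theorem divForm_ne_zero {u m : Fin 3 → ℝ} {r : ℝ} {i : Fin 3} (h : u i ≠ 0) :
    divForm b hg u m r ≠ 0 := by
  intro h0
  have h1 := divForm_plusMap b hg u m r (b i, 0)
  rw [h0, Module.Basis.constr_basis] at h1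
  simp [h.symm] at h1

end Prescribed

/-! ### Odd generalized Einstein metrics in a frame -/

section Frame

variable {G : Type*} [TopologicalSpace G] [ChartedSpace E3 G] [Group G] [LieGroup (𝓡 3) ∞ G]
  {g : LinearMap.BilinForm ℝ (LieAlg G)} {H : InvForm G 3} {F : InvForm G 2}
  {δ : Module.Dual ℝ (Fib (1 : G))} {A : Matrix (Fin 2) (Fin 2) ℝ} {p q h : ℝ}

theorem isOddEinstein_frame_iff (f : GramFrame g) (hs : ∀ X Y, g X Y = g Y X)
    (hA : IsAdapted f.b (lieBil G) H F A p q h) :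
    IsOddEinstein H F g δ ↔ IsClosedForm F ∧
      FrameRicciFlat A f.σ f.s p q h (fun i => δ (plusMap g (f.b i, 0)))
        (fun i => δ (minusMap g (f.b i))) (δ (plusMap g (0, 1))) :=
  (isOddEinstein_iff H F (f.nondegenerate hs) hs δ).trans (and_congr_right fun _ =>
    ric_eq_zero_iff_frame (f.nondegenerate hs) hs lieBil_swap δ f hA)

theorem mem_unimodKernel_iff {b : Module.Basis (Fin 3) ℝ (LieAlg G)} (hb : IsSemiBasis b A)
    (htr : A 0 0 + A 1 1 ≠ 0) (X : LieAlg G) : X ∈ unimodKernel G ↔ b.repr X 0 = 0 :=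
  hb.mem_ker_iff htr X

theorem nondegOnKernel_iff (hs : ∀ X Y, g X Y = g Y X) : NondegOnKernel g ↔
    ∀ X ∈ unimodKernel G, (∀ Y ∈ unimodKernel G, g X Y = 0) → X = 0 := by
  constructor
  · intro h X hX hXY
    exact congrArg Subtype.val (h.1 ⟨X, hX⟩ fun Y => hXY Y Y.2)
  · intro h
    have h1 : ∀ X : unimodKernel G, (∀ Y : unimodKernel G, g X Y = 0) → X = 0 := fun X hX =>
      Subtype.ext (h X X.2 fun Y hY => hX ⟨Y, hY⟩)
    exact ⟨h1, fun X hX => h1 X fun Y => by rw [hs]; exact hX Y⟩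

/-- Brackets lie in the span of `b₁` and `b₂`, on which the form vanishes, so each term is of the
type `Z₀ (X₀ φ(Y) - Y₀ φ(X))`, and the cyclic sum cancels. -/
theorem isClosedForm_twoForm {b : Module.Basis (Fin 3) ℝ (LieAlg G)} (hb : IsSemiBasis b A)
    (p q : ℝ) : IsClosedForm (twoForm b p q) := by
  intro X Y Z
  change bilinOfForm (twoForm b p q) ⁅X, Y⁆ Z + bilinOfForm (twoForm b p q) ⁅Y, Z⁆ X
    + bilinOfForm (twoForm b p q) ⁅Z, X⁆ Y = 0
  rw [twoForm_apply, twoForm_apply, twoForm_apply, hb.lie_eq X Y, hb.lie_eq Y Z, hb.lie_eq Z X]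
  simp
  ring

theorem IsSemiBasis.isAdapted {b : Module.Basis (Fin 3) ℝ (LieAlg G)} (hb : IsSemiBasis b A)
    (p q h : ℝ) : IsAdapted b (lieBil G) (h • b.det) (twoForm b p q) A p q h where
  br01 := hb.lie01
  br02 := hb.lie02
  br12 := hb.lie12
  F01 := by rw [twoForm_apply]; simp
  F02 := by rw [twoForm_apply]; simp
  F12 := by rw [twoForm_apply]; simp
  H012 := trilinOfForm_det b h

/-- Solutions of the equations in a frame give odd generalized Einstein metrics. -/
theorem IsSemiBasis.isOddEinstein {b : Module.Basis (Fin 3) ℝ (LieAlg G)} (hb : IsSemiBasis b A)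
    {σ : Fin 3 → Fin 3} {s : Fin 3 → ℝ} (hσ : ∀ i, σ (σ i) = i) (hs : ∀ i, s (σ i) = s i)
    (hsq : ∀ i, s i * s i = 1) {u m : Fin 3 → ℝ} {r : ℝ} (hR : FrameRicciFlat A σ s p q h u m r) :
    ∃ hg : (gramForm b σ s).Nondegenerate,
      IsOddEinstein (h • b.det) (twoForm b p q) (gramForm b σ s) (divForm b hg u m r) := by
  let f := gramFrame b σ s hσ fun i => by rw [hs, hsq]
  have hsymm := gramForm_symm b σ s hσ hs
  have hg := f.nondegenerate hsymm
  refine ⟨hg, (isOddEinstein_frame_iff f hsymm (hb.isAdapted p q h)).2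
    ⟨isClosedForm_twoForm hb p q, ?_⟩⟩
  simp only [divForm_plusMap, divForm_minusMap]
  have e : ∀ (v : Fin 3 → ℝ) i, b.constr ℝ v (f.b i) = v i := fun v i => b.constr_basis ℝ v i
  simp only [e, mul_zero, mul_one, zero_add, add_zero, map_zero]
  exact hR

theorem not_nondegOnKernel_gramForm {b : Module.Basis (Fin 3) ℝ (LieAlg G)}
    (hb : IsSemiBasis b A) (htr : A 0 0 + A 1 1 ≠ 0) (s : Fin 3 → ℝ)
    (hs : ∀ i, s (![1, 0, 2] i) = s i) :
    ¬ NondegOnKernel (gramForm b ![1, 0, 2] s) := by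
  rw [nondegOnKernel_iff (gramForm_symm b _ s (by decide) hs)]
  intro h
  refine b.ne_zero 1 (h _ ((mem_unimodKernel_iff hb htr _).2 (by simp)) fun Y hY => ?_)
  rw [mem_unimodKernel_iff hb htr] at hY
  rw [← b.sum_repr Y, Fin.sum_univ_three, hY]
  simp [gramForm_apply]

theorem nondegOnKernel_gramForm {b : Module.Basis (Fin 3) ℝ (LieAlg G)}
    (hb : IsSemiBasis b A) (htr : A 0 0 + A 1 1 ≠ 0) {σ : Fin 3 → Fin 3} {s : Fin 3 → ℝ}
    (hσ : ∀ i, σ (σ i) = i) (h0 : σ 0 = 0) (hs : ∀ i, s (σ i) = s i)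
    (hsq : ∀ i, s i * s i = 1) : NondegOnKernel (gramForm b σ s) := by
  rw [nondegOnKernel_iff (gramForm_symm b σ s hσ hs)]
  intro X hX h
  rw [mem_unimodKernel_iff hb htr] at hX
  refine b.ext_elem fun i => ?_
  by_cases hi : i = 0
  · rw [hi, hX]
    simp
  · have e := (gramFrame b σ s hσ fun i => by rw [hs, hsq]).coord_eq X i
    refine e.trans ?_
    have : gramForm b σ s X (b (σ i)) = 0 := by
      refine h _ ((mem_unimodKernel_iff hb htr _).2 ?_)
      rw [Module.Basis.repr_self, Finsupp.single_eq_of_ne]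
      intro h1
      exact hi (by rw [← hσ i, ← h1, h0])
    refine (congrArg _ this).trans ?_
    simp

end Frame

/-! ### Frames adapted to a metric and to the unimodular kernel -/

section Normalize

variable {L : Type*} [AddCommGroup L] [Module ℝ L] {g : LinearMap.BilinForm ℝ L}

theorem exists_smul_unit {z : L} (h : g z z ≠ 0) :
    ∃ c : ℝ, c ≠ 0 ∧ g (c • z) (c • z) * g (c • z) (c • z) = 1 := by
  have h1 : 0 < |g z z| := abs_pos.2 h
  refine ⟨(√|g z z|)⁻¹, inv_ne_zero (Real.sqrt_pos.2 h1).ne', ?_⟩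
  have h2 : ((√|g z z|)⁻¹) * ((√|g z z|)⁻¹) = |g z z|⁻¹ := by
    rw [← mul_inv, Real.mul_self_sqrt h1.le]
  have h3 : |g z z|⁻¹ * g z z * (|g z z|⁻¹ * g z z) = 1 := by
    rw [mul_mul_mul_comm, ← mul_inv, abs_mul_abs_self, inv_mul_cancel₀ (mul_ne_zero h h)]
  rw [← h2] at h3
  simp only [map_smul, LinearMap.smul_apply, smul_eq_mul]
  linear_combination h3

/-- The frame given by a basis with a pseudo-orthonormal Gram matrix. -/
def GramFrame.ofOrth (hs : ∀ X Y, g X Y = g Y X) (b : Module.Basis (Fin 3) ℝ L) {e₀ e₁ e₂ : ℝ}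
    (h₀ : e₀ * e₀ = 1) (h₁ : e₁ * e₁ = 1) (h₂ : e₂ * e₂ = 1) (g00 : g (b 0) (b 0) = e₀)
    (g01 : g (b 0) (b 1) = 0) (g02 : g (b 0) (b 2) = 0) (g11 : g (b 1) (b 1) = e₁)
    (g12 : g (b 1) (b 2) = 0) (g22 : g (b 2) (b 2) = e₂) : GramFrame g where
  b := b
  σ := ![0, 1, 2]
  s := ![e₀, e₁, e₂]
  invol := by decide
  sq i := by
    fin_cases i
    exacts [h₀, h₁, h₂]
  gram i j := by
    fin_cases i <;> fin_cases j <;>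
      simp [g00, g01, g02, g11, g12, g22, hs (b 1) (b 0), hs (b 2) (b 0), hs (b 2) (b 1)]

/-- The frame given by a basis with `b₀` and `b₁` null. -/
def GramFrame.ofDegenerate (hs : ∀ X Y, g X Y = g Y X) (b : Module.Basis (Fin 3) ℝ L) {e : ℝ}
    (he : e * e = 1) (g00 : g (b 0) (b 0) = 0) (g01 : g (b 0) (b 1) = 1)
    (g02 : g (b 0) (b 2) = 0) (g11 : g (b 1) (b 1) = 0) (g12 : g (b 1) (b 2) = 0)
    (g22 : g (b 2) (b 2) = e) : GramFrame g where
  b := b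
  σ := ![1, 0, 2]
  s := ![1, 1, e]
  invol := by decide
  sq i := by
    fin_cases i
    exacts [one_mul 1, one_mul 1, he]
  gram i j := by
    fin_cases i <;> fin_cases j <;>
      simp [g00, g01, g02, g11, g12, g22, hs (b 1) (b 0), hs (b 2) (b 0), hs (b 2) (b 1)]

/-- The frame given by a basis with `b₁` and `b₂` null. -/
def GramFrame.ofNull (hs : ∀ X Y, g X Y = g Y X) (b : Module.Basis (Fin 3) ℝ L) {e : ℝ}
    (he : e * e = 1) (g00 : g (b 0) (b 0) = e) (g01 : g (b 0) (b 1) = 0)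
    (g02 : g (b 0) (b 2) = 0) (g11 : g (b 1) (b 1) = 0) (g12 : g (b 1) (b 2) = 1)
    (g22 : g (b 2) (b 2) = 0) : GramFrame g where
  b := b
  σ := ![0, 2, 1]
  s := ![e, 1, 1]
  invol := by decide
  sq i := by
    fin_cases i
    exacts [he, one_mul 1, one_mul 1]
  gram i j := by
    fin_cases i <;> fin_cases j <;>
      simp [g00, g01, g02, g11, g12, g22, hs (b 1) (b 0), hs (b 2) (b 0), hs (b 2) (b 1)]

theorem eq_zero_of_basis {ι : Type*} (hg : g.Nondegenerate) (b : Module.Basis ι ℝ L) {X : L}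
    (h : ∀ i, g X (b i) = 0) : X = 0 :=
  hg.1 X fun Y => LinearMap.congr_fun (b.ext (f₁ := g X) (f₂ := 0) h) Y

end Normalize

section Frames

variable {𝔤 : Type*} [LieRing 𝔤] [LieAlgebra ℝ 𝔤] {g : LinearMap.BilinForm ℝ 𝔤}
  {b : Module.Basis (Fin 3) ℝ 𝔤} {A : Matrix (Fin 2) (Fin 2) ℝ}

theorem IsSemiBasis.traceAd_basis (hb : IsSemiBasis b A) :
    traceAd 𝔤 (b 0) = A 0 0 + A 1 1 ∧ traceAd 𝔤 (b 1) = 0 ∧ traceAd 𝔤 (b 2) = 0 := by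
  simp [hb.traceAd_eq]

theorem IsSemiBasis.eq_of_traceAd (hb : IsSemiBasis b A) (htr : A 0 0 + A 1 1 ≠ 0) {X : 𝔤}
    (hX : traceAd 𝔤 X = 0) : X = b.repr X 1 • b 1 + b.repr X 2 • b 2 := by
  have h : b.repr X 0 = 0 := (hb.mem_ker_iff htr X).1 hX
  conv_lhs => rw [← b.sum_repr X, Fin.sum_univ_three, h, zero_smul, zero_add]

/-- The radical vector `n` becomes `b₁`. Since `g` is non-degenerate on `𝔤`, the vector `n` is not
orthogonal to `b₀`, and complements of `n` in `𝔲` are non-null; a Gram-Schmidt process then produces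
the frame. -/
theorem exists_degenerate_frame (h3 : Module.finrank ℝ 𝔤 = 3) (hb : IsSemiBasis b A)
    (htr : A 0 0 + A 1 1 ≠ 0) (hs : ∀ X Y, g X Y = g Y X) (hg : g.Nondegenerate) {n : 𝔤}
    (hn : traceAd 𝔤 n = 0) (hn0 : n ≠ 0) (hno : ∀ Y, traceAd 𝔤 Y = 0 → g n Y = 0) :
    ∃ (f : GramFrame g) (B : Matrix (Fin 2) (Fin 2) ℝ) (e : ℝ), f.σ = ![1, 0, 2] ∧
      f.s = ![1, 1, e] ∧ e * e = 1 ∧ IsSemiBasis f.b B ∧ B 0 0 + B 1 1 ≠ 0 := by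
  obtain ⟨t0, t1, t2⟩ := hb.traceAd_basis
  have en := hb.eq_of_traceAd htr hn
  set α := b.repr n 1
  set β := b.repr n 2
  have hαβ : α ^ 2 + β ^ 2 ≠ 0 := fun h => hn0 (by
    rw [en, show α = 0 by nlinarith [sq_nonneg α, sq_nonneg β],
      show β = 0 by nlinarith [sq_nonneg α, sq_nonneg β]]
    simp)
  -- Rotating the coordinates of `n` by a right angle gives a vector of `𝔲` independent of `n`.
  have hz : traceAd 𝔤 (-β • b 1 + α • b 2) = 0 := by simp [t1, t2]
  obtain ⟨b', A', e0, e1, e2, hb', -⟩ := exists_isSemiBasis_of_mem h3 (t0 ▸ htr) hn hz (by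
    intro c d h
    rw [en] at h
    have h1 := congrArg (fun X => b.repr X 1) h
    have h2 := congrArg (fun X => b.repr X 2) h
    simp at h1 h2
    constructor
    · refine (mul_eq_zero.1 ?_).resolve_right hαβ
      linear_combination α * h1 + β * h2
    · refine (mul_eq_zero.1 ?_).resolve_right hαβ
      linear_combination α * h2 - β * h1)
  have n1 : g n (b' 1) = 0 := hno _ (by rw [e1, hn])
  have n2 : g n (b' 2) = 0 := hno _ (by rw [e2, hz])
  have n0 : g n (b' 0) ≠ 0 := fun h => hn0 (eq_zero_of_basis hg b' (by
    intro i
    fin_cases i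
    exacts [h, n1, n2]))
  have hnn : g n n = 0 := hno n hn
  -- If `b' 2` were null, subtracting a multiple of `n` would make it orthogonal to the whole basis.
  have z2 : g (b' 2) (b' 2) ≠ 0 := fun h => by
    have h1 : b' 2 - (g (b' 2) (b' 0) / g n (b' 0)) • n = 0 := eq_zero_of_basis hg b' (by
      intro i
      rw [map_sub, map_smul, LinearMap.sub_apply, LinearMap.smul_apply, smul_eq_mul]
      fin_cases i
      · simp [n0]
      · change g (b' 2) (b' 1) - _ * g n (b' 1) = 0
        rw [n1, e1, hs, n2, mul_zero, sub_zero]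
      · change g (b' 2) (b' 2) - _ * g n (b' 2) = 0
        rw [n2, h, mul_zero, sub_zero])
    have h2 := congrArg (fun X => b'.repr X 2) h1
    rw [← e1] at h2
    simp at h2
  obtain ⟨c, hc, he⟩ := exists_smul_unit z2
  set z := c • b' 2
  set x := b' 0
  set e := g z z
  have hnz : g n z = 0 := by simp [z, n2]
  have hzn : g z n = 0 := by rw [hs, hnz]
  have hxn : g x n = g n x := hs _ _
  have hzx : g z x = g x z := hs _ _
  have tz : traceAd 𝔤 z = 0 := by simp only [z, map_smul, e2, hz, smul_zero]
  have tx : traceAd 𝔤 x ≠ 0 := by rw [show x = b 0 from e0, t0]; exact htr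
  set ν := g n x
  -- This vector is orthogonal to `z` and pairs to `1` with `n`; subtracting `1 / 2 * g y y` times
  -- `n` makes it null without changing these products.
  set y := ν⁻¹ • x - (e * ν⁻¹ * g x z) • z
  have hyz : g y z = 0 := by
    simp only [y, map_sub, map_smul, LinearMap.sub_apply, LinearMap.smul_apply, smul_eq_mul]
    change ν⁻¹ * g x z - e * ν⁻¹ * g x z * e = 0
    linear_combination (-ν⁻¹ * g x z) * he
  have hyn : g y n = 1 := by
    simp only [y, map_sub, map_smul, LinearMap.sub_apply, LinearMap.smul_apply, smul_eq_mul, hxn,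
      hzn, mul_zero, sub_zero]
    exact inv_mul_cancel₀ n0
  have hny : g n y = 1 := by rw [hs, hyn]
  have hzy : g z y = 0 := by rw [hs, hyz]
  have ty : traceAd 𝔤 (y - (1 / 2 * g y y) • n) ≠ 0 := by
    rw [map_sub, map_smul, hn, smul_zero, sub_zero, map_sub, map_smul, map_smul, tz, smul_zero,
      sub_zero]
    exact mul_ne_zero (inv_ne_zero n0) tx
  obtain ⟨v, B, v0, v1, v2, hv⟩ := exists_isSemiBasis_of_mem h3 ty hn tz (by
    intro c d h
    have h1 := congrArg (fun X => g X z) h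
    simp only [map_add, map_smul, LinearMap.add_apply, LinearMap.smul_apply, smul_eq_mul, hnz,
      mul_zero, zero_add, map_zero, LinearMap.zero_apply] at h1
    have hd : d = 0 := (mul_eq_zero.1 h1).resolve_right fun h => by
      change e = 0 at h
      rw [h] at he
      simp at he
    rw [hd, zero_smul, add_zero, smul_eq_zero, or_iff_left hn0] at h
    exact ⟨h, hd⟩)
  refine ⟨.ofDegenerate hs v he ?_ ?_ ?_ ?_ ?_ ?_, B, e, rfl, rfl, he, hv⟩
  · rw [v0]
    simp only [map_sub, map_smul, LinearMap.sub_apply, LinearMap.smul_apply, smul_eq_mul, hyn, hny,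
      hnn]
    ring
  · rw [v0, v1]
    simp [hyn, hnn]
  · rw [v0, v2]
    simp [hyz, hnz]
  · rw [v1, hnn]
  · rw [v1, v2, hnz]
  · rw [v2]

theorem exists_unit_orthogonal (hb : IsSemiBasis b A) (htr : A 0 0 + A 1 1 ≠ 0)
    (hs : ∀ X Y, g X Y = g Y X) (hg : g.Nondegenerate)
    (hnd : ∀ X, traceAd 𝔤 X = 0 → (∀ Y, traceAd 𝔤 Y = 0 → g X Y = 0) → X = 0) :
    g (b 1) (b 1) * g (b 2) (b 2) - g (b 1) (b 2) ^ 2 ≠ 0 ∧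
    ∃ x, g x x * g x x = 1 ∧ (∀ Y, traceAd 𝔤 Y = 0 → g x Y = 0) ∧ traceAd 𝔤 x ≠ 0 := by
  obtain ⟨t0, t1, t2⟩ := hb.traceAd_basis
  have h21 : g (b 2) (b 1) = g (b 1) (b 2) := hs _ _
  have orth : ∀ X, g X (b 1) = 0 → g X (b 2) = 0 → ∀ Y, traceAd 𝔤 Y = 0 → g X Y = 0 := by
    intro X h1 h2 Y hY
    rw [hb.eq_of_traceAd htr hY]
    simp [h1, h2]
  have key : ∀ c d : ℝ, c * g (b 1) (b 1) + d * g (b 1) (b 2) = 0 →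
      c * g (b 1) (b 2) + d * g (b 2) (b 2) = 0 → c = 0 ∧ d = 0 := by
    intro c d h1 h2
    have h0 := hnd (c • b 1 + d • b 2) (by simp [t1, t2])
      (orth _ (by simpa [h21] using h1) (by simpa using h2))
    have e1 := congrArg (fun X => b.repr X 1) h0
    have e2 := congrArg (fun X => b.repr X 2) h0
    simp at e1 e2
    exact ⟨e1, e2⟩
  -- If the determinant vanished, the rows of the adjugate would be in the radical, hence the Gram
  -- matrix would be zero, and `b 1` itself in the radical.
  have hD : g (b 1) (b 1) * g (b 2) (b 2) - g (b 1) (b 2) ^ 2 ≠ 0 := fun h => by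
    obtain ⟨k1, k2⟩ := key (g (b 2) (b 2)) (-g (b 1) (b 2)) (by linear_combination h) (by ring)
    obtain ⟨k3, k4⟩ := key (g (b 1) (b 2)) (-g (b 1) (b 1)) (by ring) (by linear_combination -h)
    have := (key 1 0 (by linear_combination -k4) (by linear_combination k3)).1
    exact one_ne_zero this
  refine ⟨hD, ?_⟩
  set D := g (b 1) (b 1) * g (b 2) (b 2) - g (b 1) (b 2) ^ 2 with hDdef
  -- By Cramer's rule this is `b 0` minus its orthogonal projection to `𝔲`, multiplied by `D` to
  -- clear denominators.
  set x := D • b 0 + (g (b 0) (b 2) * g (b 1) (b 2) - g (b 0) (b 1) * g (b 2) (b 2)) • b 1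
    + (g (b 0) (b 1) * g (b 1) (b 2) - g (b 0) (b 2) * g (b 1) (b 1)) • b 2 with hx
  have x1 : g x (b 1) = 0 := by
    simp only [hx, map_add, map_smul, LinearMap.add_apply, LinearMap.smul_apply, smul_eq_mul, h21,
      hDdef]
    ring
  have x2 : g x (b 2) = 0 := by
    simp only [hx, map_add, map_smul, LinearMap.add_apply, LinearMap.smul_apply, smul_eq_mul,
      hDdef]
    ring
  have tx : traceAd 𝔤 x ≠ 0 := by
    simp only [hx, map_add, map_smul, t0, t1, t2, mul_zero, add_zero, smul_eq_mul]
    exact mul_ne_zero hD htr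
  have hxx : g x x = D * g x (b 0) := by
    conv_lhs => rw [hx, map_add, map_add, map_smul, map_smul, map_smul, ← hx, x1, x2]
    simp
  have hxx0 : g x x ≠ 0 := fun h => by
    rw [hxx, mul_eq_zero, or_iff_right hD] at h
    refine tx ?_
    rw [eq_zero_of_basis hg b (X := x) (by
      intro i
      fin_cases i
      exacts [h, x1, x2]), map_zero]
  obtain ⟨c, hc, he⟩ := exists_smul_unit hxx0
  refine ⟨c • x, he, fun Y hY => ?_, ?_⟩
  · rw [map_smul, LinearMap.smul_apply, orth x x1 x2 Y hY, smul_zero]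
  · rw [map_smul, smul_eq_mul]
    exact mul_ne_zero hc tx

/-- The vector `v` will be the one in the kernel of `F`, so that `q = 0` in the frame. Within `𝔲` it
is completed to a hyperbolic pair if it is null, and otherwise by an orthogonal vector. -/
theorem exists_nondegenerate_frame (h3 : Module.finrank ℝ 𝔤 = 3) (hb : IsSemiBasis b A)
    (htr : A 0 0 + A 1 1 ≠ 0) (hs : ∀ X Y, g X Y = g Y X) (hg : g.Nondegenerate)
    (hnd : ∀ X, traceAd 𝔤 X = 0 → (∀ Y, traceAd 𝔤 Y = 0 → g X Y = 0) → X = 0) {v : 𝔤}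
    (hv : traceAd 𝔤 v = 0) (hv0 : v ≠ 0) :
    ∃ (f : GramFrame g) (B : Matrix (Fin 2) (Fin 2) ℝ) (k : ℝ), IsSemiBasis f.b B ∧
      B 0 0 + B 1 1 ≠ 0 ∧ f.b 2 = k • v ∧
      ((∃ e₀ e₁ e₂ : ℝ, e₀ * e₀ = 1 ∧ e₁ * e₁ = 1 ∧ e₂ * e₂ = 1 ∧ f.σ = ![0, 1, 2] ∧
          f.s = ![e₀, e₁, e₂]) ∨
        ∃ e₀ : ℝ, e₀ * e₀ = 1 ∧ f.σ = ![0, 2, 1] ∧ f.s = ![e₀, 1, 1]) := by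
  obtain ⟨t0, t1, t2⟩ := hb.traceAd_basis
  obtain ⟨hD, x, hx, hxo, htx⟩ := exists_unit_orthogonal hb htr hs hg hnd
  have h21 : g (b 2) (b 1) = g (b 1) (b 2) := hs _ _
  have ne : ∀ {e : ℝ}, e * e = 1 → e ≠ 0 := fun h h0 => by simp [h0] at h
  by_cases hvv : g v v = 0
  · obtain ⟨w, hw, hvw⟩ : ∃ w, traceAd 𝔤 w = 0 ∧ g v w ≠ 0 := by
      by_contra! hc
      exact hv0 (hnd v hv hc)
    have hwv : g w v = g v w := hs _ _
    set y := (g v w)⁻¹ • w - (1 / 2 * ((g v w)⁻¹ * (g v w)⁻¹ * g w w)) • v with hy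
    have ty : traceAd 𝔤 y = 0 := by simp [hy, hw, hv]
    have hyv : g y v = 1 := by
      simp [hy, hvv, hwv, hvw]
    have hvy : g v y = 1 := by rw [hs, hyv]
    have hyy : g y y = 0 := by
      simp only [hy, map_sub, map_smul, LinearMap.sub_apply, LinearMap.smul_apply, smul_eq_mul,
        hvv, hwv]
      field_simp
      ring
    obtain ⟨v', B, v0, v1, v2, hB, hBtr⟩ := exists_isSemiBasis_of_mem h3 htx ty hv (by
      intro c d h
      have h1 := congrArg (fun X => g X v) h
      have h2 := congrArg (fun X => g X y) h
      simp only [map_add, map_smul, LinearMap.add_apply, LinearMap.smul_apply, smul_eq_mul, hyv,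
        hvv, hvy, hyy, mul_zero, mul_one, zero_add, add_zero, map_zero,
        LinearMap.zero_apply] at h1 h2
      exact ⟨h1, h2⟩)
    refine ⟨.ofNull hs v' hx ?_ ?_ ?_ ?_ ?_ ?_, B, 1, hB, hBtr, by rw [one_smul]; exact v2,
      Or.inr ⟨_, hx, rfl, rfl⟩⟩
    · rw [v0]
    · rw [v0, v1, hxo y ty]
    · rw [v0, v2, hxo v hv]
    · rw [v1, hyy]
    · rw [v1, v2, hyv]
    · rw [v2, hvv]
  -- The vector orthogonal to `v` in `𝔲`; its square is the Gram determinant times `g v v`.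
  · set w := g v (b 2) • b 1 - g v (b 1) • b 2 with hw
    have tw : traceAd 𝔤 w = 0 := by simp [hw, t1, t2]
    have ev := hb.eq_of_traceAd htr hv
    set α := b.repr v 1
    set β := b.repr v 2
    have g1 : g v (b 1) = α * g (b 1) (b 1) + β * g (b 1) (b 2) := by
      conv_lhs => rw [ev]
      simp [h21]
    have g2 : g v (b 2) = α * g (b 1) (b 2) + β * g (b 2) (b 2) := by
      conv_lhs => rw [ev]
      simp
    have gv : g v v = α * g v (b 1) + β * g v (b 2) := by
      conv_lhs => enter [2]; rw [ev]
      simp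
    have hww : g w w ≠ 0 := by
      have : g w w = (g (b 1) (b 1) * g (b 2) (b 2) - g (b 1) (b 2) ^ 2) * g v v := by
        rw [gv]
        simp only [hw, map_sub, map_smul, LinearMap.sub_apply, LinearMap.smul_apply, smul_eq_mul,
          h21, g1, g2]
        ring
      rw [this]
      exact mul_ne_zero hD hvv
    have hvw : g v w = 0 := by
      simp only [hw, map_sub, map_smul, smul_eq_mul]
      ring
    obtain ⟨c, -, hc⟩ := exists_smul_unit hvv
    obtain ⟨d, -, hd⟩ := exists_smul_unit hww
    have hz : traceAd 𝔤 (c • v) = 0 := by rw [map_smul, hv, smul_zero]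
    have hy : traceAd 𝔤 (d • w) = 0 := by rw [map_smul, tw, smul_zero]
    have hzy : g (c • v) (d • w) = 0 := by simp [hvw]
    have hyz : g (d • w) (c • v) = 0 := by rw [hs, hzy]
    obtain ⟨v', B, v0, v1, v2, hB, hBtr⟩ := exists_isSemiBasis_of_mem h3 htx hy hz (by
      intro i j h
      have h1 := congrArg (fun X => g X (d • w)) h
      have h2 := congrArg (fun X => g X (c • v)) h
      rw [map_add, map_smul g i, map_smul g j, LinearMap.add_apply, LinearMap.smul_apply,
        LinearMap.smul_apply, map_zero, LinearMap.zero_apply, smul_eq_mul, smul_eq_mul] at h1 h2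
      rw [hzy, mul_zero, add_zero] at h1
      rw [hyz, mul_zero, zero_add] at h2
      exact ⟨(mul_eq_zero.1 h1).resolve_right (ne hd), (mul_eq_zero.1 h2).resolve_right (ne hc)⟩)
    refine ⟨.ofOrth hs v' hx hd hc ?_ ?_ ?_ ?_ ?_ ?_, B, c, hB, hBtr, v2,
      Or.inl ⟨_, _, _, hx, hd, hc, rfl, rfl⟩⟩
    · rw [v0]
    · rw [v0, v1, hxo _ hy]
    · rw [v0, v2, hxo _ hz]
    · rw [v1]
    · rw [v1, v2, hyz]
    · rw [v2]

end Frames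

/-! ### Closed two-forms -/

section ClosedForms

variable {G : Type*} [TopologicalSpace G] [ChartedSpace E3 G] [Group G] [LieGroup (𝓡 3) ∞ G]
  {H : InvForm G 3} {F : InvForm G 2} {A : Matrix (Fin 2) (Fin 2) ℝ}
  {b : Module.Basis (Fin 3) ℝ (LieAlg G)}

/-- Evaluating `dF = 0` on `b₀, b₁, b₂` gives `tr A * F(b₁, b₂) = 0`. -/
theorem IsSemiBasis.closed_apply (hb : IsSemiBasis b A) (htr : A 0 0 + A 1 1 ≠ 0)
    (hF : IsClosedForm F) : bilinOfForm F (b 1) (b 2) = 0 := by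
  have h := hF (b 0) (b 1) (b 2)
  change bilinOfForm F ⁅b 0, b 1⁆ (b 2) + bilinOfForm F ⁅b 1, b 2⁆ (b 0)
    + bilinOfForm F ⁅b 2, b 0⁆ (b 1) = 0 at h
  have h0 : ∀ X, bilinOfForm F X X = 0 := fun X => by linarith [bilinOfForm_swap F X X]
  rw [hb.lie01, hb.lie12, ← lie_skew (b 2), hb.lie02] at h
  simp only [map_add, map_smul, map_neg, map_zero, LinearMap.add_apply, LinearMap.smul_apply,
    LinearMap.neg_apply, LinearMap.zero_apply, smul_eq_mul, h0,
    bilinOfForm_swap F (b 2) (b 1)] at h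
  refine (mul_eq_zero.1 ?_).resolve_left htr
  linear_combination h

theorem IsSemiBasis.isAdapted_of_closed (hb : IsSemiBasis b A) (htr : A 0 0 + A 1 1 ≠ 0)
    (hF : IsClosedForm F) : IsAdapted b (lieBil G) H F A (bilinOfForm F (b 0) (b 1))
      (bilinOfForm F (b 0) (b 2)) (trilinOfForm H (b 0) (b 1) (b 2)) :=
  ⟨hb.lie01, hb.lie02, hb.lie12, rfl, rfl, hb.closed_apply htr hF, rfl⟩

theorem IsSemiBasis.form_ne_zero (hb : IsSemiBasis b A) (htr : A 0 0 + A 1 1 ≠ 0)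
    (hF : IsClosedForm F) (h0 : F ≠ 0) (h2 : bilinOfForm F (b 0) (b 2) = 0) :
    bilinOfForm F (b 0) (b 1) ≠ 0 := by
  intro h1
  have h12 := hb.closed_apply htr hF
  have hs : ∀ X, bilinOfForm F X X = 0 := fun X => by linarith [bilinOfForm_swap F X X]
  have hB : bilinOfForm F = 0 := by
    refine LinearMap.BilinForm.ext_basis b fun i j => ?_
    fin_cases i <;> fin_cases j <;>
      simp [h1, h2, h12, hs, bilinOfForm_swap F (b 1) (b 0), bilinOfForm_swap F (b 2) (b 0),
        bilinOfForm_swap F (b 2) (b 1)]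
  refine h0 (AlternatingMap.ext fun v => ?_)
  have := LinearMap.congr_fun₂ hB (v 0) (v 1)
  rw [show v = ![v 0, v 1] by ext i; fin_cases i <;> rfl]
  exact this

end ClosedForms

/-! ### Assembling the classification. -/

section Main

variable {G : Type*} [TopologicalSpace G] [ChartedSpace E3 G] [Group G] [LieGroup (𝓡 3) ∞ G]
  {A : Matrix (Fin 2) (Fin 2) ℝ} {b : Module.Basis (Fin 3) ℝ (LieAlg G)}
  {g : LinearMap.BilinForm ℝ (LieAlg G)} {H : InvForm G 3} {F : InvForm G 2}
  {δ : Module.Dual ℝ (Fib (1 : G))}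

theorem hasLieAlg_iff (A : Matrix (Fin 2) (Fin 2) ℝ) :
    HasLieAlg G (SemiDir A) ↔ ∃ b : Module.Basis (Fin 3) ℝ (LieAlg G), IsSemiBasis b A :=
  nonempty_lieEquiv_iff A

theorem unimodKernel_eq : unimodKernel G = LinearMap.ker (traceAd (LieAlg G)) := rfl

theorem mem_unimodKernel {X : LieAlg G} : X ∈ unimodKernel G ↔ traceAd (LieAlg G) X = 0 := by
  rw [unimodKernel_eq, LinearMap.mem_ker]

theorem exists_isSemiBasis_lieAlg (hG : unimodKernel G ≠ ⊤) :
    ∃ (b : Module.Basis (Fin 3) ℝ (LieAlg G)) (A : Matrix (Fin 2) (Fin 2) ℝ),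
      IsSemiBasis b A ∧ A 0 0 + A 1 1 ≠ 0 := by
  rw [unimodKernel_eq] at hG
  exact exists_isSemiBasis finrank_lieAlg hG

/-! ### Metrics with degenerate restriction to the unimodular kernel -/

theorem forall_fin_three_of {P : Fin 3 → Prop} (h0 : P 0) (h1 : P 1) (h2 : P 2) : ∀ i, P i :=
  forall_fin_three.2 ⟨h0, h1, h2⟩

/-- If `b₁` spans an ideal, then solutions of the frame equations with first divergence
component `t` exist for every `t` with `a² + d² + a t > 0`. -/
theorem IsSemiBasis.exists_degenerate (hb : IsSemiBasis b A) (htr : A 0 0 + A 1 1 ≠ 0)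
    (hc : A 1 0 = 0) {t : ℝ} (ht : 0 < A 0 0 ^ 2 + A 1 1 ^ 2 + A 0 0 * t) :
    ∃ (H : InvForm G 3) (F : InvForm G 2) (g : LinearMap.BilinForm ℝ (LieAlg G))
        (δ : Module.Dual ℝ (Fib (1 : G))),
        F ≠ 0 ∧ IsOddEinstein H F g δ ∧ ¬ NondegOnKernel g ∧ (δ = 0 ↔ t = 0) := by
  have hA : A = !![A 0 0, A 0 1; 0, A 1 1] := by
    rw [← hc]
    exact Matrix.eta_fin_two A
  have hR := frameRicciFlat_deg₂ (b := A 0 1) (Real.sq_sqrt ht.le)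
  rw [← hA] at hR
  have hs : ∀ i, (![1, 1, -1] : Fin 3 → ℝ) (![1, 0, 2] i) = ![1, 1, -1] i :=
    forall_fin_three_of rfl rfl rfl
  obtain ⟨hg, hE⟩ := hb.isOddEinstein (by decide) hs
    (forall_fin_three_of (by simp) (by simp) (by simp)) hR
  refine ⟨_, _, _, _, twoForm_ne_zero b (Or.inr (Real.sqrt_pos.2 ht).ne'), hE,
    not_nondegOnKernel_gramForm hb htr _ hs, ?_⟩
  constructor
  · intro h
    by_contra h0
    exact divForm_ne_zero b hg (i := 0) (by simpa using h0) h
  · rintro rfl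
    rw [show (![0, 0, 0] : Fin 3 → ℝ) = 0 by ext i; fin_cases i <;> rfl]
    exact divForm_zero b hg

/-- Existence in the case of a cyclic vector. -/
theorem IsSemiBasis.exists_degenerate_companion {e d : ℝ} (hb : IsSemiBasis b !![0, e; 1, d])
    (hd : d ≠ 0) :
    ∃ (H : InvForm G 3) (F : InvForm G 2) (g : LinearMap.BilinForm ℝ (LieAlg G))
        (δ : Module.Dual ℝ (Fib (1 : G))),
        F ≠ 0 ∧ IsOddEinstein H F g δ ∧ ¬ NondegOnKernel g := by
  have hs : ∀ i, (![1, 1, -1] : Fin 3 → ℝ) (![1, 0, 2] i) = ![1, 1, -1] i :=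
    forall_fin_three_of rfl rfl rfl
  obtain ⟨hg, hE⟩ := hb.isOddEinstein (by decide) hs
    (forall_fin_three_of (by simp) (by simp) (by simp)) (frameRicciFlat_deg₁ e d)
  exact ⟨_, _, _, _, twoForm_ne_zero b (Or.inr hd), hE,
    not_nondegOnKernel_gramForm hb (by simpa using hd) _ hs⟩

theorem exists_degenerate_einstein (hG : unimodKernel G ≠ ⊤) :
    ∃ (H : InvForm G 3) (F : InvForm G 2) (g : LinearMap.BilinForm ℝ (LieAlg G))
        (δ : Module.Dual ℝ (Fib (1 : G))),
        F ≠ 0 ∧ IsOddEinstein H F g δ ∧ ¬ NondegOnKernel g := by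
  obtain ⟨b, A, hb, htr⟩ := exists_isSemiBasis_lieAlg hG
  by_cases hc : A 1 0 = 0
  · have : 0 < A 0 0 ^ 2 + A 1 1 ^ 2 + A 0 0 * 0 := by
      by_contra! h
      refine htr ?_
      rw [show A 0 0 = 0 by nlinarith [sq_nonneg (A 0 0), sq_nonneg (A 1 1)],
        show A 1 1 = 0 by nlinarith [sq_nonneg (A 0 0), sq_nonneg (A 1 1)], add_zero]
    obtain ⟨H, F, g, δ, h1, h2, h3, -⟩ := hb.exists_degenerate htr hc this
    exact ⟨H, F, g, δ, h1, h2, h3⟩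
  -- Now `b₁` and `A b₁` form a basis of `𝔲`, in which `A` is a companion matrix by Cayley-Hamilton.
  · obtain ⟨b', hb'⟩ := hb.change (P := !![1, A 0 0; 0, A 1 0])
      (B := !![0, -(A 0 0 * A 1 1 - A 0 1 * A 1 0); 1, A 0 0 + A 1 1]) one_ne_zero
      (by simpa [Matrix.det_fin_two] using hc) (by
        ext i j
        fin_cases i <;> fin_cases j <;> simp [Matrix.mul_apply, Fin.sum_univ_two] <;> ring)
    exact hb'.exists_degenerate_companion htr

theorem exists_isSemiBasis_triangular (h : HasLieAlg G Tau2R ∨ HasLieAlg G Tau3 ∨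
    ∃ l : ℝ, l ≠ -1 ∧ 0 < |l| ∧ |l| ≤ 1 ∧ HasLieAlg G (Tau3p l)) :
    ∃ (b : Module.Basis (Fin 3) ℝ (LieAlg G)) (A : Matrix (Fin 2) (Fin 2) ℝ), IsSemiBasis b A ∧
      A 0 0 + A 1 1 ≠ 0 ∧ A 1 0 = 0 ∧ A 0 0 = 1 := by
  rcases h with h | h | ⟨l, hl, -, -, h⟩
  · obtain ⟨b, hb⟩ := (hasLieAlg_iff _).1 h
    exact ⟨b, _, hb, by simp, rfl, rfl⟩
  · obtain ⟨b, hb⟩ := (hasLieAlg_iff _).1 h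
    exact ⟨b, _, hb, by norm_num, rfl, rfl⟩
  · obtain ⟨b, hb⟩ := (hasLieAlg_iff _).1 h
    exact ⟨b, _, hb, fun h0 => hl (by simp at h0; linarith), rfl, rfl⟩

theorem exists_frame_of_not_nondegOnKernel (hG : unimodKernel G ≠ ⊤) (hE : IsOddEinstein H F g δ)
    (hd : ¬ NondegOnKernel g) :
    ∃ (f : GramFrame g) (B : Matrix (Fin 2) (Fin 2) ℝ) (e : ℝ), f.σ = ![1, 0, 2] ∧
      f.s = ![1, 1, e] ∧ e * e = 1 ∧ IsSemiBasis f.b B ∧ B 0 0 + B 1 1 ≠ 0 := by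
  obtain ⟨b, A, hb, htr⟩ := exists_isSemiBasis_lieAlg hG
  rw [nondegOnKernel_iff hE.symm] at hd
  simp only [mem_unimodKernel] at hd
  push Not at hd
  obtain ⟨n, hn, hno, hn0⟩ := hd
  have h3 : Module.finrank ℝ (LieAlg G) = 3 := finrank_lieAlg
  have hs := hE.symm
  have hg := hE.nondegenerate
  exact exists_degenerate_frame h3 hb htr hs hg hn hn0 hno

/-- A divergence-free metric with degenerate restriction to the unimodular kernel yields a common
eigenvector of the adjoint action in the unimodular kernel. -/
theorem exists_eigenvector (hG : unimodKernel G ≠ ⊤) (hE : IsOddEinstein H F g 0)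
    (hd : ¬ NondegOnKernel g) : ∃ (X Y : LieAlg G) (c : ℝ), traceAd (LieAlg G) X ≠ 0 ∧
      traceAd (LieAlg G) Y = 0 ∧ Y ≠ 0 ∧ ⁅X, Y⁆ = c • Y := by
  obtain ⟨f, B, e, hσ, hs, he, hB, htr⟩ := exists_frame_of_not_nondegOnKernel hG hE hd
  have hR := ((isOddEinstein_frame_iff f hE.symm (hB.isAdapted_of_closed htr hE.closed)).1 hE).2
  rw [hσ, hs, Matrix.eta_fin_two B] at hR
  have hc : B 1 0 = 0 := eigenvector_of_frameRicciFlat hR htr he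
  obtain ⟨t0, t1, -⟩ := hB.traceAd_basis
  refine ⟨f.b 0, f.b 1, B 0 0, by rwa [t0], t1, f.b.ne_zero 1, ?_⟩
  rw [hB.lie01, hc, zero_smul, add_zero]

/-- On `𝔲`, `ad X` is a non-zero multiple of `A`, whose eigenvalues `l ± i` are not real. -/
theorem not_exists_eigenvector {l : ℝ} (hl : l ≠ 0) (h : HasLieAlg G (Tau3p' l)) {X Y : LieAlg G}
    {c : ℝ} (hX : traceAd (LieAlg G) X ≠ 0) (hY : traceAd (LieAlg G) Y = 0)
    (h0 : ⁅X, Y⁆ = c • Y) : Y = 0 := by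
  obtain ⟨b, hb⟩ := (hasLieAlg_iff _).1 h
  have htr : (!![l, -1; 1, l] : Matrix (Fin 2) (Fin 2) ℝ) 0 0 + !![l, -1; 1, l] 1 1 ≠ 0 := by
    simpa using hl
  have hX0 : b.repr X 0 ≠ 0 := fun h => hX ((hb.mem_ker_iff htr X).2 h)
  have hY0 : b.repr Y 0 = 0 := (hb.mem_ker_iff htr Y).1 hY
  rw [hb.lie_eq] at h0
  have h1 := congrArg (fun Z => b.repr Z 1) h0
  have h2 := congrArg (fun Z => b.repr Z 2) h0
  simp [hY0] at h1 h2
  -- Pairing with `Y` rotated by a right angle eliminates both `l` and `c`.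
  have h3 : b.repr X 0 * (b.repr Y 1 ^ 2 + b.repr Y 2 ^ 2) = 0 := by
    linear_combination b.repr Y 1 * h2 - b.repr Y 2 * h1
  have h4 := (mul_eq_zero.1 h3).resolve_left hX0
  refine b.ext_elem fun i => ?_
  rw [map_zero]
  fin_cases i
  · exact hY0
  · change b.repr Y 1 = 0
    nlinarith [sq_nonneg (b.repr Y 1), sq_nonneg (b.repr Y 2)]
  · change b.repr Y 2 = 0
    nlinarith [sq_nonneg (b.repr Y 1), sq_nonneg (b.repr Y 2)]

/-! ### Metrics with non-degenerate restriction to the unimodular kernel -/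

/-- The columns of `P` are an eigenvector for `a` and a kernel vector; `s` normalizes the eigenvalue
to `1`. -/
theorem IsSemiBasis.hasLieAlg_tau2R {a c : ℝ} (hb : IsSemiBasis b !![a, 0; c, 0]) (ha : a ≠ 0) :
    HasLieAlg G Tau2R :=
  (hasLieAlg_iff _).2 (hb.change (P := !![a, 0; c, 1]) (s := a⁻¹) (inv_ne_zero ha)
    (by simpa [Matrix.det_fin_two] using ha) (by
      ext i j
      fin_cases i <;> fin_cases j <;> simp [Matrix.mul_apply, Fin.sum_univ_two] <;> field_simp))

/-- The columns of `P` are eigenvectors for `2a` and `a`, in the order giving the ratio `1 / 2`. -/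
theorem IsSemiBasis.hasLieAlg_tau3p_half {a e : ℝ} (hb : IsSemiBasis b !![a, e; 0, 2 * a])
    (ha : a ≠ 0) : HasLieAlg G (Tau3p (1 / 2)) :=
  (hasLieAlg_iff _).2 (hb.change (P := !![e, 1; a, 0]) (s := (2 * a)⁻¹) (by simpa using ha)
    (by simpa [Matrix.det_fin_two] using ha) (by
      ext i j
      fin_cases i <;> fin_cases j <;> simp [Matrix.mul_apply, Fin.sum_univ_two] <;> field_simp
      <;> ring))

/-- The columns of `P` are eigenvectors for `-2a` and `a`. -/
theorem IsSemiBasis.hasLieAlg_tau3p_neg_half {a c : ℝ} (hb : IsSemiBasis b !![a, 0; c, -2 * a])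
    (ha : a ≠ 0) : HasLieAlg G (Tau3p (-1 / 2)) :=
  (hasLieAlg_iff _).2 (hb.change (P := !![0, 3 * a; 1, c]) (s := (-2 * a)⁻¹) (by simpa using ha)
    (by simpa [Matrix.det_fin_two] using ha) (by
      ext i j
      fin_cases i <;> fin_cases j <;> simp [Matrix.mul_apply, Fin.sum_univ_two] <;> field_simp
      <;> ring))

/-- As `F` vanishes on `𝔲`, it is the product of the coordinate form of `b₀` with a form `φ` on `𝔲`;
the kernel of `φ` is spanned by the vector with the rotated coefficients. -/
theorem IsSemiBasis.exists_kernel_vector (hb : IsSemiBasis b A) (htr : A 0 0 + A 1 1 ≠ 0)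
    (hF : F ≠ 0) (hFc : IsClosedForm F) :
    ∃ v : LieAlg G, traceAd (LieAlg G) v = 0 ∧ v ≠ 0 ∧ ∀ X, bilinOfForm F X v = 0 := by
  obtain ⟨-, t1, t2⟩ := hb.traceAd_basis
  set v := bilinOfForm F (b 0) (b 2) • b 1 - bilinOfForm F (b 0) (b 1) • b 2 with hv
  have tv : traceAd (LieAlg G) v = 0 := by simp [hv, t1, t2]
  have hv0 : v ≠ 0 := fun h => by
    have h1 := congrArg (fun X => b.repr X 1) h
    have h2 := congrArg (fun X => b.repr X 2) h
    simp [hv] at h1 h2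
    exact hb.form_ne_zero htr hFc hF h1 h2
  have hFv : ∀ X, bilinOfForm F X v = 0 := fun X => by
    have h12 := hb.closed_apply htr hFc
    have hs : ∀ X, bilinOfForm F X X = 0 := fun X => by linarith [bilinOfForm_swap F X X]
    rw [← b.sum_repr X, Fin.sum_univ_three, hv]
    simp only [map_add, map_sub, map_smul, LinearMap.add_apply, LinearMap.smul_apply, smul_eq_mul,
      h12, hs, bilinOfForm_swap F (b 2) (b 1)]
    ring
  exact ⟨v, tv, hv0, hFv⟩

theorem exists_frame_of_nondegOnKernel (hG : unimodKernel G ≠ ⊤) (hF : F ≠ 0)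
    (hE : IsOddEinstein H F g δ) (hd : NondegOnKernel g) :
    ∃ (f : GramFrame g) (B : Matrix (Fin 2) (Fin 2) ℝ), IsSemiBasis f.b B ∧
      B 0 0 + B 1 1 ≠ 0 ∧ bilinOfForm F (f.b 0) (f.b 2) = 0 ∧
      ((∃ e₀ e₁ e₂ : ℝ, e₀ * e₀ = 1 ∧ e₁ * e₁ = 1 ∧ e₂ * e₂ = 1 ∧ f.σ = ![0, 1, 2] ∧
          f.s = ![e₀, e₁, e₂]) ∨
        ∃ e₀ : ℝ, e₀ * e₀ = 1 ∧ f.σ = ![0, 2, 1] ∧ f.s = ![e₀, 1, 1]) := by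
  obtain ⟨b, A, hb, htr⟩ := exists_isSemiBasis_lieAlg hG
  rw [nondegOnKernel_iff hE.symm] at hd
  simp only [mem_unimodKernel] at hd
  obtain ⟨v, tv, hv0, hFv⟩ := hb.exists_kernel_vector htr hF hE.closed
  have h3 : Module.finrank ℝ (LieAlg G) = 3 := finrank_lieAlg
  have hs := hE.symm
  have hg := hE.nondegenerate
  obtain ⟨f, B, k, hB, hBtr, hk, hf⟩ := exists_nondegenerate_frame h3 hb htr hs hg hd tv hv0
  exact ⟨f, B, hB, hBtr, by rw [hk, map_smul, hFv, smul_zero], hf⟩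

theorem hasLieAlg_of_nondegOnKernel (hG : unimodKernel G ≠ ⊤) (hF : F ≠ 0)
    (hE : IsOddEinstein H F g δ) (hd : NondegOnKernel g) :
    (HasLieAlg G Tau2R ∨ HasLieAlg G (Tau3p (1 / 2)) ∨ HasLieAlg G (Tau3p (-1 / 2))) ∧ δ ≠ 0 := by
  obtain ⟨f, B, hB, hBtr, hq, hf⟩ := exists_frame_of_nondegOnKernel hG hF hE hd
  have hp := hB.form_ne_zero hBtr hE.closed hF hq
  have hR := ((isOddEinstein_frame_iff f hE.symm
    (hB.isAdapted_of_closed hBtr hE.closed)).1 hE).2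
  have hδ : (δ (plusMap g (f.b 0, 0)) ≠ 0) → δ ≠ 0 := by
    rintro h rfl
    exact h rfl
  rw [hq, Matrix.eta_fin_two B] at hR
  rw [Matrix.eta_fin_two B] at hB
  rcases hf with ⟨e₀, e₁, e₂, h₀, h₁, h₂, hσ, hs⟩ | ⟨e₀, h₀, hσ, hs⟩
  · rw [hσ, hs] at hR
    obtain ⟨h | h, hu⟩ := cases_of_frameRicciFlat_orth h₀ h₁ h₂ hR hBtr hp
    · rw [h.1, h.2] at hB
      refine ⟨Or.inl (hB.hasLieAlg_tau2R ?_), hδ hu⟩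
      rwa [h.2, add_zero] at hBtr
    · rw [h.1, h.2.1] at hB
      refine ⟨Or.inr (Or.inl (hB.hasLieAlg_tau3p_half fun h0 => hBtr ?_)), hδ hu⟩
      rw [h.2.1, h0, mul_zero, add_zero]
  · rw [hσ, hs] at hR
    obtain ⟨hb0, ha, h | h, hu⟩ := cases_of_frameRicciFlat_null h₀ hR hBtr hp
    · rw [hb0, h] at hB
      exact ⟨Or.inl (hB.hasLieAlg_tau2R ha), hδ hu⟩
    · rw [hb0, h] at hB
      exact ⟨Or.inr (Or.inr (hB.hasLieAlg_tau3p_neg_half ha)), hδ hu⟩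

theorem IsSemiBasis.exists_nondegenerate (hb : IsSemiBasis b A) (htr : A 0 0 + A 1 1 ≠ 0)
    {σ : Fin 3 → Fin 3} {s : Fin 3 → ℝ} (hσ : ∀ i, σ (σ i) = i) (h0 : σ 0 = 0)
    (hs : ∀ i, s (σ i) = s i) (hsq : ∀ i, s i * s i = 1) {p q h : ℝ} (hp : p ≠ 0)
    {u m : Fin 3 → ℝ} {r : ℝ} (hR : FrameRicciFlat A σ s p q h u m r) :
    ∃ (H : InvForm G 3) (F : InvForm G 2) (g : LinearMap.BilinForm ℝ (LieAlg G))
        (δ : Module.Dual ℝ (Fib (1 : G))),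
        F ≠ 0 ∧ IsOddEinstein H F g δ ∧ NondegOnKernel g := by
  obtain ⟨hg, hE⟩ := hb.isOddEinstein hσ hs hsq hR
  exact ⟨_, _, _, _, twoForm_ne_zero b (Or.inl hp), hE,
    nondegOnKernel_gramForm hb htr hσ h0 hs hsq⟩

theorem exists_nondegenerate_einstein
    (h : HasLieAlg G Tau2R ∨ HasLieAlg G (Tau3p (1 / 2)) ∨ HasLieAlg G (Tau3p (-1 / 2))) :
    ∃ (H : InvForm G 3) (F : InvForm G 2) (g : LinearMap.BilinForm ℝ (LieAlg G))
        (δ : Module.Dual ℝ (Fib (1 : G))),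
        F ≠ 0 ∧ IsOddEinstein H F g δ ∧ NondegOnKernel g := by
  rcases h with h | h | h
  · obtain ⟨b, hb⟩ := (hasLieAlg_iff _).1 h
    exact hb.exists_nondegenerate (by simp) (by decide) rfl (forall_fin_three_of rfl rfl rfl)
      (forall_fin_three_of (by simp) (by simp) (by simp)) one_ne_zero frameRicciFlat_tau2
  · obtain ⟨b, hb⟩ := (hasLieAlg_iff _).1 h
    -- The diagonal form of `A` does not fit, since `b² = 4a²` calls for an off-diagonal entry.
    obtain ⟨b', hb'⟩ := hb.change (P := !![0, 1; 1, -2]) (B := !![1 / 2, 1; 0, 1]) one_ne_zero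
      (by simp [Matrix.det_fin_two]) (by
        ext i j
        fin_cases i <;> fin_cases j <;> norm_num [Matrix.mul_apply, Fin.sum_univ_two])
    have hp : √(3 / 4) ^ 2 = (3 / 4 : ℝ) := Real.sq_sqrt (by norm_num)
    exact hb'.exists_nondegenerate (by norm_num) (by decide) rfl (forall_fin_three_of rfl rfl rfl)
      (forall_fin_three_of (by simp) (by simp) (by simp)) (Real.sqrt_pos.2 (by norm_num)).ne'
      (frameRicciFlat_tau3_half hp)
  · obtain ⟨b, hb⟩ := (hasLieAlg_iff _).1 h
    -- Doubling `b₀` turns the eigenvalues `1, -1 / 2` into `2, -1`, those of the matrix in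
    -- `frameRicciFlat_tau3_neg_half`.
    obtain ⟨b', hb'⟩ := hb.change (P := !![2 / 3, 1; 1, 0]) (B := !![-1, 0; 2, 2]) two_ne_zero
      (by simp [Matrix.det_fin_two]) (by
        ext i j
        fin_cases i <;> fin_cases j <;> norm_num [Matrix.mul_apply, Fin.sum_univ_two])
    exact hb'.exists_nondegenerate (by norm_num) (by decide) rfl (forall_fin_three_of rfl rfl rfl)
      (forall_fin_three_of (by simp) (by simp) (by simp)) two_ne_zero frameRicciFlat_tau3_neg_half

end Main

end OddGen

theorem theorem1p2 {G : Type*} [TopologicalSpace G] [ChartedSpace E3 G] [Group G]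
    [LieGroup (𝓡 3) ∞ G] (hG : unimodKernel G ≠ ⊤) :
    -- (i) metrics with degenerate restriction to the unimodular kernel
    (∃ (H : InvForm G 3) (F : InvForm G 2) (g : LinearMap.BilinForm ℝ (LieAlg G))
        (δ : Module.Dual ℝ (Fib (1 : G))),
        F ≠ 0 ∧ IsOddEinstein H F g δ ∧ ¬ NondegOnKernel g) ∧
    ((HasLieAlg G Tau2R ∨ HasLieAlg G Tau3 ∨
        ∃ l : ℝ, l ≠ -1 ∧ 0 < |l| ∧ |l| ≤ 1 ∧ HasLieAlg G (Tau3p l)) →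
      (∃ (H : InvForm G 3) (F : InvForm G 2) (g : LinearMap.BilinForm ℝ (LieAlg G))
        (δ : Module.Dual ℝ (Fib (1 : G))),
        F ≠ 0 ∧ IsOddEinstein H F g δ ∧ ¬ NondegOnKernel g ∧ δ = 0) ∧
      (∃ (H : InvForm G 3) (F : InvForm G 2) (g : LinearMap.BilinForm ℝ (LieAlg G))
        (δ : Module.Dual ℝ (Fib (1 : G))),
        F ≠ 0 ∧ IsOddEinstein H F g δ ∧ ¬ NondegOnKernel g ∧ δ ≠ 0)) ∧
    ((∃ l : ℝ, l ≠ 0 ∧ HasLieAlg G (Tau3p' l)) →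
      ∀ (H : InvForm G 3) (F : InvForm G 2) (g : LinearMap.BilinForm ℝ (LieAlg G))
        (δ : Module.Dual ℝ (Fib (1 : G))),
        F ≠ 0 → IsOddEinstein H F g δ → ¬ NondegOnKernel g → δ ≠ 0) ∧
    -- (ii) metrics with non-degenerate restriction to the unimodular kernel
    ((∃ (H : InvForm G 3) (F : InvForm G 2) (g : LinearMap.BilinForm ℝ (LieAlg G))
        (δ : Module.Dual ℝ (Fib (1 : G))),
        F ≠ 0 ∧ IsOddEinstein H F g δ ∧ NondegOnKernel g) ↔
      (HasLieAlg G Tau2R ∨ HasLieAlg G (Tau3p (1 / 2)) ∨ HasLieAlg G (Tau3p (-1 / 2)))) ∧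
    (∀ (H : InvForm G 3) (F : InvForm G 2) (g : LinearMap.BilinForm ℝ (LieAlg G))
        (δ : Module.Dual ℝ (Fib (1 : G))),
        F ≠ 0 → IsOddEinstein H F g δ → NondegOnKernel g → δ ≠ 0) := by
  refine ⟨exists_degenerate_einstein hG, fun h => ?_, ?_, ⟨?_, exists_nondegenerate_einstein⟩,
    fun H F g δ hF hE hd => (hasLieAlg_of_nondegOnKernel hG hF hE hd).2⟩
  · obtain ⟨b, A, hb, htr, hc, ha⟩ := exists_isSemiBasis_triangular h
    constructor
    -- Since `A 0 0 = 1`, the quantity required to be positive is `1 + d² + t`; `t = 0` and `t = 1`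
    -- serve the two claims.
    · obtain ⟨H, F, g, δ, hF, hE, hd, hδ⟩ := hb.exists_degenerate htr hc (t := 0)
        (by rw [ha]; positivity)
      exact ⟨H, F, g, δ, hF, hE, hd, hδ.2 rfl⟩
    · obtain ⟨H, F, g, δ, hF, hE, hd, hδ⟩ := hb.exists_degenerate htr hc (t := 1)
        (by rw [ha]; positivity)
      exact ⟨H, F, g, δ, hF, hE, hd, fun h => one_ne_zero (hδ.1 h)⟩
  · rintro ⟨l, hl, h⟩ H F g δ - hE hd rfl
    obtain ⟨X, Y, c, hX, hY, hY0, hXY⟩ := exists_eigenvector hG hE hd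
    exact hY0 (not_exists_eigenvector hl h hX hY hXY)
  · rintro ⟨H, F, g, δ, hF, hE, hd⟩
    exact (hasLieAlg_of_nondegOnKernel hG hF hE hd).1
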